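/- Let $m,M\ge 0$ and consider the one-dimensional Dirac–Klein–Gordon system $$(i\gamma_0\partial_t+\gamma_1\partial_x)\psi+m\psi=\phi\psi,\qquad (\partial_t^2-\partial_x^2+M^2)\phi=\psi^*\gamma_0\psi,$$ $$\gamma_0=\begin{pmatrix}1&0\\0&-1\end{pmatrix},\qquad \gamma_1=\begin{pmatrix}0&-i\\ i&0\end{pmatrix},$$ for $\psi(t,x)\in\mathbb{C}^2$ and $\phi(t,x)\in\mathbb{R}$, $x\in\mathbb{R}$. For $s\in\mathbb{R}$ let $\|f\|_{H^s}=\big(\int_{\mathbb{R}}(1+\xi^2)^{s}|\hat f(\xi)|^2\,d\xi\big)^{1/2}$ with $\hat f(\xi)=\int_{\mathbb{R}} e^{-ix\xi}f(x)\,dx$. Let $\psi_0\in H^{-1/2}(\mathbb{R};\mathbb{C}^2)$, let $\phi_0\in H^{1/2}(\mathbb{R})$ and $\phi_1\in H^{-1/2}(\mathbb{R})$ be real-valued, and let $\varepsilon>0$. Then there exist $T>0$, a solution $(\psi_\varepsilon,\phi_\varepsilon)$ of the system on $(-T,T)\times\mathbb{R}$ and a time $t_\varepsilon\in(0,\varepsilon)$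 with $t_\varepsilon<T$ such that $$\|\psi_\varepsilon(0)-\psi_0\|_{H^{-1/2}}+\|\phi_\varepsilon(0)-\phi_0\|_{H^{1/2}}+\|\partial_t\phi_\varepsilon(0)-\phi_1\|_{H^{-1/2}}<\varepsilon$$ and $$\|\phi_\varepsilon(t_\varepsilon)\|_{H^{1/2}}>\varepsilon^{-1}.$$ Here a solution is a classical one that stays in the critical spaces: $\psi_\varepsilon$ is $C^1$ and $\phi_\varepsilon$ is real-valued and $C^2$ on $(-T,T)\times\mathbb{R}$, both equations hold pointwise, $\psi_\varepsilon(t),\phi_\varepsilon(t),\partial_t\phi_\varepsilon(t)\in L^2(\mathbb{R})$ for every $t\in(-T,T)$, and $(\psi_\varepsilon,\phi_\varepsilon,\partial_t\phi_\varepsilon)\in C\big((-T,T);H^{-1/2}\times H^{1/2}\times H^{-1/2}\big)$. -/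

import Mathlib

open MeasureTheory TemperedDistribution FourierTransform
open scoped SchwartzMap ENNReal Topology Matrix

noncomputable section

namespace DKG

/-- The target space `ℂ²` of the Dirac field. -/
abbrev Spinor : Type := EuclideanSpace ℂ (Fin 2)

/-- The Dirac matrix `γ₀`. -/
def gamma0 : Matrix (Fin 2) (Fin 2) ℂ := !![1, 0; 0, -1]

/-- The Dirac matrix `γ₁`. -/
def gamma1 : Matrix (Fin 2) (Fin 2) ℂ := !![0, -Complex.I; Complex.I, 0]

/-- The symbol `⟨ξ⟩ ^ s = (1 + ξ ^ 2) ^ (s / 2)` at the angular frequency `ξ = 2 π η`, where `η`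
is the frequency variable of the Fourier transform of Mathlib. -/
def japaneseBracket (s η : ℝ) : ℝ := (1 + (2 * Real.pi * η) ^ 2) ^ (s / 2)

/-- The symbol has temperate growth, so that multiplication by it is defined on tempered
distributions. -/
theorem hasTemperateGrowth_japaneseBracket (s : ℝ) :
    (fun η : ℝ ↦ ((japaneseBracket s η : ℝ) : ℂ)).HasTemperateGrowth := by
  have h1 := Function.hasTemperateGrowth_one_add_norm_sq_rpow ℝ (s / 2)
  have h2 : (fun η : ℝ ↦ 2 * Real.pi * η).HasTemperateGrowth := by fun_prop
  have h3 := h1.comp h2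
  have h4 : (japaneseBracket s).HasTemperateGrowth := by
    have : japaneseBracket s
        = (fun x : ℝ ↦ (1 + ‖x‖ ^ 2) ^ (s / 2)) ∘ fun η ↦ 2 * Real.pi * η := by
      funext η
      simp only [japaneseBracket, Function.comp, Real.norm_eq_abs, sq_abs]
    rw [this]
    exact h3
  fun_prop

/-- The norm `‖f‖_{H^s} = (∫ ⟨ξ⟩ ^ (2 s) |f̂ ξ| ^ 2 dξ) ^ (1 / 2)` with
`f̂ ξ = ∫ exp (- i x ξ) f x dx`, extended by `∞` to the tempered distributions outside `H^s`.
Here `f̂ (2 π η) = 𝓕 f η`, so that `dξ = 2 π dη`. There is at most one `g` as in the infimum. -/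
def sobolevENorm {F : Type*} [NormedAddCommGroup F] [InnerProductSpace ℂ F] [CompleteSpace F]
    (s : ℝ) (f : 𝓢'(ℝ, F)) : ℝ≥0∞ :=
  ⨅ (g : Lp F 2 (volume : Measure ℝ))
    (_ : smulLeftCLM F (fun η : ℝ ↦ ((japaneseBracket s η : ℝ) : ℂ)) (𝓕 f) = (g : 𝓢'(ℝ, F))),
    ENNReal.ofReal (Real.sqrt (2 * Real.pi) * ‖g‖)

/-- A complex tempered distribution is real if it is real on real test functions. -/
def IsRealDistribution (f : 𝓢'(ℝ, ℂ)) : Prop :=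
  ∀ g : 𝓢(ℝ, ℂ), (∀ x, (g x).im = 0) → (f g).im = 0

open Classical in
/-- The tempered distribution given by a square integrable function (only used for these). -/
def toDistribution {F : Type*} [NormedAddCommGroup F] [InnerProductSpace ℂ F] [CompleteSpace F]
    (f : ℝ → F) : 𝓢'(ℝ, F) :=
  if h : MemLp f 2 (volume : Measure ℝ) then ((h.toLp f : Lp F 2 (volume : Measure ℝ)) : 𝓢'(ℝ, F))
  else 0

/-- The time derivative of a function of `(t, x)`. -/
def dt {F : Type*} [NormedAddCommGroup F] [NormedSpace ℝ F] (f : ℝ → ℝ → F) (t x : ℝ) : F :=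
  deriv (fun τ ↦ f τ x) t

/-- The space derivative of a function of `(t, x)`. -/
def dx {F : Type*} [NormedAddCommGroup F] [NormedSpace ℝ F] (f : ℝ → ℝ → F) (t x : ℝ) : F :=
  deriv (fun y ↦ f t y) x

/-- The real function `f` as a complex function. -/
def cplx (f : ℝ → ℝ) (x : ℝ) : ℂ := (f x : ℂ)

/-- `u` takes square integrable values on `(-T, T)` and, as a curve of tempered distributions,
lies in `C((-T, T); H^s)`. -/
structure IsSobolevCurve {F : Type*} [NormedAddCommGroup F] [InnerProductSpace ℂ F]
    [CompleteSpace F] (T s : ℝ) (u : ℝ → ℝ → F) : Prop where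
  memLp : ∀ t ∈ Set.Ioo (-T) T, MemLp (u t) 2 (volume : Measure ℝ)
  memSobolev : ∀ t ∈ Set.Ioo (-T) T, MemSobolev s 2 (toDistribution (u t))
  continuous : ∀ t ∈ Set.Ioo (-T) T,
    Filter.Tendsto (fun t' ↦ sobolevENorm s (toDistribution (u t') - toDistribution (u t)))
      (𝓝 t) (𝓝 0)

/-- `(ψ, φ)` is a classical solution on `(-T, T) × ℝ` of the Dirac-Klein-Gordon system
`(i γ₀ ∂ₜ + γ₁ ∂ₓ) ψ + m ψ = φ ψ`, `(∂ₜ² - ∂ₓ² + M²) φ = ψ* γ₀ ψ`, with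
`(ψ, φ, ∂ₜ φ) ∈ C((-T, T); H^s × H^r × H^(r - 1))`. -/
structure IsSolution (m M s r T : ℝ) (ψ : ℝ → ℝ → Spinor) (φ : ℝ → ℝ → ℝ) : Prop where
  contDiff_psi : ContDiffOn ℝ 1 (fun p : ℝ × ℝ ↦ ψ p.1 p.2) (Set.Ioo (-T) T ×ˢ Set.univ)
  contDiff_phi : ContDiffOn ℝ 2 (fun p : ℝ × ℝ ↦ φ p.1 p.2) (Set.Ioo (-T) T ×ˢ Set.univ)
  dirac : ∀ t ∈ Set.Ioo (-T) T, ∀ x : ℝ,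
    Complex.I • (gamma0 *ᵥ (dt ψ t x).ofLp) + gamma1 *ᵥ (dx ψ t x).ofLp
      + (m : ℂ) • (ψ t x).ofLp = (φ t x : ℂ) • (ψ t x).ofLp
  kleinGordon : ∀ t ∈ Set.Ioo (-T) T, ∀ x : ℝ,
    ((dt (dt φ) t x - dx (dx φ) t x + M ^ 2 * φ t x : ℝ) : ℂ)
      = star (ψ t x).ofLp ⬝ᵥ (gamma0 *ᵥ (ψ t x).ofLp)
  curve_psi : IsSobolevCurve T s ψ
  curve_phi : IsSobolevCurve T r (fun t ↦ cplx (φ t))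
  curve_dt_phi : IsSobolevCurve T (r - 1) (fun t ↦ cplx (dt φ t))

end DKG

end

/-!
The problem is ill-posed because the source `ψ* γ₀ ψ = Re (u v̄)` of the Klein-Gordon equation, with
`u` and `v` the sum and the difference of the two components of the spinor, is not controlled by
the norms of `u` and `v` in `H^{-1/2}`: if both concentrate near one point, then the product can be
arbitrarily large.

In the characteristic coordinates `x + t` and `x - t`, called `x` and `y` from here on, `u` is
transported along `y` and `v` along `x`, up to terms of lower order, and `q = ∂φ/∂x` has the
derivative `M² φ / 4 - Re (u v̄) / 4` in `y`. The system then consists of four integral equations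
along characteristics. With a cutoff in `x - y` it is solved by contraction in the Banach algebra of
bounded continuous functions on the plane (`exists_solution_integrated_system`), in a strip whose
width is inversely proportional to the size of the data for `u` and `v`
(`exists_characteristic_solution`). Here it matters that no smallness is needed beyond this scaling,
under which concentrating data behave like data of a fixed size. The solution is translated back to
space and time in `IsCharacteristicSolution.isSolution`; continuity in the Sobolev spaces comes from
finite speed of propagation and the embedding of `H¹` into `H^{1/2}`.

The given data are first replaced by smooth compactly supported ones, which are dense in `H^s` for
`s ≤ 1 / 2` (`exists_smooth_sobolevENorm_sub_lt`, `exists_real_smooth_sobolevENorm_sub_lt`). Let `B`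
be a smooth bump. The function `F'`, with `F = δ B(x / R)`, is added to the datum for `u`, and `G'`,
with `G = η ∑_{j < J} B(4^j x / l)`, to the datum for `v`; here `R` is so small that `G = η J` on
the support of `F`. The norm of `F'` in `H^{-1/2}` is of the order of at most `δ` whatever `R` is,
and that of `G'` is of the order of at most `η √J`, because the summands are almost orthogonal
(`exists_isWeightedFourier_sum_scales`). With `η = n⁻³` and `J = n⁴` this is `1 / n`.

On the other hand, integration of the source along both characteristics up to the time `2 l` gives
`φ ≈ η J F(x + t) / 4 = n F(x + t) / 4`, up to a bounded error
(`IsCharacteristicSolution.abs_sub_le`, `exists_solution_with_bump`). All other terms disappear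
in the limit `l → 0`, which is taken last, so that the time is also as short as desired. Finally a
function close to a bump of the height `n δ / 4` has a norm of the order of at least `n δ` in
`H^{1/2}`, however narrow the bump: this is seen by pairing it with a rescaled second derivative of
`B`, the norm of which in `H^{-1/2}` is independent of the scale up to a constant
(`IsWeightedFourier.bump_le_norm`).
-/

noncomputable section

namespace DKG

/-! ### Sobolev norms on the Fourier side -/

section Weighted

variable {F : Type*} [NormedAddCommGroup F] [InnerProductSpace ℂ F] [CompleteSpace F]

theorem japaneseBracket_pos (s η : ℝ) : 0 < japaneseBracket s η := by
  unfold japaneseBracket; positivity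

theorem japaneseBracket_mul (s r η : ℝ) :
    japaneseBracket s η * japaneseBracket r η = japaneseBracket (s + r) η := by
  unfold japaneseBracket
  rw [← Real.rpow_add (by positivity)]
  congr 1; ring

theorem japaneseBracket_zero (η : ℝ) : japaneseBracket 0 η = 1 := by
  simp [japaneseBracket]

theorem japaneseBracket_le_one {s : ℝ} (hs : s ≤ 0) (η : ℝ) : japaneseBracket s η ≤ 1 := by
  unfold japaneseBracket
  exact Real.rpow_le_one_of_one_le_of_nonpos (by nlinarith [sq_nonneg (2 * Real.pi * η)])
    (by linarith)

theorem abs_frequency_mul_japaneseBracket_le {s : ℝ} (hs : s ≤ -1) (η : ℝ) :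
    |2 * Real.pi * η| * japaneseBracket s η ≤ 1 := by
  have h1 : |2 * Real.pi * η| ≤ japaneseBracket 1 η := by
    unfold japaneseBracket
    rw [← Real.sqrt_eq_rpow]
    exact Real.abs_le_sqrt (by linarith)
  calc _ ≤ japaneseBracket 1 η * japaneseBracket s η := by
        gcongr; exact (japaneseBracket_pos s η).le
    _ = japaneseBracket (1 + s) η := japaneseBracket_mul _ _ _
    _ ≤ 1 := japaneseBracket_le_one (by linarith) η

theorem japaneseBracket_two (η : ℝ) : japaneseBracket 2 η = 1 + (2 * Real.pi * η) ^ 2 := by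
  simp [japaneseBracket]

/-- The square integrable function `g` represents `⟨ξ⟩ ^ s f̂`; such a `g` exists exactly when `f`
lies in `H^s`, and then its norm is that of `f`, up to the factor `√(2 π)`. -/
def IsWeightedFourier (s : ℝ) (f : 𝓢'(ℝ, F)) (g : Lp F 2 (volume : Measure ℝ)) : Prop :=
  smulLeftCLM F (fun η : ℝ ↦ ((japaneseBracket s η : ℝ) : ℂ)) (𝓕 f) = (g : 𝓢'(ℝ, F))

theorem toTemperedDistribution_injective :
    Function.Injective (Lp.toTemperedDistributionCLM F (volume : Measure ℝ) 2) := by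
  have := Lp.ker_toTemperedDistributionCLM_eq_bot (F := F) (μ := (volume : Measure ℝ)) (p := 2)
  exact LinearMap.ker_eq_bot.1 this

theorem eq_of_toTemperedDistribution_eq {f g : Lp F 2 (volume : Measure ℝ)}
    (h : (f : 𝓢'(ℝ, F)) = (g : 𝓢'(ℝ, F))) : f = g :=
  toTemperedDistribution_injective h

theorem IsWeightedFourier.add {s : ℝ} {f f' : 𝓢'(ℝ, F)} {g g' : Lp F 2 (volume : Measure ℝ)}
    (h : IsWeightedFourier s f g) (h' : IsWeightedFourier s f' g') :
    IsWeightedFourier s (f + f') (g + g') := by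
  unfold IsWeightedFourier at *
  rw [FourierTransform.fourier_add, map_add, h, h']
  exact (map_add (Lp.toTemperedDistributionCLM F (volume : Measure ℝ) 2) g g').symm

theorem IsWeightedFourier.smul {s : ℝ} {f : 𝓢'(ℝ, F)} {g : Lp F 2 (volume : Measure ℝ)}
    (c : ℂ) (h : IsWeightedFourier s f g) :
    IsWeightedFourier s (c • f) (c • g) := by
  unfold IsWeightedFourier at *
  rw [FourierTransform.fourier_smul, map_smul, h]
  exact (map_smul (Lp.toTemperedDistributionCLM F (volume : Measure ℝ) 2) c g).symm

theorem IsWeightedFourier.zero (s : ℝ) : IsWeightedFourier s (0 : 𝓢'(ℝ, F)) 0 := by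
  unfold IsWeightedFourier
  rw [FourierTransform.fourier_zero, map_zero]
  exact (map_zero (Lp.toTemperedDistributionCLM F (volume : Measure ℝ) 2)).symm

theorem IsWeightedFourier.sub {s : ℝ} {f f' : 𝓢'(ℝ, F)} {g g' : Lp F 2 (volume : Measure ℝ)}
    (h : IsWeightedFourier s f g) (h' : IsWeightedFourier s f' g') :
    IsWeightedFourier s (f - f') (g - g') := by
  have := h.add (h'.smul (-1))
  simpa [sub_eq_add_neg] using this

theorem IsWeightedFourier.sobolevENorm_eq {s : ℝ} {f : 𝓢'(ℝ, F)}
    {g : Lp F 2 (volume : Measure ℝ)} (h : IsWeightedFourier s f g) :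
    sobolevENorm s f = ENNReal.ofReal (Real.sqrt (2 * Real.pi) * ‖g‖) := by
  unfold sobolevENorm
  apply le_antisymm
  · exact iInf₂_le g h
  · refine le_iInf₂ fun g' h' ↦ ?_
    have : g = g' := eq_of_toTemperedDistribution_eq (h.symm.trans h')
    rw [this]

theorem sobolevENorm_eq_top {s : ℝ} {f : 𝓢'(ℝ, F)} (h : ∀ g, ¬ IsWeightedFourier s f g) :
    sobolevENorm s f = ∞ := by
  unfold sobolevENorm
  exact iInf₂_eq_top.2 fun g hg ↦ (h g hg).elim

theorem sobolevENorm_add_le (s : ℝ) (f f' : 𝓢'(ℝ, F)) :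
    sobolevENorm s (f + f') ≤ sobolevENorm s f + sobolevENorm s f' := by
  by_cases h : ∃ g, IsWeightedFourier s f g
  · obtain ⟨g, hg⟩ := h
    by_cases h' : ∃ g, IsWeightedFourier s f' g
    · obtain ⟨g', hg'⟩ := h'
      rw [hg.sobolevENorm_eq, hg'.sobolevENorm_eq, (hg.add hg').sobolevENorm_eq,
        ← ENNReal.ofReal_add (by positivity) (by positivity), ← mul_add]
      gcongr
      exact norm_add_le _ _
    · rw [sobolevENorm_eq_top (not_exists.1 h')]; simp
  · rw [sobolevENorm_eq_top (not_exists.1 h)]; simp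

/-- Multiplication by a bounded symbol on `L²`. -/
theorem exists_symbol_mul {a : ℝ → ℂ} (ha : a.HasTemperateGrowth) {C : ℝ}
    (hC : ∀ η, ‖a η‖ ≤ C) (h : Lp F 2 (volume : Measure ℝ)) :
    ∃ h' : Lp F 2 (volume : Measure ℝ), (∀ᵐ η, h' η = a η • h η) ∧ ‖h'‖ ≤ C * ‖h‖ ∧
      smulLeftCLM F a (h : 𝓢'(ℝ, F)) = (h' : 𝓢'(ℝ, F)) := by
  have hm : MemLp a ∞ (volume : Measure ℝ) :=
    memLp_top_of_bound ha.1.continuous.aestronglyMeasurable C (Filter.Eventually.of_forall hC)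
  refine ⟨(hm.toLp a : Lp ℂ ∞ (volume : Measure ℝ)) • h, ?_, ?_, ?_⟩
  · filter_upwards [Lp.coeFn_lpSMul (r := 2) (hm.toLp a) h, hm.coeFn_toLp] with x h1 h2
    rw [h1, ← h2]; rfl
  · have h1 : ∀ᵐ η, ‖((hm.toLp a : Lp ℂ ∞ (volume : Measure ℝ)) • h : Lp F 2 volume) η‖
        ≤ C * ‖h η‖ := by
      filter_upwards [Lp.coeFn_lpSMul (r := 2) (hm.toLp a) h, hm.coeFn_toLp] with x h1 h2
      rw [h1]
      change ‖(hm.toLp a) x • h x‖ ≤ _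
      rw [h2, norm_smul]
      gcongr
      exact hC x
    exact Lp.norm_le_mul_norm_of_ae_le_mul h1
  · exact (Lp.toTemperedDistribution_smul_eq ha hm h).symm

/-- If `f` lies in `H^s`, then `b f̂` is square integrable for every symbol `b = a ⟨ξ⟩ ^ s` with a
bounded factor `a`. -/
theorem IsWeightedFourier.symbol_mul {s : ℝ} {f : 𝓢'(ℝ, F)} {g : Lp F 2 (volume : Measure ℝ)}
    (h : IsWeightedFourier s f g) {a b : ℝ → ℂ} (ha : a.HasTemperateGrowth) {C : ℝ}
    (hC : ∀ η, ‖a η‖ ≤ C) (hb : ∀ η, a η * (japaneseBracket s η : ℂ) = b η) :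
    ∃ h' : Lp F 2 (volume : Measure ℝ), (∀ᵐ η, h' η = a η • g η) ∧ ‖h'‖ ≤ C * ‖g‖ ∧
      smulLeftCLM F b (𝓕 f) = (h' : 𝓢'(ℝ, F)) := by
  obtain ⟨h', h1, h2, h3⟩ := exists_symbol_mul ha hC g
  refine ⟨h', h1, h2, ?_⟩
  rw [← h3, ← h, smulLeftCLM_smulLeftCLM_apply (hasTemperateGrowth_japaneseBracket s) ha]
  congr 2
  funext η
  rw [← hb, mul_comm]; rfl

/-- The symbol `⟨ξ⟩ ^ s` at `ξ = 2 π η` is comparable with `(1 + η ^ 2) ^ (s / 2)`. -/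
theorem japaneseBracket_comparison (s η : ℝ) :
    (1 + ‖η‖ ^ 2) ^ (s / 2) * japaneseBracket (-s) η ≤ max 1 ((2 * Real.pi) ^ (-s)) ∧
    japaneseBracket s η * (1 + ‖η‖ ^ 2) ^ (-s / 2) ≤ max 1 ((2 * Real.pi) ^ s) := by
  have h2 : (1 : ℝ) ≤ 2 * Real.pi := by nlinarith [Real.pi_gt_three]
  have key : ∀ r : ℝ, (1 + ‖η‖ ^ 2) ^ (r / 2) ≤ max 1 ((2 * Real.pi) ^ (-r))
      * japaneseBracket r η ∧
      japaneseBracket r η ≤ max 1 ((2 * Real.pi) ^ r) * (1 + ‖η‖ ^ 2) ^ (r / 2) := by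
    intro r
    have hle : 1 + ‖η‖ ^ 2 ≤ 1 + (2 * Real.pi * η) ^ 2 := by
      rw [Real.norm_eq_abs, sq_abs, mul_pow]
      nlinarith [sq_nonneg η, one_le_pow₀ h2 (n := 2)]
    have hge : 1 + (2 * Real.pi * η) ^ 2 ≤ (2 * Real.pi) ^ 2 * (1 + ‖η‖ ^ 2) := by
      rw [Real.norm_eq_abs, sq_abs, mul_pow]
      nlinarith [sq_nonneg η, one_le_pow₀ h2 (n := 2)]
    have hsplit : ((2 * Real.pi) ^ 2 * (1 + ‖η‖ ^ 2)) ^ (r / 2)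
        = (2 * Real.pi) ^ r * (1 + ‖η‖ ^ 2) ^ (r / 2) := by
      rw [Real.mul_rpow (by positivity) (by positivity), ← Real.rpow_natCast,
        ← Real.rpow_mul (by positivity)]
      congr 2; push_cast; ring
    have hp : 0 < (1 + ‖η‖ ^ 2) ^ (r / 2) := by positivity
    have hj := japaneseBracket_pos r η
    have hpi : (2 * Real.pi) ^ (-r) * (2 * Real.pi) ^ r = 1 := by
      rw [← Real.rpow_add (by positivity)]; simp
    have hpr : 0 < (2 * Real.pi) ^ r := by positivity
    have hpr' : 0 < (2 * Real.pi) ^ (-r) := by positivity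
    rcases le_total 0 r with hr | hr
    · have h3 : (1 + ‖η‖ ^ 2) ^ (r / 2) ≤ japaneseBracket r η :=
        Real.rpow_le_rpow (by positivity) hle (by linarith)
      have h4 : japaneseBracket r η ≤ (2 * Real.pi) ^ r * (1 + ‖η‖ ^ 2) ^ (r / 2) := by
        rw [← hsplit]; exact Real.rpow_le_rpow (by positivity) hge (by linarith)
      exact ⟨h3.trans (le_mul_of_one_le_left hj.le (le_max_left _ _)),
        h4.trans (mul_le_mul_of_nonneg_right (le_max_right _ _) hp.le)⟩
    · have h3 : japaneseBracket r η ≤ (1 + ‖η‖ ^ 2) ^ (r / 2) :=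
        Real.rpow_le_rpow_of_nonpos (by positivity) hle (by linarith)
      have h4 : (2 * Real.pi) ^ r * (1 + ‖η‖ ^ 2) ^ (r / 2) ≤ japaneseBracket r η := by
        rw [← hsplit]; exact Real.rpow_le_rpow_of_nonpos (by positivity) hge (by linarith)
      refine ⟨?_, h3.trans (le_mul_of_one_le_left hp.le (le_max_left _ _))⟩
      calc (1 + ‖η‖ ^ 2) ^ (r / 2)
          = (2 * Real.pi) ^ (-r) * ((2 * Real.pi) ^ r * (1 + ‖η‖ ^ 2) ^ (r / 2)) := by
            rw [← mul_assoc, hpi, one_mul]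
        _ ≤ (2 * Real.pi) ^ (-r) * japaneseBracket r η := by gcongr
        _ ≤ _ := by gcongr; exact le_max_right _ _
  constructor
  · calc _ ≤ (max 1 ((2 * Real.pi) ^ (-s)) * japaneseBracket s η) * japaneseBracket (-s) η := by
          gcongr
          · exact (japaneseBracket_pos _ _).le
          · exact (key s).1
      _ = _ := by
          rw [mul_assoc, japaneseBracket_mul, add_neg_cancel, japaneseBracket_zero, mul_one]
  · calc _ ≤ (max 1 ((2 * Real.pi) ^ s) * (1 + ‖η‖ ^ 2) ^ (s / 2))
            * (1 + ‖η‖ ^ 2) ^ (-s / 2) := by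
          gcongr
          exact (key s).2
      _ = _ := by
          rw [mul_assoc, ← Real.rpow_add (by positivity)]
          simp [neg_div]

/-- The Sobolev spaces of Mathlib, whose weight is `(1 + η ^ 2) ^ (s / 2)` without the factor
`2 π`, are the same. -/
theorem memSobolev_iff_exists_isWeightedFourier {s : ℝ} {f : 𝓢'(ℝ, F)} :
    MemSobolev s 2 f ↔ ∃ g, IsWeightedFourier s f g := by
  have htg : ∀ r : ℝ, (fun x : ℝ ↦ (((1 + ‖x‖ ^ 2) ^ r : ℝ) : ℂ)).HasTemperateGrowth := by
    intro r; fun_prop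
  rw [memSobolev_iff_exists_smulLeftCLM_fourier]
  constructor
  · rintro ⟨g, hg⟩
    have ha : (fun η : ℝ ↦ (((1 + ‖η‖ ^ 2) ^ (-s / 2) : ℝ) : ℂ)
        * ((japaneseBracket s η : ℝ) : ℂ)).HasTemperateGrowth :=
      (htg _).mul (hasTemperateGrowth_japaneseBracket s)
    obtain ⟨h', -, -, h3⟩ := exists_symbol_mul ha (C := max 1 ((2 * Real.pi) ^ s)) (fun η ↦ by
      rw [← Complex.ofReal_mul, Complex.norm_real, Real.norm_of_nonneg
        (mul_nonneg (by positivity) (japaneseBracket_pos _ _).le), mul_comm]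
      exact (japaneseBracket_comparison s η).2) g
    refine ⟨h', ?_⟩
    unfold IsWeightedFourier
    rw [← h3, ← hg, smulLeftCLM_smulLeftCLM_apply (htg _) ha]
    congr 2
    funext η
    simp only [Pi.mul_apply]
    rw [← mul_assoc, ← Complex.ofReal_mul, ← Real.rpow_add (by positivity)]
    simp [neg_div]
  · rintro ⟨g, hg⟩
    have ha : (fun η : ℝ ↦ (((1 + ‖η‖ ^ 2) ^ (s / 2) : ℝ) : ℂ)
        * ((japaneseBracket (-s) η : ℝ) : ℂ)).HasTemperateGrowth :=
      (htg _).mul (hasTemperateGrowth_japaneseBracket (-s))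
    obtain ⟨h', -, -, h3⟩ := hg.symbol_mul
      (b := fun η : ℝ ↦ (((1 + ‖η‖ ^ 2) ^ (s / 2) : ℝ) : ℂ)) ha
      (C := max 1 ((2 * Real.pi) ^ (-s))) (fun η ↦ by
      rw [← Complex.ofReal_mul, Complex.norm_real, Real.norm_of_nonneg
        (mul_nonneg (by positivity) (japaneseBracket_pos _ _).le)]
      exact (japaneseBracket_comparison s η).1) (fun η ↦ by
        rw [mul_assoc, ← Complex.ofReal_mul, japaneseBracket_mul, neg_add_cancel,
          japaneseBracket_zero]; simp)
    exact ⟨h', h3⟩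

/-- A square integrable function lies in `H^s` for `s ≤ 0`, with the norm at most that in `L²`. -/
theorem exists_isWeightedFourier_of_nonpos {s : ℝ} (hs : s ≤ 0)
    (f : Lp F 2 (volume : Measure ℝ)) :
    ∃ g : Lp F 2 (volume : Measure ℝ), IsWeightedFourier s (f : 𝓢'(ℝ, F)) g ∧ ‖g‖ ≤ ‖f‖ ∧
      ∀ᵐ η, g η = ((japaneseBracket s η : ℝ) : ℂ) • (𝓕 f : Lp F 2 (volume : Measure ℝ)) η := by
  obtain ⟨h', h1, h2, h3⟩ := exists_symbol_mul (hasTemperateGrowth_japaneseBracket s) (C := 1)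
    (fun η ↦ by
      rw [Complex.norm_real, Real.norm_of_nonneg (japaneseBracket_pos _ _).le]
      exact japaneseBracket_le_one hs η) (𝓕 f : Lp F 2 (volume : Measure ℝ))
  refine ⟨h', ?_, by simpa using h2, h1⟩
  unfold IsWeightedFourier
  rw [Lp.fourier_toTemperedDistribution_eq, h3]

/-- The square integrable `f'` is the distributional derivative of the square integrable `f`. -/
def IsWeakDeriv (f f' : Lp F 2 (volume : Measure ℝ)) : Prop :=
  LineDeriv.lineDerivOp (1 : ℝ) (f : 𝓢'(ℝ, F)) = (f' : 𝓢'(ℝ, F))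

/-- Differentiation maps `L²` to `H^s` for `s ≤ -1`. -/
theorem IsWeakDeriv.exists_isWeightedFourier_deriv {f f' : Lp F 2 (volume : Measure ℝ)}
    (h : IsWeakDeriv f f')
    {s : ℝ} (hs : s ≤ -1) :
    ∃ g : Lp F 2 (volume : Measure ℝ), IsWeightedFourier s (f' : 𝓢'(ℝ, F)) g ∧ ‖g‖ ≤ ‖f‖ := by
  have hlin : (fun η : ℝ ↦ ((inner ℝ η (1 : ℝ) : ℝ) : ℂ)).HasTemperateGrowth := by fun_prop
  have ha : (fun η : ℝ ↦ (2 * Real.pi * Complex.I) * (((inner ℝ η (1 : ℝ) : ℝ) : ℂ)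
      * ((japaneseBracket s η : ℝ) : ℂ))).HasTemperateGrowth :=
    (Function.HasTemperateGrowth.const _).mul
      (hlin.mul (hasTemperateGrowth_japaneseBracket s))
  obtain ⟨h', h1, h2, h3⟩ := exists_symbol_mul ha (C := 1)
    (fun η ↦ by
      have := abs_frequency_mul_japaneseBracket_le hs η
      simp only [norm_mul, Complex.norm_real, Complex.norm_I, Complex.norm_ofNat,
        Real.norm_of_nonneg (japaneseBracket_pos s η).le, Real.norm_of_nonneg Real.pi_pos.le]
      rw [abs_mul, abs_of_pos Real.two_pi_pos] at this
      simpa [mul_assoc] using this) (𝓕 f : Lp F 2 (volume : Measure ℝ))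
  refine ⟨h', ?_, by simpa using h2⟩
  unfold IsWeightedFourier
  rw [← h3, ← h, TemperedDistribution.fourier_lineDerivOp_eq, map_smul,
    smulLeftCLM_smulLeftCLM_apply hlin (hasTemperateGrowth_japaneseBracket s),
    ← Lp.fourier_toTemperedDistribution_eq]
  rw [show (fun η : ℝ ↦ (2 * Real.pi * Complex.I) * (((inner ℝ η (1 : ℝ) : ℝ) : ℂ)
      * ((japaneseBracket s η : ℝ) : ℂ))) = (2 * Real.pi * Complex.I : ℂ) •
      ((fun η : ℝ ↦ ((inner ℝ η (1 : ℝ) : ℝ) : ℂ)) * fun η ↦ ((japaneseBracket s η : ℝ) : ℂ))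
      from rfl, smulLeftCLM_smul (hlin.mul (hasTemperateGrowth_japaneseBracket s))]
  rfl

/-- In the inner product of `H^{-1/2}` of a derivative `f'` with `k`, the weight `⟨ξ⟩ ^ (-1)`
absorbs the derivative, so that only the norms of `f` and `k` in `L²` enter. -/
theorem IsWeakDeriv.norm_inner_le {f f' k : Lp F 2 (volume : Measure ℝ)} (h : IsWeakDeriv f f')
    {g g' : Lp F 2 (volume : Measure ℝ)}
    (hg : IsWeightedFourier (-(1 / 2)) (f' : 𝓢'(ℝ, F)) g)
    (hg' : IsWeightedFourier (-(1 / 2)) (k : 𝓢'(ℝ, F)) g') :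
    ‖inner ℂ g g'‖ ≤ ‖f‖ * ‖k‖ := by
  obtain ⟨e, he1, he2⟩ := h.exists_isWeightedFourier_deriv le_rfl
  obtain ⟨e', he1', -, he3'⟩ := exists_isWeightedFourier_of_nonpos (s := -1) (by norm_num) f'
  obtain ⟨g1, hg1, -, hg2⟩ := exists_isWeightedFourier_of_nonpos (s := -(1 / 2)) (by norm_num) f'
  obtain ⟨g1', hg1', -, hg2'⟩ := exists_isWeightedFourier_of_nonpos (s := -(1 / 2)) (by norm_num) k
  obtain rfl : g = g1 := eq_of_toTemperedDistribution_eq (hg.symm.trans hg1)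
  obtain rfl : g' = g1' := eq_of_toTemperedDistribution_eq (hg'.symm.trans hg1')
  obtain rfl : e = e' := eq_of_toTemperedDistribution_eq (he1.symm.trans he1')
  have : inner ℂ g g' = inner ℂ e (𝓕 k : Lp F 2 (volume : Measure ℝ)) := by
    rw [L2.inner_def, L2.inner_def]
    apply integral_congr_ae
    filter_upwards [hg2, hg2', he3'] with η h1 h2 h3
    rw [h1, h2, h3, inner_smul_left, inner_smul_right, inner_smul_left, Complex.conj_ofReal,
      Complex.conj_ofReal, ← mul_assoc, ← Complex.ofReal_mul, japaneseBracket_mul]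
    norm_num
  rw [this]
  calc _ ≤ ‖e‖ * ‖(𝓕 k : Lp F 2 (volume : Measure ℝ))‖ := norm_inner_le_norm _ _
    _ ≤ _ := by rw [Lp.norm_fourier_eq]; gcongr

/-- `H¹` embeds into `H^{1/2}`. The weight `⟨ξ⟩ ^ (1 / 2)` is split as
`⟨ξ⟩ ^ (-3 / 2) + ξ ^ 2 ⟨ξ⟩ ^ (-3 / 2)`, with one factor `ξ` used for the derivative. -/
theorem IsWeakDeriv.exists_isWeightedFourier {f f' : Lp F 2 (volume : Measure ℝ)}
    (h : IsWeakDeriv f f') :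
    ∃ g : Lp F 2 (volume : Measure ℝ), IsWeightedFourier (1 / 2) (f : 𝓢'(ℝ, F)) g ∧
      ‖g‖ ≤ ‖f‖ + ‖f'‖ := by
  have hlin : (fun η : ℝ ↦ ((inner ℝ η (1 : ℝ) : ℝ) : ℂ)).HasTemperateGrowth := by fun_prop
  have hw := hasTemperateGrowth_japaneseBracket (-(3 / 2))
  have ha : (fun η : ℝ ↦ (-(2 * Real.pi * Complex.I)) * (((inner ℝ η (1 : ℝ) : ℝ) : ℂ)
      * ((japaneseBracket (-(3 / 2)) η : ℝ) : ℂ))).HasTemperateGrowth :=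
    (Function.HasTemperateGrowth.const _).mul (hlin.mul hw)
  have hc : ((2 * Real.pi * Complex.I : ℂ) • ((fun η : ℝ ↦ ((inner ℝ η (1 : ℝ) : ℝ) : ℂ)) *
      fun η : ℝ ↦ (-(2 * Real.pi * Complex.I)) * (((inner ℝ η (1 : ℝ) : ℝ) : ℂ)
      * ((japaneseBracket (-(3 / 2)) η : ℝ) : ℂ)))).HasTemperateGrowth :=
    (Function.HasTemperateGrowth.const (2 * Real.pi * Complex.I : ℂ)).mul (hlin.mul ha)
  obtain ⟨g1, h1, h2, -⟩ := exists_isWeightedFourier_of_nonpos (s := -(3 / 2)) (by norm_num) f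
  obtain ⟨g2, -, h4, h5⟩ := exists_symbol_mul ha (C := 1)
    (fun η ↦ by
      have := abs_frequency_mul_japaneseBracket_le (s := -(3 / 2)) (by norm_num) η
      simp only [norm_mul, norm_neg, Complex.norm_real, Complex.norm_I, Complex.norm_ofNat,
        Real.norm_of_nonneg (japaneseBracket_pos (-(3 / 2)) η).le,
        Real.norm_of_nonneg Real.pi_pos.le]
      rw [abs_mul, abs_of_pos Real.two_pi_pos] at this
      simpa [mul_assoc] using this) (𝓕 f' : Lp F 2 (volume : Measure ℝ))
  refine ⟨g1 + g2, ?_, (norm_add_le _ _).trans (add_le_add h2 (by simpa using h4))⟩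
  unfold IsWeightedFourier at *
  have e : ((g1 + g2 : Lp F 2 (volume : Measure ℝ)) : 𝓢'(ℝ, F)) = (g1 : 𝓢'(ℝ, F))
      + (g2 : 𝓢'(ℝ, F)) := map_add (Lp.toTemperedDistributionCLM F (volume : Measure ℝ) 2) g1 g2
  rw [e, ← h1, ← h5, ← Lp.fourier_toTemperedDistribution_eq, ← h,
    TemperedDistribution.fourier_lineDerivOp_eq, map_smul,
    smulLeftCLM_smulLeftCLM_apply hlin ha, ← smul_apply,
    ← smulLeftCLM_smul (hlin.mul ha), ← add_apply, ← smulLeftCLM_add hw hc]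
  congr 2
  funext η
  have h3 : japaneseBracket (1 / 2) η = japaneseBracket 2 η * japaneseBracket (-(3 / 2)) η := by
    rw [japaneseBracket_mul]; norm_num
  simp only [Pi.add_apply, Pi.smul_apply, Pi.mul_apply, smul_eq_mul, h3, japaneseBracket_two]
  push_cast
  simp only [inner, one_mul]
  linear_combination ((2 * Real.pi * η) ^ 2 * (japaneseBracket (-(3 / 2)) η : ℂ)) * Complex.I_sq

end Weighted

/-! ### Smooth compactly supported functions are dense -/

section Density

variable {F : Type*} [NormedAddCommGroup F] [InnerProductSpace ℂ F] [CompleteSpace F]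

theorem toDistribution_eq {f : ℝ → F} (h : MemLp f 2 (volume : Measure ℝ)) :
    toDistribution f = ((h.toLp f : Lp F 2 (volume : Measure ℝ)) : 𝓢'(ℝ, F)) := by
  rw [toDistribution, dif_pos h]

theorem toDistribution_schwartz (f : 𝓢(ℝ, F)) :
    toDistribution (f : ℝ → F) = (f : 𝓢'(ℝ, F)) := by
  rw [toDistribution_eq (f.memLp 2), ← Lp.toTemperedDistribution_toLp_eq (p := 2)]
  rfl

theorem toDistribution_apply {f : ℝ → F} (h : MemLp f 2 (volume : Measure ℝ)) (g : 𝓢(ℝ, ℂ)) :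
    toDistribution f g = ∫ x, g x • f x := by
  rw [toDistribution_eq h, Lp.toTemperedDistribution_apply]
  apply integral_congr_ae
  filter_upwards [h.coeFn_toLp] with x hx
  rw [hx]

theorem toDistribution_add {f g : ℝ → F} (hf : MemLp f 2 (volume : Measure ℝ))
    (hg : MemLp g 2 (volume : Measure ℝ)) :
    toDistribution (f + g) = toDistribution f + toDistribution g := by
  rw [toDistribution_eq hf, toDistribution_eq hg, toDistribution_eq (hf.add hg), MemLp.toLp_add]
  exact map_add (Lp.toTemperedDistributionCLM F (volume : Measure ℝ) 2) _ _

theorem toDistribution_sub {f g : ℝ → F} (hf : MemLp f 2 (volume : Measure ℝ))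
    (hg : MemLp g 2 (volume : Measure ℝ)) :
    toDistribution (f - g) = toDistribution f - toDistribution g := by
  rw [toDistribution_eq hf, toDistribution_eq hg, toDistribution_eq (hf.sub hg), MemLp.toLp_sub]
  exact map_sub (Lp.toTemperedDistributionCLM F (volume : Measure ℝ) 2) _ _

/-- A classical derivative is a distributional derivative. -/
theorem isWeakDeriv_of_hasDerivAt {f f' : ℝ → F} (hf : MemLp f 2 (volume : Measure ℝ))
    (hf' : MemLp f' 2 (volume : Measure ℝ)) (h : ∀ x, HasDerivAt f (f' x) x) :
    IsWeakDeriv (hf.toLp f) (hf'.toLp f') := by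
  unfold IsWeakDeriv
  ext g
  rw [← toDistribution_eq hf, ← toDistribution_eq hf', TemperedDistribution.lineDerivOp_apply_apply,
    toDistribution_apply hf, toDistribution_apply hf']
  have hg : ∀ k : 𝓢(ℝ, ℂ), ∀ k' : ℝ → F, MemLp k' 2 (volume : Measure ℝ) →
      Integrable (fun x ↦ k x • k' x) := by
    intro k k' hk'
    exact memLp_one_iff_integrable.1 (hk'.smul (k.memLp 2))
  have := integral_bilinear_hasDerivAt_right_eq_neg_left_of_integrable
    (L := (ContinuousLinearMap.lsmul ℝ ℂ : ℂ →L[ℝ] F →L[ℝ] F)) (u := g) (v := f)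
    (u' := deriv g) (v' := f') (fun x _ ↦ g.hasDerivAt x) (fun x _ ↦ h x)
    (hg g f' hf') (by
      have := hg (SchwartzMap.derivCLM ℂ ℂ g) f hf
      simpa using this) (hg g f hf)
  simp only [ContinuousLinearMap.lsmul_apply] at this
  rw [this, ← integral_neg]
  apply integral_congr_ae
  filter_upwards with x
  simp [SchwartzMap.lineDerivOp_apply_eq_fderiv]

/-- The embedding of `H¹` into `H^s`, `s ≤ 1 / 2`, for classical derivatives. -/
theorem exists_isWeightedFourier_of_le_half {s : ℝ} (hs : s ≤ 1 / 2) {f f' : ℝ → F}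
    (hf : MemLp f 2 (volume : Measure ℝ))
    (hf' : MemLp f' 2 (volume : Measure ℝ)) (h : ∀ x, HasDerivAt f (f' x) x) :
    ∃ g : Lp F 2 (volume : Measure ℝ), IsWeightedFourier s (toDistribution f) g ∧
      ‖g‖ ≤ ‖hf.toLp f‖ + ‖hf'.toLp f'‖ := by
  obtain ⟨g, hg1, hg2⟩ := (isWeakDeriv_of_hasDerivAt hf hf' h).exists_isWeightedFourier
  rw [← toDistribution_eq hf] at hg1
  obtain ⟨g', -, h2, h3⟩ := hg1.symbol_mul
    (b := fun η ↦ ((japaneseBracket s η : ℝ) : ℂ))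
    (hasTemperateGrowth_japaneseBracket (s - 1 / 2)) (C := 1) (fun η ↦ by
      rw [Complex.norm_real, Real.norm_of_nonneg (japaneseBracket_pos _ _).le]
      exact japaneseBracket_le_one (by linarith) η) (fun η ↦ by
      rw [← Complex.ofReal_mul, japaneseBracket_mul]; simp)
  exact ⟨g', h3, (by simpa using h2 : ‖g'‖ ≤ ‖g‖).trans hg2⟩

theorem sobolevENorm_le_of_hasDerivAt {s : ℝ} (hs : s ≤ 1 / 2) {f f' : ℝ → F}
    (hf : MemLp f 2 (volume : Measure ℝ))
    (hf' : MemLp f' 2 (volume : Measure ℝ)) (h : ∀ x, HasDerivAt f (f' x) x) :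
    sobolevENorm s (toDistribution f) ≤ ENNReal.ofReal (Real.sqrt (2 * Real.pi)) *
      (eLpNorm f 2 volume + eLpNorm f' 2 volume) := by
  obtain ⟨g, hg1, hg2⟩ := exists_isWeightedFourier_of_le_half hs hf hf' h
  rw [hg1.sobolevENorm_eq, ENNReal.ofReal_mul (by positivity)]
  gcongr
  rw [Lp.norm_toLp, Lp.norm_toLp] at hg2
  refine (ENNReal.ofReal_le_ofReal hg2).trans ?_
  rw [ENNReal.ofReal_add (by positivity) (by positivity), ENNReal.ofReal_toReal hf.2.ne,
    ENNReal.ofReal_toReal hf'.2.ne]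

theorem sobolevENorm_le_of_nonpos {s : ℝ} (hs : s ≤ 0) {f : ℝ → F}
    (hf : MemLp f 2 (volume : Measure ℝ)) :
    sobolevENorm s (toDistribution f) ≤ ENNReal.ofReal (Real.sqrt (2 * Real.pi)) *
      eLpNorm f 2 volume := by
  obtain ⟨g, hg1, hg2, -⟩ := exists_isWeightedFourier_of_nonpos hs (hf.toLp f)
  rw [← toDistribution_eq] at hg1
  rw [hg1.sobolevENorm_eq, ENNReal.ofReal_mul (by positivity)]
  gcongr
  rw [Lp.norm_toLp] at hg2
  refine (ENNReal.ofReal_le_ofReal hg2).trans ?_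
  rw [ENNReal.ofReal_toReal hf.2.ne]

/-- Schwartz functions are dense in `H^s`. -/
theorem exists_schwartz_sobolevENorm_sub_lt {s : ℝ} {f : 𝓢'(ℝ, F)} (hf : MemSobolev s 2 f)
    {δ : ℝ} (hδ : 0 < δ) :
    ∃ k : 𝓢(ℝ, F), (∃ g, IsWeightedFourier s (f - (k : 𝓢'(ℝ, F))) g) ∧
      sobolevENorm s (f - (k : 𝓢'(ℝ, F))) < ENNReal.ofReal δ := by
  obtain ⟨g, hg⟩ := memSobolev_iff_exists_isWeightedFourier.1 hf
  have h2π : 0 < Real.sqrt (2 * Real.pi) := by positivity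
  obtain ⟨h, hh⟩ := (SchwartzMap.denseRange_toLpCLM (E := ℝ) (F := F) (p := 2)
    (μ := volume) (by simp)).exists_dist_lt g (div_pos hδ h2π)
  have htg := hasTemperateGrowth_japaneseBracket
  let k : 𝓢(ℝ, F) := SchwartzMap.fourierMultiplierCLM F
    (fun η : ℝ ↦ ((japaneseBracket (-s) η : ℝ) : ℂ)) (𝓕⁻ h)
  have hk : IsWeightedFourier s (k : 𝓢'(ℝ, F)) (h.toLp 2) := by
    unfold IsWeightedFourier
    rw [← fourierMultiplierCLM_toTemperedDistributionCLM_eq (htg _), fourierMultiplierCLM_apply,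
      FourierTransform.fourier_fourierInv_eq, smulLeftCLM_smulLeftCLM_apply (htg _) (htg _),
      fourier_toTemperedDistributionCLM_eq, FourierTransform.fourier_fourierInv_eq,
      Lp.toTemperedDistribution_toLp_eq]
    convert smulLeftCLM_const (1 : ℂ) (h : 𝓢'(ℝ, F)) using 1
    · congr 2
      funext η
      simp only [Pi.mul_apply]
      rw [← Complex.ofReal_mul, japaneseBracket_mul, neg_add_cancel, japaneseBracket_zero]
      simp
    · simp
  refine ⟨k, ⟨_, hg.sub hk⟩, ?_⟩
  rw [(hg.sub hk).sobolevENorm_eq, ENNReal.ofReal_lt_ofReal_iff hδ]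
  rw [dist_eq_norm] at hh
  calc _ < Real.sqrt (2 * Real.pi) * (δ / Real.sqrt (2 * Real.pi)) := by
        gcongr; exact hh
    _ = δ := by field_simp

theorem exists_cutoff : ∃ χ : ℝ → ℝ, ContDiff ℝ (⊤ : ℕ∞) χ ∧ (∀ x, |x| ≤ 1 → χ x = 1) ∧
    (∀ x, 2 ≤ |x| → χ x = 0) ∧ (∀ x, 0 ≤ χ x ∧ χ x ≤ 1) ∧ (∀ x, χ (-x) = χ x) := by
  let b : ContDiffBump (0 : ℝ) := ⟨1, 2, by norm_num, by norm_num⟩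
  refine ⟨b, b.contDiff, fun x hx ↦ b.one_of_mem_closedBall (by simpa using hx),
    fun x hx ↦ b.zero_of_le_dist (by simpa using hx), fun x ↦ ⟨b.nonneg, b.le_one⟩,
    fun x ↦ b.neg x⟩

/-- Cutting off a Schwartz function far out changes it little in `H^s`, `s ≤ 1 / 2`. -/
theorem exists_cutoff_sobolevENorm_sub_lt {s : ℝ} (hs : s ≤ 1 / 2) (f : 𝓢(ℝ, F))
    {δ : ℝ} (hδ : 0 < δ) :
    ∃ χ : ℝ → ℝ, ContDiff ℝ (⊤ : ℕ∞) χ ∧ HasCompactSupport χ ∧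
      sobolevENorm s ((f : 𝓢'(ℝ, F)) - toDistribution (fun x ↦ χ x • f x)) < ENNReal.ofReal δ := by
  obtain ⟨χ, hχ, hχ1, hχ0, hχb, -⟩ := exists_cutoff
  have hχc : HasCompactSupport χ := HasCompactSupport.of_support_subset_isCompact
    (isCompact_Icc (a := -2) (b := 2)) (fun x hx ↦ by
      by_contra hx2
      apply hx
      apply hχ0
      by_contra! h3
      exact hx2 ⟨by linarith [(abs_lt.1 h3).1], by linarith [(abs_lt.1 h3).2]⟩)
  obtain ⟨C, hC⟩ := (hχc.deriv).exists_bound_of_continuous (hχ.continuous_deriv (by simp))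
  have hC0 : 0 ≤ C := (norm_nonneg _).trans (hC 0)
  let f' : 𝓢(ℝ, F) := SchwartzMap.derivCLM ℂ F f
  have hf' : ∀ x, HasDerivAt f (f' x) x := fun x ↦ by simpa [f'] using f.hasDerivAt x
  have htx : (fun x : ℝ ↦ (x : ℂ)).HasTemperateGrowth := by fun_prop
  let X : 𝓢(ℝ, F) → 𝓢(ℝ, F) := SchwartzMap.smulLeftCLM F (fun x : ℝ ↦ (x : ℂ))
  have hX : ∀ (k : 𝓢(ℝ, F)) x, ‖X k x‖ = |x| * ‖k x‖ := fun k x ↦ by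
    simp [X, SchwartzMap.smulLeftCLM_apply_apply htx, norm_smul]
  let G : ℝ → ℝ := fun x ↦ ‖X f x‖ + ‖X f' x‖ + C * ‖f x‖
  have hG : MemLp G 2 (volume : Measure ℝ) :=
    (((X f).memLp 2).norm.add ((X f').memLp 2).norm).add ((f.memLp 2).norm.const_mul C)
  -- The part of the function that is cut off.
  let d : ℝ → ℝ → F := fun n x ↦ (1 - χ (x / n)) • f x
  let d' : ℝ → ℝ → F := fun n x ↦ (1 - χ (x / n)) • f' x + (-(deriv χ (x / n) / n)) • f x
  have hd : ∀ n : ℝ, ∀ x, HasDerivAt (d n) (d' n x) x := by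
    intro n x
    have h1 : HasDerivAt χ (deriv χ (x / n)) (x / n) :=
      ((hχ.differentiable (by simp)) (x / n)).hasDerivAt
    have h2 : HasDerivAt (fun x ↦ 1 - χ (x / n)) (-(deriv χ (x / n) / n)) x := by
      have := (h1.comp x ((hasDerivAt_id x).div_const n)).const_sub 1
      simpa [Function.comp_def, div_eq_mul_inv] using this
    exact h2.smul (hf' x)
  have hcut : ∀ n : ℝ, 0 < n → ∀ x (k : 𝓢(ℝ, F)), ‖(1 - χ (x / n)) • k x‖ ≤ n⁻¹ * ‖X k x‖ := by
    intro n hn x k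
    rw [norm_smul, hX]
    rcases le_total |x / n| 1 with h | h
    · rw [hχ1 _ h]; simp; positivity
    · rw [abs_div, abs_of_pos hn, le_div_iff₀ hn] at h
      have h1 : ‖1 - χ (x / n)‖ ≤ 1 := by
        rw [Real.norm_eq_abs, abs_le]; constructor <;> linarith [hχb (x / n)]
      calc _ ≤ 1 * ‖k x‖ := by gcongr
        _ ≤ (n⁻¹ * |x|) * ‖k x‖ := by
          gcongr
          rw [← div_eq_inv_mul, le_div_iff₀ hn]; exact h
        _ = _ := by ring
  have hdG : ∀ n : ℝ, 0 < n → ∀ x, ‖d n x‖ ≤ n⁻¹ * ‖G x‖ ∧ ‖d' n x‖ ≤ n⁻¹ * ‖G x‖ := by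
    intro n hn x
    have hGx : ‖G x‖ = G x := Real.norm_of_nonneg (by positivity)
    have e1 := hcut n hn x f
    have e2 := hcut n hn x f'
    have hn' : 0 < n⁻¹ := inv_pos.2 hn
    have e3 : ‖(-(deriv χ (x / n) / n)) • f x‖ ≤ n⁻¹ * (C * ‖f x‖) := by
      rw [norm_smul, norm_neg, norm_div, Real.norm_of_nonneg hn.le, div_eq_inv_mul, mul_assoc]
      gcongr
      exact hC _
    rw [hGx]
    have p1 : 0 ≤ n⁻¹ * ‖X f x‖ := by positivity
    have p2 : 0 ≤ n⁻¹ * ‖X f' x‖ := by positivity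
    have p3 : 0 ≤ n⁻¹ * (C * ‖f x‖) := by positivity
    constructor
    · simp only [d, G]; linarith
    · refine (norm_add_le _ _).trans ?_
      simp only [G]; linarith
  have hmem : ∀ n : ℝ, 0 < n → MemLp (d n) 2 volume ∧ MemLp (d' n) 2 volume := by
    intro n hn
    have hcont : Continuous (fun x ↦ χ (x / n)) := hχ.continuous.comp (by fun_prop)
    have hcont' : Continuous (fun x ↦ deriv χ (x / n)) :=
      (hχ.continuous_deriv (by simp)).comp (by fun_prop)
    have hfc := f.continuous
    have hfc' := f'.continuous
    constructor
    · exact MemLp.of_le_mul hG (by fun_prop : Continuous (d n)).aestronglyMeasurable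
        (Filter.Eventually.of_forall fun x ↦ (hdG n hn x).1)
    · exact MemLp.of_le_mul hG (by fun_prop : Continuous (d' n)).aestronglyMeasurable
        (Filter.Eventually.of_forall fun x ↦ (hdG n hn x).2)
  -- The size of the cutoff radius.
  set K : ℝ := Real.sqrt (2 * Real.pi) * (2 * (eLpNorm G 2 volume).toReal) with hK
  have hK0 : 0 ≤ K := by positivity
  let n : ℝ := (K + 1) / δ
  have hn : 0 < n := by positivity
  refine ⟨fun x ↦ χ (x / n), hχ.comp (by fun_prop), ?_, ?_⟩
  · have := hχc.comp_smul (c := n⁻¹) (by positivity)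
    simpa [div_eq_inv_mul] using this
  have hcs : Continuous (fun x ↦ χ (x / n) • f x) :=
    (hχ.continuous.comp (by fun_prop)).smul f.continuous
  have hcsm : MemLp (fun x ↦ χ (x / n) • f x) 2 (volume : Measure ℝ) := by
    have : (fun x ↦ χ (x / n) • f x) = (f : ℝ → F) - d n := by
      funext x; simp [d, sub_smul]
    rw [this]
    exact (f.memLp 2).sub (hmem n hn).1
  rw [← toDistribution_schwartz, ← toDistribution_sub (f.memLp 2) hcsm]
  have : (f : ℝ → F) - (fun x ↦ χ (x / n) • f x) = d n := by
    funext x; simp [d, sub_smul]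
  rw [this]
  refine (sobolevENorm_le_of_hasDerivAt hs (hmem n hn).1 (hmem n hn).2 (hd n)).trans_lt ?_
  have b1 : eLpNorm (d n) 2 volume ≤ ENNReal.ofReal n⁻¹ * eLpNorm G 2 volume :=
    eLpNorm_le_mul_eLpNorm_of_ae_le_mul (Filter.Eventually.of_forall fun x ↦ (hdG n hn x).1) 2
  have b2 : eLpNorm (d' n) 2 volume ≤ ENNReal.ofReal n⁻¹ * eLpNorm G 2 volume :=
    eLpNorm_le_mul_eLpNorm_of_ae_le_mul (Filter.Eventually.of_forall fun x ↦ (hdG n hn x).2) 2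
  calc _ ≤ ENNReal.ofReal (Real.sqrt (2 * Real.pi)) *
        (ENNReal.ofReal n⁻¹ * eLpNorm G 2 volume + ENNReal.ofReal n⁻¹ * eLpNorm G 2 volume) := by
        gcongr
    _ = ENNReal.ofReal (n⁻¹ * K) := by
        rw [hK, ← ENNReal.ofReal_toReal hG.2.ne, ← ENNReal.ofReal_mul (by positivity),
          ← ENNReal.ofReal_add (by positivity) (by positivity),
          ← ENNReal.ofReal_mul (by positivity), ENNReal.toReal_ofReal (by positivity)]
        congr 1; ring
    _ < ENNReal.ofReal δ := by
        rw [ENNReal.ofReal_lt_ofReal_iff hδ]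
        simp only [n, inv_div]
        rw [div_mul_eq_mul_div, div_lt_iff₀ (by positivity)]
        nlinarith

end Density

/-! ### Real functions are dense in the real distributions -/

/-- The complex conjugate of a Schwartz function. -/
def conjSchwartz (u : 𝓢(ℝ, ℂ)) : 𝓢(ℝ, ℂ) :=
  SchwartzMap.postcompCLM (𝕜 := ℝ) (Complex.conjCLE : ℂ →L[ℝ] ℂ) u

/-- The real part of a Schwartz function. -/
def reSchwartz (u : 𝓢(ℝ, ℂ)) : 𝓢(ℝ, ℂ) :=
  SchwartzMap.postcompCLM (𝕜 := ℝ) (Complex.ofRealCLM ∘L Complex.reCLM) u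

/-- The reflected Schwartz function. -/
def negSchwartz (u : 𝓢(ℝ, ℂ)) : 𝓢(ℝ, ℂ) :=
  SchwartzMap.compCLMOfContinuousLinearEquiv ℝ (ContinuousLinearEquiv.neg ℝ) u

theorem conjSchwartz_apply (u : 𝓢(ℝ, ℂ)) (x : ℝ) : conjSchwartz u x = star (u x) := rfl

theorem reSchwartz_apply (u : 𝓢(ℝ, ℂ)) (x : ℝ) : reSchwartz u x = ((u x).re : ℂ) := rfl

theorem negSchwartz_apply (u : 𝓢(ℝ, ℂ)) (x : ℝ) : negSchwartz u x = u (-x) := rfl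

theorem IsRealDistribution.apply_conj {T : 𝓢'(ℝ, ℂ)} (hT : IsRealDistribution T)
    (v : 𝓢(ℝ, ℂ)) : T (conjSchwartz v) = star (T v) := by
  have h1 := hT (reSchwartz v) (fun x ↦ by simp [reSchwartz_apply])
  have h2 := hT (reSchwartz (-Complex.I • v)) (fun x ↦ by simp [reSchwartz_apply])
  have e1 : v = reSchwartz v + Complex.I • reSchwartz (-Complex.I • v) := by
    ext x
    simp [reSchwartz_apply, Complex.ext_iff]
  have e2 : conjSchwartz v = reSchwartz v - Complex.I • reSchwartz (-Complex.I • v) := by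
    ext x
    simp [reSchwartz_apply, conjSchwartz_apply, Complex.ext_iff]
  rw [e2, map_sub, map_smul]
  conv_rhs => rw [e1, map_add, map_smul]
  generalize T (reSchwartz v) = a at *
  generalize T (reSchwartz (-Complex.I • v)) = b at *
  simp [Complex.ext_iff, h1, h2]

theorem fourier_conj_neg (u : 𝓢(ℝ, ℂ)) :
    𝓕 (negSchwartz (conjSchwartz u)) = conjSchwartz (𝓕 u) := by
  ext x
  rw [conjSchwartz_apply, SchwartzMap.fourier_coe, SchwartzMap.fourier_coe, Real.fourier_eq',
    Real.fourier_eq']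
  change _ = (starRingEnd ℂ) _
  rw [← integral_conj, ← integral_neg_eq_self]
  apply integral_congr_ae
  filter_upwards with v
  rw [negSchwartz_apply, conjSchwartz_apply, neg_neg]
  simp only [smul_eq_mul, map_mul, ← Complex.exp_conj, Complex.conj_ofReal, Complex.conj_I]
  congr 2
  simp

/-- Taking the real part does not increase the distance to a real distribution in `H^s`. On the
Fourier side it is the average of `g` and of `conj g(-η)`. -/
theorem sobolevENorm_sub_reSchwartz_le {s : ℝ} {T : 𝓢'(ℝ, ℂ)} (hT : IsRealDistribution T)
    (f : 𝓢(ℝ, ℂ)) {g : Lp ℂ 2 (volume : Measure ℝ)}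
    (hg : IsWeightedFourier s (T - (f : 𝓢'(ℝ, ℂ))) g) :
    sobolevENorm s (T - (reSchwartz f : 𝓢'(ℝ, ℂ))) ≤ sobolevENorm s (T - (f : 𝓢'(ℝ, ℂ))) := by
  have hw := hasTemperateGrowth_japaneseBracket s
  have hmp := Measure.measurePreserving_neg (volume : Measure ℝ)
  have hm : MemLp (fun x ↦ star (g (-x))) 2 (volume : Measure ℝ) :=
    ((Lp.memLp g).comp_measurePreserving hmp).star
  let g' : Lp ℂ 2 (volume : Measure ℝ) := hm.toLp _
  have hn : ‖g'‖ = ‖g‖ := by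
    rw [Lp.norm_toLp, Lp.norm_def]
    congr 1
    rw [← eLpNorm_comp_measurePreserving (Lp.aestronglyMeasurable g) hmp]
    exact eLpNorm_congr_norm_ae (Filter.Eventually.of_forall fun x ↦ by simp)
  have key : IsWeightedFourier s (T - (reSchwartz f : 𝓢'(ℝ, ℂ))) ((1 / 2 : ℂ) • (g + g')) := by
    unfold IsWeightedFourier at *
    ext u
    have e1 : ∀ v : 𝓢(ℝ, ℂ), (T - (f : 𝓢'(ℝ, ℂ)))
        (𝓕 (SchwartzMap.smulLeftCLM ℂ (fun η : ℝ ↦ ((japaneseBracket s η : ℝ) : ℂ)) v))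
        = ∫ x, v x * g x := by
      intro v
      have := congrArg (fun S : 𝓢'(ℝ, ℂ) ↦ S v) hg
      simpa using this
    set w := SchwartzMap.smulLeftCLM ℂ (fun η : ℝ ↦ ((japaneseBracket s η : ℝ) : ℂ)) u with hwdef
    have e2 : SchwartzMap.smulLeftCLM ℂ (fun η : ℝ ↦ ((japaneseBracket s η : ℝ) : ℂ))
        (negSchwartz (conjSchwartz u)) = negSchwartz (conjSchwartz w) := by
      ext x
      have heven : japaneseBracket s (-x) = japaneseBracket s x := by simp [japaneseBracket]
      rw [negSchwartz_apply, conjSchwartz_apply, hwdef, SchwartzMap.smulLeftCLM_apply_apply hw,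
        SchwartzMap.smulLeftCLM_apply_apply hw, negSchwartz_apply, conjSchwartz_apply, heven]
      simp
    have e3 := e1 (negSchwartz (conjSchwartz u))
    rw [e2, fourier_conj_neg] at e3
    have e4 := e1 u
    set v := 𝓕 w with hv
    have e5 : ((((1 / 2 : ℂ) • (g + g') : Lp ℂ 2 (volume : Measure ℝ)) : 𝓢'(ℝ, ℂ)) : _) u
        = (1 / 2) * ((∫ x, u x * g x) + ∫ x, u x * g' x) := by
      have : (((1 / 2 : ℂ) • (g + g') : Lp ℂ 2 (volume : Measure ℝ)) : 𝓢'(ℝ, ℂ))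
          = (1 / 2 : ℂ) • ((g : 𝓢'(ℝ, ℂ)) + (g' : 𝓢'(ℝ, ℂ))) := by
        rw [← Lp.toTemperedDistributionCLM_apply, map_smul, map_add]
        rfl
      rw [this]
      simp
      ring
    have e6 : ∫ x, u x * g' x = star (∫ x, negSchwartz (conjSchwartz u) x * g x) := by
      change _ = (starRingEnd ℂ) _
      rw [← integral_conj, ← integral_neg_eq_self]
      apply integral_congr_ae
      filter_upwards [hmp.quasiMeasurePreserving.ae (hm.coeFn_toLp)] with x hx
      rw [negSchwartz_apply, conjSchwartz_apply, map_mul]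
      simp only [g']
      rw [hx]
      simp
    have hint : ∀ k : 𝓢(ℝ, ℂ), Integrable (fun x ↦ v x * k x) := fun k ↦
      memLp_one_iff_integrable.1 ((k.memLp 2).mul (v.memLp 2))
    have e7 : (T - (reSchwartz f : 𝓢'(ℝ, ℂ))) v
        = (1 / 2) * ((T - (f : 𝓢'(ℝ, ℂ))) v + star ((T - (f : 𝓢'(ℝ, ℂ))) (conjSchwartz v))) := by
      have a1 : (∫ x, v x * reSchwartz f x)
          = (1 / 2) * ((∫ x, v x * f x) + star (∫ x, conjSchwartz v x * f x)) := by
        have : star (∫ x, conjSchwartz v x * f x) = ∫ x, v x * conjSchwartz f x := by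
          change (starRingEnd ℂ) _ = _
          rw [← integral_conj]
          apply integral_congr_ae
          filter_upwards with x
          simp [conjSchwartz_apply]
        rw [this, ← integral_add (hint _) (hint _), ← integral_const_mul]
        apply integral_congr_ae
        filter_upwards with x
        rw [reSchwartz_apply, conjSchwartz_apply, Complex.re_eq_add_conj]
        change _ = 1 / 2 * (v x * f x + v x * (starRingEnd ℂ) (f x))
        ring
      have a2 : ∀ k l : 𝓢(ℝ, ℂ), (T - (k : 𝓢'(ℝ, ℂ))) l = T l - ∫ x, l x * k x := by
        intro k l
        simp
      rw [a2, a2, a2, a1, hT.apply_conj, star_sub, star_star]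
      ring
    rw [e5, e6, ← e3, ← e4]
    exact e7
  rw [key.sobolevENorm_eq, hg.sobolevENorm_eq]
  gcongr
  rw [norm_smul]
  have := norm_add_le g g'
  rw [hn] at this
  simp only [norm_div, norm_one, Complex.norm_ofNat]
  linarith

theorem sobolevENorm_neg {F : Type*} [NormedAddCommGroup F]
    [InnerProductSpace ℂ F] [CompleteSpace F] (s : ℝ) (T : 𝓢'(ℝ, F)) :
    sobolevENorm s (-T) = sobolevENorm s T := by
  have key : ∀ S : 𝓢'(ℝ, F), sobolevENorm s (-S) ≤ sobolevENorm s S := by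
    intro S
    by_cases h : ∃ g, IsWeightedFourier s S g
    · obtain ⟨g, hg⟩ := h
      have := (IsWeightedFourier.zero s).sub hg
      rw [zero_sub, zero_sub] at this
      rw [this.sobolevENorm_eq, hg.sobolevENorm_eq, norm_neg]
    · rw [sobolevENorm_eq_top (not_exists.1 h)]; simp
  refine le_antisymm (key T) ?_
  simpa using key (-T)

/-- Smooth compactly supported functions are dense in `H^s`, `s ≤ 1 / 2`. -/
theorem exists_smooth_sobolevENorm_sub_lt {F : Type*} [NormedAddCommGroup F]
    [InnerProductSpace ℂ F] [CompleteSpace F] {s : ℝ} (hs : s ≤ 1 / 2) {T : 𝓢'(ℝ, F)}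
    (hT : MemSobolev s 2 T) {δ : ℝ} (hδ : 0 < δ) :
    ∃ f : ℝ → F, ContDiff ℝ (⊤ : ℕ∞) f ∧ HasCompactSupport f ∧
      sobolevENorm s (toDistribution f - T) < ENNReal.ofReal δ := by
  obtain ⟨k, -, hk⟩ := exists_schwartz_sobolevENorm_sub_lt hT (half_pos hδ)
  obtain ⟨χ, hχ, hχc, hχd⟩ := exists_cutoff_sobolevENorm_sub_lt hs k (half_pos hδ)
  refine ⟨fun x ↦ χ x • k x, hχ.smul (k.smooth _), hχc.smul_right, ?_⟩
  rw [← sobolevENorm_neg, neg_sub, ← sub_add_sub_cancel T (k : 𝓢'(ℝ, F))]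
  refine (sobolevENorm_add_le _ _ _).trans_lt ?_
  calc _ < ENNReal.ofReal (δ / 2) + ENNReal.ofReal (δ / 2) := ENNReal.add_lt_add hk hχd
    _ = ENNReal.ofReal δ := by
      rw [← ENNReal.ofReal_add (by positivity) (by positivity), add_halves]

/-- Real smooth compactly supported functions are dense in the real part of `H^s`, `s ≤ 1 / 2`. -/
theorem exists_real_smooth_sobolevENorm_sub_lt {s : ℝ} (hs : s ≤ 1 / 2) {T : 𝓢'(ℝ, ℂ)}
    (hT : MemSobolev s 2 T) (hreal : IsRealDistribution T) {δ : ℝ} (hδ : 0 < δ) :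
    ∃ f : ℝ → ℝ, ContDiff ℝ (⊤ : ℕ∞) f ∧ HasCompactSupport f ∧
      sobolevENorm s (toDistribution (cplx f) - T) < ENNReal.ofReal δ := by
  obtain ⟨k, ⟨g, hg⟩, hk⟩ := exists_schwartz_sobolevENorm_sub_lt hT (half_pos hδ)
  have hk' := (sobolevENorm_sub_reSchwartz_le hreal k hg).trans_lt hk
  obtain ⟨χ, hχ, hχc, hχd⟩ :=
    exists_cutoff_sobolevENorm_sub_lt hs (reSchwartz k) (half_pos hδ)
  have hre : ContDiff ℝ (⊤ : ℕ∞) (fun x ↦ (k x).re) :=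
    Complex.reCLM.contDiff.comp (k.smooth _)
  refine ⟨fun x ↦ χ x * (k x).re, hχ.mul hre, hχc.mul_right, ?_⟩
  have : cplx (fun x ↦ χ x * (k x).re) = fun x ↦ χ x • reSchwartz k x := by
    funext x
    simp [cplx, reSchwartz_apply]
  rw [this, ← sobolevENorm_neg, neg_sub, ← sub_add_sub_cancel T (reSchwartz k : 𝓢'(ℝ, ℂ))]
  refine (sobolevENorm_add_le _ _ _).trans_lt ?_
  calc _ < ENNReal.ofReal (δ / 2) + ENNReal.ofReal (δ / 2) := ENNReal.add_lt_add hk' hχd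
    _ = ENNReal.ofReal δ := by
      rw [← ENNReal.ofReal_add (by positivity) (by positivity), add_halves]

/-! ### The contraction argument -/

/-- The system in characteristic coordinates, in integrated form, is solved by a contraction in a
commutative Banach algebra with involution. Here `V` and `V'` stand for the integration in the two
characteristic directions, over a distance at most `ℓ`; the first two data may be as large as
`N / ℓ`, and then the two fields are found in the ball of radius `2 N / ℓ`. -/
theorem exists_solution_integrated_system {𝒜 : Type*} [NormedCommRing 𝒜] [NormedAlgebra ℂ 𝒜]
    [StarRing 𝒜] [NormedStarGroup 𝒜] [StarModule ℂ 𝒜] [CompleteSpace 𝒜]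
    (V V' : 𝒜 →ₗ[ℂ] 𝒜) {ℓ : ℝ} (hℓ : 0 < ℓ) (hV : ∀ k, ‖V k‖ ≤ ℓ * ‖k‖)
    (hV' : ∀ k, ‖V' k‖ ≤ ℓ * ‖k‖) (hVs : ∀ k, V (star k) = star (V k))
    (hVs' : ∀ k, V' (star k) = star (V' k))
    (S : Submodule ℂ 𝒜) (hS : IsClosed (S : Set 𝒜)) (hSm : ∀ k ∈ S, ∀ l, k * l ∈ S)
    (hSV : ∀ k ∈ S, V k ∈ S) (hSV' : ∀ k ∈ S, V' k ∈ S)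
    {m M N B Q₀ B₀ : ℝ} (hm : 0 ≤ m) (hN : 0 < N)
    {u₀ v₀ q₀ φ₀ : 𝒜} (hu₀ : u₀ ∈ S) (hv₀ : v₀ ∈ S) (hq₀ : q₀ ∈ S) (hφ₀ : φ₀ ∈ S)
    (hq₀s : star q₀ = q₀) (hφ₀s : star φ₀ = φ₀)
    (hu₀n : ‖u₀‖ ≤ N / ℓ) (hv₀n : ‖v₀‖ ≤ N / ℓ) (hq₀n : ‖q₀‖ ≤ Q₀) (hφ₀n : ‖φ₀‖ ≤ B₀)
    (hB : B = B₀ + N ^ 2 + 1)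
    (h1 : ℓ * (B + m + 16 * N ^ 2) ≤ 1) (h2 : 2 * ℓ * Q₀ + ℓ ^ 2 * M ^ 2 * B / 2 ≤ 2)
    (h3 : ℓ ^ 2 * M ^ 2 ≤ 1 / 2) :
    ∃ u ∈ S, ∃ v ∈ S, ∃ q ∈ S, ∃ φ ∈ S, star q = q ∧ star φ = φ ∧
      ‖u‖ ≤ 2 * N / ℓ ∧ ‖v‖ ≤ 2 * N / ℓ ∧ ‖φ‖ ≤ B ∧
      u = u₀ + V' ((Complex.I / 2) • (φ * v - (m : ℂ) • v)) ∧
      v = v₀ - V ((Complex.I / 2) • (φ * u - (m : ℂ) • u)) ∧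
      q = q₀ + V' (((M ^ 2 / 4 : ℝ) : ℂ) • φ - ((1 / 8 : ℝ) : ℂ) • (u * star v + v * star u)) ∧
      φ = φ₀ + V q := by
  have hB₀ : 0 ≤ B₀ := (norm_nonneg _).trans hφ₀n
  have hB0 : 0 ≤ B := by rw [hB]; positivity
  set k : ℝ := 8 * N * ℓ with hk
  have hk0 : 0 < k := by positivity
  -- The unknowns are `k u`, `k v`, `2 ℓ q` and `φ`, so that the system is a contraction for the
  -- maximum norm: in the equation for `φ` the factor is `ℓ (2 ℓ)⁻¹ = 1 / 2`, and `k = 8 N ℓ` is so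
  -- large that the quadratic terms contribute `1 / 4` to the factor in the equation for `q`.
  let f : (𝒜 × 𝒜) × (𝒜 × 𝒜) → (𝒜 × 𝒜) × (𝒜 × 𝒜) := fun w ↦
    (((k : ℂ) • u₀ + V' ((Complex.I / 2) • (w.2.2 * w.1.2 - (m : ℂ) • w.1.2)),
      (k : ℂ) • v₀ - V ((Complex.I / 2) • (w.2.2 * w.1.1 - (m : ℂ) • w.1.1))),
     (((2 * ℓ : ℝ) : ℂ) • (q₀ + V' (((M ^ 2 / 4 : ℝ) : ℂ) • w.2.2 -
        ((1 / (8 * k ^ 2) : ℝ) : ℂ) • (w.1.1 * star w.1.2 + w.1.2 * star w.1.1))),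
      φ₀ + V ((((2 * ℓ)⁻¹ : ℝ) : ℂ) • w.2.1)))
  let D : Set ((𝒜 × 𝒜) × (𝒜 × 𝒜)) := {w | (w.1.1 ∈ S ∧ w.1.2 ∈ S ∧ w.2.1 ∈ S ∧ w.2.2 ∈ S) ∧
    (star w.2.1 = w.2.1 ∧ star w.2.2 = w.2.2) ∧ (‖w.1.1‖ ≤ 16 * N ^ 2 ∧ ‖w.1.2‖ ≤ 16 * N ^ 2) ∧
    (‖w.2.1‖ ≤ 2 * (N ^ 2 + 1) ∧ ‖w.2.2‖ ≤ B)}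
  have hDc : IsClosed D := by
    refine IsClosed.inter ?_ (IsClosed.inter ?_ (IsClosed.inter ?_ ?_))
    · exact (hS.preimage (f := fun w : (𝒜 × 𝒜) × (𝒜 × 𝒜) ↦ w.1.1) (by fun_prop)).inter
        ((hS.preimage (f := fun w : (𝒜 × 𝒜) × (𝒜 × 𝒜) ↦ w.1.2) (by fun_prop)).inter
        ((hS.preimage (f := fun w : (𝒜 × 𝒜) × (𝒜 × 𝒜) ↦ w.2.1) (by fun_prop)).inter
        (hS.preimage (f := fun w : (𝒜 × 𝒜) × (𝒜 × 𝒜) ↦ w.2.2) (by fun_prop))))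
    · exact (isClosed_eq (f := fun w : (𝒜 × 𝒜) × (𝒜 × 𝒜) ↦ star w.2.1)
        (by fun_prop) (by fun_prop)).inter
        (isClosed_eq (f := fun w : (𝒜 × 𝒜) × (𝒜 × 𝒜) ↦ star w.2.2)
        (by fun_prop) (by fun_prop))
    · exact (isClosed_le (f := fun w : (𝒜 × 𝒜) × (𝒜 × 𝒜) ↦ ‖w.1.1‖)
        (by fun_prop) continuous_const).inter
        (isClosed_le (f := fun w : (𝒜 × 𝒜) × (𝒜 × 𝒜) ↦ ‖w.1.2‖)
        (by fun_prop) continuous_const)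
    · exact (isClosed_le (f := fun w : (𝒜 × 𝒜) × (𝒜 × 𝒜) ↦ ‖w.2.1‖)
        (by fun_prop) continuous_const).inter
        (isClosed_le (f := fun w : (𝒜 × 𝒜) × (𝒜 × 𝒜) ↦ ‖w.2.2‖)
        (by fun_prop) continuous_const)
  have hI2 : ‖(Complex.I / 2 : ℂ)‖ = 1 / 2 := by simp
  have hmaps : Set.MapsTo f D D := by
    rintro ⟨⟨a, b⟩, ⟨p, φ⟩⟩ ⟨⟨ha, hb, hp, hφ⟩, ⟨hps, hφs⟩, ⟨han, hbn⟩, ⟨hpn, hφn⟩⟩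
    simp only at ha hb hp hφ hps hφs han hbn hpn hφn
    have hmv : ∀ c : 𝒜, ‖c‖ ≤ 16 * N ^ 2 →
        ℓ * ‖(Complex.I / 2 : ℂ) • (φ * c - (m : ℂ) • c)‖ ≤ 8 * N ^ 2 := by
      intro c hc
      rw [norm_smul, hI2]
      have : ‖φ * c - (m : ℂ) • c‖ ≤ B * (16 * N ^ 2) + m * (16 * N ^ 2) := by
        refine (norm_sub_le _ _).trans (add_le_add ((norm_mul_le _ _).trans (by gcongr)) ?_)
        rw [norm_smul, Complex.norm_real, Real.norm_of_nonneg hm]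
        gcongr
      have h4 : ℓ * (B + m) ≤ 1 := by nlinarith [mul_nonneg hℓ.le (sq_nonneg N)]
      calc _ ≤ ℓ * (1 / 2 * (B * (16 * N ^ 2) + m * (16 * N ^ 2))) := by gcongr
        _ = (ℓ * (B + m)) * (8 * N ^ 2) := by ring
        _ ≤ 1 * (8 * N ^ 2) := by gcongr
        _ = _ := by ring
    have hku : ∀ c : 𝒜, ‖c‖ ≤ N / ℓ → ‖(k : ℂ) • c‖ ≤ 8 * N ^ 2 := by
      intro c hc
      rw [norm_smul, Complex.norm_real, Real.norm_of_nonneg hk0.le]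
      calc _ ≤ k * (N / ℓ) := by gcongr
        _ = _ := by rw [hk]; field_simp
    refine ⟨⟨?_, ?_, ?_, ?_⟩, ⟨?_, ?_⟩, ⟨?_, ?_⟩, ⟨?_, ?_⟩⟩ <;> simp only [f]
    · exact S.add_mem (S.smul_mem _ hu₀) (hSV' _ (S.smul_mem _
        (S.sub_mem (hSm _ hφ _) (S.smul_mem _ hb))))
    · exact S.sub_mem (S.smul_mem _ hv₀) (hSV _ (S.smul_mem _
        (S.sub_mem (hSm _ hφ _) (S.smul_mem _ ha))))
    · exact S.smul_mem _ (S.add_mem hq₀ (hSV' _ (S.sub_mem (S.smul_mem _ hφ) (S.smul_mem _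
        (S.add_mem (hSm _ ha _) (hSm _ hb _))))))
    · exact S.add_mem hφ₀ (hSV _ (S.smul_mem _ hp))
    · rw [star_smul, star_add, hq₀s, ← hVs', star_sub, star_smul, star_smul, star_add, star_mul,
        star_mul, star_star, star_star, hφs]
      simp only [Complex.star_def, Complex.conj_ofReal]
      rw [add_comm (b * star a)]
    · rw [star_add, hφ₀s, ← hVs, star_smul, hps, Complex.star_def, Complex.conj_ofReal]
    · calc _ ≤ 8 * N ^ 2 + 8 * N ^ 2 :=
            (norm_add_le _ _).trans (add_le_add (hku _ hu₀n) ((hV' _).trans (hmv b hbn)))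
        _ = _ := by ring
    · calc _ ≤ 8 * N ^ 2 + 8 * N ^ 2 :=
            (norm_sub_le _ _).trans (add_le_add (hku _ hv₀n) ((hV _).trans (hmv a han)))
        _ = _ := by ring
    · rw [norm_smul, Complex.norm_real, Real.norm_of_nonneg (by positivity)]
      have e1 : ‖((M ^ 2 / 4 : ℝ) : ℂ) • φ‖ ≤ M ^ 2 / 4 * B := by
        rw [norm_smul, Complex.norm_real, Real.norm_of_nonneg (by positivity)]; gcongr
      have e2 : ‖((1 / (8 * k ^ 2) : ℝ) : ℂ) • (a * star b + b * star a)‖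
          ≤ 1 / (8 * k ^ 2) * (2 * (16 * N ^ 2 * (16 * N ^ 2))) := by
        rw [norm_smul, Complex.norm_real, Real.norm_of_nonneg (by positivity)]
        gcongr
        calc _ ≤ ‖a‖ * ‖b‖ + ‖b‖ * ‖a‖ := by
              refine (norm_add_le _ _).trans (add_le_add ?_ ?_) <;>
              refine (norm_mul_le _ _).trans (by rw [norm_star])
          _ ≤ 16 * N ^ 2 * (16 * N ^ 2) + 16 * N ^ 2 * (16 * N ^ 2) := by gcongr
          _ = _ := by ring
      calc _ ≤ 2 * ℓ * (Q₀ + ℓ * (M ^ 2 / 4 * B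
            + 1 / (8 * k ^ 2) * (2 * (16 * N ^ 2 * (16 * N ^ 2))))) := by
            gcongr
            refine (norm_add_le _ _).trans (add_le_add hq₀n ((hV' _).trans ?_))
            gcongr
            exact (norm_sub_le _ _).trans (add_le_add e1 e2)
        _ = (2 * ℓ * Q₀ + ℓ ^ 2 * M ^ 2 * B / 2) + 2 * N ^ 2 := by
            rw [hk]; field_simp; ring
        _ ≤ _ := by linarith
    · calc _ ≤ B₀ + ℓ * ((2 * ℓ)⁻¹ * (2 * (N ^ 2 + 1))) := by
            refine (norm_add_le _ _).trans (add_le_add hφ₀n ((hV _).trans ?_))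
            rw [norm_smul, Complex.norm_real, Real.norm_of_nonneg (by positivity)]
            gcongr
        _ = B := by rw [hB]; field_simp; ring
  have hlip : ∀ w ∈ D, ∀ w' ∈ D, dist (f w) (f w') ≤ 1 / 2 * dist w w' := by
    rintro ⟨⟨a, b⟩, ⟨p, φ⟩⟩ ⟨-, -, ⟨han, hbn⟩, ⟨hpn, hφn⟩⟩
      ⟨⟨a', b'⟩, ⟨p', φ'⟩⟩ ⟨-, -, ⟨han', hbn'⟩, ⟨hpn', hφn'⟩⟩
    simp only at han hbn hpn hφn han' hbn' hpn' hφn'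
    set d := dist ((a, b), (p, φ)) ((a', b'), (p', φ')) with hd
    have hd0 : 0 ≤ d := dist_nonneg
    obtain ⟨⟨da, db⟩, dp, dφ⟩ : (‖a - a'‖ ≤ d ∧ ‖b - b'‖ ≤ d) ∧ ‖p - p'‖ ≤ d ∧ ‖φ - φ'‖ ≤ d := by
      simp only [← dist_eq_norm, hd, Prod.dist_eq]
      exact ⟨⟨by simp, by simp⟩, by simp, by simp⟩
    have hprod : ∀ c c' : 𝒜, ‖c‖ ≤ 16 * N ^ 2 → ‖c - c'‖ ≤ d →
        ℓ * ‖(Complex.I / 2 : ℂ) • (φ * c - (m : ℂ) • c)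
          - (Complex.I / 2 : ℂ) • (φ' * c' - (m : ℂ) • c')‖ ≤ 1 / 2 * d := by
      intro c c' hc hcc
      have e : (Complex.I / 2 : ℂ) • (φ * c - (m : ℂ) • c)
          - (Complex.I / 2 : ℂ) • (φ' * c' - (m : ℂ) • c')
          = (Complex.I / 2 : ℂ) • ((φ - φ') * c + φ' * (c - c') - (m : ℂ) • (c - c')) := by
        rw [← smul_sub, smul_sub (m : ℂ)]
        congr 1
        ring
      rw [e, norm_smul, hI2]
      calc _ ≤ ℓ * (1 / 2 * (d * (16 * N ^ 2) + B * d + m * d)) := by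
            gcongr
            refine (norm_sub_le _ _).trans (add_le_add ((norm_add_le _ _).trans
              (add_le_add ((norm_mul_le _ _).trans (by gcongr))
              ((norm_mul_le _ _).trans (by gcongr)))) ?_)
            rw [norm_smul, Complex.norm_real, Real.norm_of_nonneg hm]
            gcongr
        _ = (ℓ * (B + m + 16 * N ^ 2)) * (1 / 2 * d) := by ring
        _ ≤ 1 * (1 / 2 * d) := by gcongr
        _ = _ := one_mul _
    rw [Prod.dist_eq, Prod.dist_eq, Prod.dist_eq]
    refine max_le (max_le ?_ ?_) (max_le ?_ ?_) <;> simp only [f, dist_eq_norm]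
    · rw [add_sub_add_left_eq_sub, ← map_sub]
      exact (hV' _).trans (hprod b b' hbn db)
    · rw [sub_sub_sub_cancel_left, ← map_sub, ← norm_neg, ← map_neg, neg_sub]
      exact (hV _).trans (hprod a a' han da)
    · rw [← smul_sub, add_sub_add_left_eq_sub, ← map_sub, norm_smul, Complex.norm_real,
        Real.norm_of_nonneg (by positivity)]
      have e : ((M ^ 2 / 4 : ℝ) : ℂ) • φ -
          ((1 / (8 * k ^ 2) : ℝ) : ℂ) • (a * star b + b * star a) -
          (((M ^ 2 / 4 : ℝ) : ℂ) • φ' -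
          ((1 / (8 * k ^ 2) : ℝ) : ℂ) • (a' * star b' + b' * star a'))
          = ((M ^ 2 / 4 : ℝ) : ℂ) • (φ - φ') - ((1 / (8 * k ^ 2) : ℝ) : ℂ) •
            (((a - a') * star b + a' * star (b - b')) +
              ((b - b') * star a + b' * star (a - a'))) := by
        rw [smul_sub, sub_sub_sub_comm, ← smul_sub ((1 / (8 * k ^ 2) : ℝ) : ℂ)]
        congr 2
        rw [star_sub, star_sub]
        ring
      rw [e]
      calc _ ≤ 2 * ℓ * (ℓ * (M ^ 2 / 4 * d + 1 / (8 * k ^ 2) *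
            ((d * (16 * N ^ 2) + (16 * N ^ 2) * d) + (d * (16 * N ^ 2) + (16 * N ^ 2) * d)))) := by
            gcongr
            refine (hV' _).trans ?_
            gcongr
            refine (norm_sub_le _ _).trans (add_le_add ?_ ?_)
            · rw [norm_smul, Complex.norm_real, Real.norm_of_nonneg (by positivity)]
              gcongr
            · rw [norm_smul, Complex.norm_real, Real.norm_of_nonneg (by positivity)]
              gcongr
              refine (norm_add_le _ _).trans (add_le_add
                ((norm_add_le _ _).trans (add_le_add ?_ ?_))
                ((norm_add_le _ _).trans (add_le_add ?_ ?_))) <;>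
              · refine (norm_mul_le _ _).trans ?_
                rw [norm_star]
                gcongr
        _ = (ℓ ^ 2 * M ^ 2) * (1 / 2 * d) + 1 / 4 * d := by rw [hk]; field_simp; ring
        _ ≤ 1 / 2 * (1 / 2 * d) + 1 / 4 * d := by gcongr
        _ = _ := by ring
    · rw [add_sub_add_left_eq_sub, ← map_sub, ← smul_sub]
      refine (hV _).trans ?_
      rw [norm_smul, Complex.norm_real, Real.norm_of_nonneg (by positivity)]
      calc _ ≤ ℓ * ((2 * ℓ)⁻¹ * d) := by gcongr
        _ = 1 / 2 * d := by field_simp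
  have hcontr : ContractingWith (1 / 2) (hmaps.restrict f D D) := by
    refine ⟨by norm_num, LipschitzWith.of_dist_le_mul ?_⟩
    rintro ⟨w, hw⟩ ⟨w', hw'⟩
    exact hlip w hw w' hw'
  have h0 : (0 : (𝒜 × 𝒜) × (𝒜 × 𝒜)) ∈ D := by
    refine ⟨⟨S.zero_mem, S.zero_mem, S.zero_mem, S.zero_mem⟩, ⟨star_zero _, star_zero _⟩,
      ⟨?_, ?_⟩, ?_, ?_⟩ <;> simp <;> positivity
  obtain ⟨⟨⟨a, b⟩, ⟨p, φ⟩⟩, ⟨⟨ha, hb, hp, hφ⟩, ⟨hps, hφs⟩, ⟨han, hbn⟩, ⟨hpn, hφn⟩⟩, hfix, -⟩ :=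
    hcontr.exists_fixedPoint' hDc.isComplete hmaps h0 (edist_ne_top _ _)
  simp only at ha hb hp hφ hps hφs han hbn hpn hφn
  have hfix' : f ((a, b), (p, φ)) = ((a, b), (p, φ)) := hfix
  simp only [f, Prod.mk.injEq] at hfix'
  obtain ⟨⟨f1, f2⟩, f3, f4⟩ := hfix'
  have hkc : (k : ℂ) ≠ 0 := by exact_mod_cast hk0.ne'
  have hℓc : ((2 * ℓ : ℝ) : ℂ) ≠ 0 := by exact_mod_cast (by positivity : 2 * ℓ ≠ 0)
  have hnorm : ∀ c : 𝒜, ‖c‖ ≤ 16 * N ^ 2 → ‖(k : ℂ)⁻¹ • c‖ ≤ 2 * N / ℓ := by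
    intro c hc
    rw [norm_smul, norm_inv, Complex.norm_real, Real.norm_of_nonneg hk0.le]
    calc _ ≤ k⁻¹ * (16 * N ^ 2) := by gcongr
      _ = _ := by rw [hk]; field_simp; norm_num
  refine ⟨(k : ℂ)⁻¹ • a, S.smul_mem _ ha, (k : ℂ)⁻¹ • b, S.smul_mem _ hb,
    ((2 * ℓ : ℝ) : ℂ)⁻¹ • p, S.smul_mem _ hp, φ, hφ, ?_, hφs, hnorm a han, hnorm b hbn, hφn,
    ?_, ?_, ?_, ?_⟩
  · rw [star_smul, hps, Complex.star_def, map_inv₀, Complex.conj_ofReal]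
  · nth_rewrite 1 [← f1]
    rw [smul_add, smul_smul, inv_mul_cancel₀ hkc, one_smul, ← map_smul]
    congr 2
    rw [smul_comm, mul_smul_comm, smul_comm (m : ℂ), ← smul_sub]
  · nth_rewrite 1 [← f2]
    rw [smul_sub, smul_smul, inv_mul_cancel₀ hkc, one_smul, ← map_smul]
    congr 2
    rw [smul_comm, mul_smul_comm, smul_comm (m : ℂ), ← smul_sub]
  · nth_rewrite 1 [← f3]
    rw [smul_smul, inv_mul_cancel₀ hℓc, one_smul]
    congr 3
    rw [star_smul, star_smul, smul_mul_smul_comm, smul_mul_smul_comm, ← smul_add, smul_smul]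
    congr 1
    rw [Complex.star_def, map_inv₀, Complex.conj_ofReal]
    push_cast
    field_simp
  · nth_rewrite 1 [← f4]
    congr 3
    push_cast
    rfl

/-! ### Regularity of integrals along characteristics -/

section Regularity

variable {E : Type*} [NormedAddCommGroup E] [NormedSpace ℝ E]

theorem contDiff_toSpanSingleton {n : WithTop ℕ∞} :
    ContDiff ℝ n (fun e : E ↦ ContinuousLinearMap.toSpanSingleton ℝ e) := by
  have : (fun e : E ↦ ContinuousLinearMap.toSpanSingleton ℝ e)
      = ContinuousLinearMap.smulRightL ℝ ℝ E (ContinuousLinearMap.id ℝ ℝ) := by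
    ext e; simp
  rw [this]
  exact ContinuousLinearMap.contDiff _

theorem hasFDerivAt_of_partials {f fx fy : ℝ → ℝ → E}
    (hx : ∀ x y, HasDerivAt (fun x ↦ f x y) (fx x y) x)
    (hy : ∀ x y, HasDerivAt (fun y ↦ f x y) (fy x y) y)
    (cx : Continuous (fun p : ℝ × ℝ ↦ fx p.1 p.2))
    (cy : Continuous (fun p : ℝ × ℝ ↦ fy p.1 p.2)) (p : ℝ × ℝ) :
    HasFDerivAt (fun p : ℝ × ℝ ↦ f p.1 p.2)
      ((ContinuousLinearMap.toSpanSingleton ℝ (fx p.1 p.2)).coprod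
        (ContinuousLinearMap.toSpanSingleton ℝ (fy p.1 p.2))) p := by
  have hs := (contDiff_toSpanSingleton (E := E) (n := 0)).continuous
  exact (hasStrictFDerivAt_uncurry_coprod (𝕜 := ℝ) (f := f) (u := p)
    (f₁ := fun x y ↦ ContinuousLinearMap.toSpanSingleton ℝ (fx x y))
    (f₂ := fun x y ↦ ContinuousLinearMap.toSpanSingleton ℝ (fy x y))
    (Filter.Eventually.of_forall fun v ↦ (hx v.1 v.2).hasFDerivAt)
    (Filter.Eventually.of_forall fun v ↦ (hy v.1 v.2).hasFDerivAt)
    (hs.comp cx).continuousAt (hs.comp cy).continuousAt).hasFDerivAt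

theorem contDiff_succ_of_partials {f fx fy : ℝ → ℝ → E}
    (hx : ∀ x y, HasDerivAt (fun x ↦ f x y) (fx x y) x)
    (hy : ∀ x y, HasDerivAt (fun y ↦ f x y) (fy x y) y) {n : ℕ}
    (cx : ContDiff ℝ n (fun p : ℝ × ℝ ↦ fx p.1 p.2))
    (cy : ContDiff ℝ n (fun p : ℝ × ℝ ↦ fy p.1 p.2)) :
    ContDiff ℝ (n + 1) (fun p : ℝ × ℝ ↦ f p.1 p.2) := by
  rw [contDiff_succ_iff_hasFDerivAt]
  refine ⟨_, ?_, hasFDerivAt_of_partials hx hy cx.continuous cy.continuous⟩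
  have : (fun p : ℝ × ℝ ↦ (ContinuousLinearMap.toSpanSingleton ℝ (fx p.1 p.2)).coprod
        (ContinuousLinearMap.toSpanSingleton ℝ (fy p.1 p.2)))
      = fun p : ℝ × ℝ ↦ (ContinuousLinearMap.toSpanSingleton ℝ (fx p.1 p.2)).comp
          (ContinuousLinearMap.fst ℝ ℝ ℝ) +
        (ContinuousLinearMap.toSpanSingleton ℝ (fy p.1 p.2)).comp
          (ContinuousLinearMap.snd ℝ ℝ ℝ) := by
    funext p
    ext <;> simp
  rw [this]
  exact ((contDiff_toSpanSingleton.comp cx).clm_comp contDiff_const).add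
    ((contDiff_toSpanSingleton.comp cy).clm_comp contDiff_const)

/-- The partial derivatives of a parametric primitive: the integrand has to be differentiable in the
parameter `y` only. -/
theorem hasDerivAt_primitive [CompleteSpace E] {h h2 : ℝ → ℝ → E}
    (ch : Continuous (fun p : ℝ × ℝ ↦ h p.1 p.2))
    (ch2 : Continuous (fun p : ℝ × ℝ ↦ h2 p.1 p.2))
    (hd : ∀ s y, HasDerivAt (fun y ↦ h s y) (h2 s y) y) (x y : ℝ) :
    HasDerivAt (fun x ↦ ∫ s in (0)..x, h s y) (h x y) x ∧
    HasDerivAt (fun y ↦ ∫ s in (0)..x, h s y) (∫ s in (0)..x, h2 s y) y := by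
  constructor
  · have : Continuous (fun s ↦ h s y) := ch.comp (by fun_prop : Continuous fun s : ℝ ↦ (s, y))
    exact intervalIntegral.integral_hasDerivAt_right (this.intervalIntegrable _ _)
      (this.stronglyMeasurableAtFilter _ _) this.continuousAt
  · have hc : ∀ y, Continuous (fun s ↦ h s y) := fun y ↦
      ch.comp (by fun_prop : Continuous fun s : ℝ ↦ (s, y))
    have hc2 : Continuous (fun s ↦ h2 s y) :=
      ch2.comp (by fun_prop : Continuous fun s : ℝ ↦ (s, y))
    obtain ⟨C, hC⟩ := (isCompact_uIcc.prod (isCompact_closedBall y 1)).exists_bound_of_continuousOn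
      (s := Set.uIcc 0 x ×ˢ Metric.closedBall y 1) ch2.continuousOn
    refine (intervalIntegral.hasDerivAt_integral_of_dominated_loc_of_deriv_le
      (s := Metric.ball y 1) (bound := fun _ ↦ C)
      (F := fun y s ↦ h s y) (F' := fun y s ↦ h2 s y) (Metric.ball_mem_nhds y one_pos)
      (Filter.Eventually.of_forall fun y ↦ (hc y).aestronglyMeasurable)
      ((hc y).intervalIntegrable _ _) hc2.aestronglyMeasurable
      (Filter.Eventually.of_forall fun s hs z hz ↦ hC (s, z)
        ⟨Set.uIoc_subset_uIcc hs, Metric.ball_subset_closedBall hz⟩)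
      (by simp) (Filter.Eventually.of_forall fun s _ z _ ↦ hd s z)).2

theorem continuous_primitive {h : ℝ → ℝ → E}
    (ch : Continuous (fun p : ℝ × ℝ ↦ h p.1 p.2)) :
    Continuous (fun p : ℝ × ℝ ↦ ∫ s in (0)..p.1, h s p.2) := by
  apply intervalIntegral.continuous_parametric_intervalIntegral_of_continuous
    (f := fun (p : ℝ × ℝ) s ↦ h s p.2) _ continuous_fst
  exact ch.comp (by fun_prop : Continuous fun p : (ℝ × ℝ) × ℝ ↦ (p.2, p.1.2))

theorem contDiff_one_primitive [CompleteSpace E] {h h2 : ℝ → ℝ → E}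
    (ch : Continuous (fun p : ℝ × ℝ ↦ h p.1 p.2))
    (ch2 : Continuous (fun p : ℝ × ℝ ↦ h2 p.1 p.2))
    (hd : ∀ s y, HasDerivAt (fun y ↦ h s y) (h2 s y) y) :
    ContDiff ℝ 1 (fun p : ℝ × ℝ ↦ ∫ s in (0)..p.1, h s p.2) := by
  have := contDiff_succ_of_partials (n := 0) (f := fun x y ↦ ∫ s in (0)..x, h s y)
    (fun x y ↦ (hasDerivAt_primitive ch ch2 hd x y).1)
    (fun x y ↦ (hasDerivAt_primitive ch ch2 hd x y).2)
    (contDiff_zero.2 ch) (contDiff_zero.2 (continuous_primitive ch2))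
  simpa using this

/-- One derivative of the integrand in the parameter is enough to gain one order. -/
theorem contDiff_two_primitive [CompleteSpace E] {h h2 : ℝ → ℝ → E}
    (ch : ContDiff ℝ 1 (fun p : ℝ × ℝ ↦ h p.1 p.2))
    (ch2 : ContDiff ℝ 1 (fun p : ℝ × ℝ ↦ h2 p.1 p.2))
    (hd : ∀ s y, HasDerivAt (fun y ↦ h s y) (h2 s y) y) :
    ContDiff ℝ 2 (fun p : ℝ × ℝ ↦ ∫ s in (0)..p.1, h s p.2) := by
  have hd2 : ∀ s y, HasDerivAt (fun y ↦ h2 s y)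
      (fderiv ℝ (fun p : ℝ × ℝ ↦ h2 p.1 p.2) (s, y) (0, 1)) y := by
    intro s y
    have h1 := ((ch2.differentiable (by norm_num)) (s, y)).hasFDerivAt
    exact h1.comp_hasDerivAt (f := fun y : ℝ ↦ (s, y)) y
      ((hasDerivAt_const y s).prodMk (hasDerivAt_id y))
  have := contDiff_succ_of_partials (n := 1) (f := fun x y ↦ ∫ s in (0)..x, h s y)
    (fun x y ↦ (hasDerivAt_primitive ch.continuous ch2.continuous hd x y).1)
    (fun x y ↦ (hasDerivAt_primitive ch.continuous ch2.continuous hd x y).2)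
    (by simpa using ch)
    (by
      have hcont : Continuous (fun p : ℝ × ℝ ↦
          fderiv ℝ (fun p : ℝ × ℝ ↦ h2 p.1 p.2) (p.1, p.2) (0, 1)) :=
        (ch2.continuous_fderiv (by norm_num)).clm_apply continuous_const
      simpa using contDiff_one_primitive ch2.continuous hcont hd2)
  norm_num at this
  exact this

/-- The integral of `k`, with the cutoff `χ`, along the first coordinate from the diagonal. -/
def volterra (χ : ℝ → ℝ) (k : ℝ → ℝ → E) (x y : ℝ) : E := ∫ s in y..x, χ (s - y) • k s y

variable {χ : ℝ → ℝ}

theorem volterra_eq (hχ : Continuous χ) {k : ℝ → ℝ → E}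
    (ck : Continuous (fun p : ℝ × ℝ ↦ k p.1 p.2)) (x y : ℝ) :
    volterra χ k x y = (∫ s in (0)..x, χ (s - y) • k s y) - ∫ s in (0)..y, χ (s - y) • k s y := by
  have : Continuous (fun s ↦ χ (s - y) • k s y) :=
    (hχ.comp (by fun_prop)).smul (ck.comp (by fun_prop : Continuous fun s : ℝ ↦ (s, y)))
  rw [volterra, intervalIntegral.integral_interval_sub_left (this.intervalIntegrable _ _)
    (this.intervalIntegrable _ _)]

theorem continuous_volterra (hχ : Continuous χ) {k : ℝ → ℝ → E}
    (ck : Continuous (fun p : ℝ × ℝ ↦ k p.1 p.2)) :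
    Continuous (fun p : ℝ × ℝ ↦ volterra χ k p.1 p.2) := by
  have h1 := continuous_primitive (h := fun s y ↦ χ (s - y) • k s y)
    ((hχ.comp (by fun_prop)).smul ck)
  have h2 := h1.comp (by fun_prop : Continuous fun p : ℝ × ℝ ↦ (p.2, p.2))
  simp only [volterra_eq hχ ck]
  exact h1.sub h2

theorem hasDerivAt_volterra [CompleteSpace E] (hχ : Continuous χ) {k : ℝ → ℝ → E}
    (ck : Continuous (fun p : ℝ × ℝ ↦ k p.1 p.2)) (x y : ℝ) :
    HasDerivAt (fun x ↦ volterra χ k x y) (χ (x - y) • k x y) x := by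
  have : Continuous (fun s ↦ χ (s - y) • k s y) :=
    (hχ.comp (by fun_prop)).smul (ck.comp (by fun_prop : Continuous fun s : ℝ ↦ (s, y)))
  exact intervalIntegral.integral_hasDerivAt_right (this.intervalIntegrable _ _)
    (this.stronglyMeasurableAtFilter _ _) this.continuousAt

theorem hasDerivAt_cutoff_smul (hχ : ContDiff ℝ (⊤ : ℕ∞) χ) {k k2 : ℝ → ℝ → E}
    (hd : ∀ s y, HasDerivAt (fun y ↦ k s y) (k2 s y) y) (s y : ℝ) :
    HasDerivAt (fun y ↦ χ (s - y) • k s y)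
      (χ (s - y) • k2 s y + (-deriv χ (s - y)) • k s y) y := by
  have h1 : HasDerivAt χ (deriv χ (s - y)) (s - y) :=
    ((hχ.differentiable (by simp)) _).hasDerivAt
  have h2 : HasDerivAt (fun y ↦ χ (s - y)) (-deriv χ (s - y)) y := by
    simpa [Function.comp_def] using h1.comp y ((hasDerivAt_id y).const_sub s)
  exact h2.smul (hd s y)

theorem contDiff_one_volterra [CompleteSpace E] (hχ : ContDiff ℝ (⊤ : ℕ∞) χ) {k k2 : ℝ → ℝ → E}
    (ck : Continuous (fun p : ℝ × ℝ ↦ k p.1 p.2))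
    (ck2 : Continuous (fun p : ℝ × ℝ ↦ k2 p.1 p.2))
    (hd : ∀ s y, HasDerivAt (fun y ↦ k s y) (k2 s y) y) :
    ContDiff ℝ 1 (fun p : ℝ × ℝ ↦ volterra χ k p.1 p.2) := by
  have hχc := hχ.continuous
  have hχ' : Continuous (deriv χ) := hχ.continuous_deriv (by simp)
  have h1 := contDiff_one_primitive (h := fun s y ↦ χ (s - y) • k s y)
    (h2 := fun s y ↦ χ (s - y) • k2 s y + (-deriv χ (s - y)) • k s y)
    (by fun_prop) (by fun_prop) (hasDerivAt_cutoff_smul hχ hd)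
  have h2 := h1.comp (by fun_prop : ContDiff ℝ 1 fun p : ℝ × ℝ ↦ (p.2, p.2))
  simp only [volterra_eq hχc ck]
  exact h1.sub h2

theorem contDiff_two_volterra [CompleteSpace E] (hχ : ContDiff ℝ (⊤ : ℕ∞) χ) {k k2 : ℝ → ℝ → E}
    (ck : ContDiff ℝ 1 (fun p : ℝ × ℝ ↦ k p.1 p.2))
    (ck2 : ContDiff ℝ 1 (fun p : ℝ × ℝ ↦ k2 p.1 p.2))
    (hd : ∀ s y, HasDerivAt (fun y ↦ k s y) (k2 s y) y) :
    ContDiff ℝ 2 (fun p : ℝ × ℝ ↦ volterra χ k p.1 p.2) := by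
  have hχ1 : ContDiff ℝ 1 χ := hχ.of_le (by simp)
  have hχ' : ContDiff ℝ 1 (deriv χ) := by
    have : ContDiff ℝ (1 + 1) χ := hχ.of_le (by norm_num; exact WithTop.coe_le_coe.2 le_top)
    exact (contDiff_succ_iff_deriv.1 this).2.2
  have h1 := contDiff_two_primitive (h := fun s y ↦ χ (s - y) • k s y)
    (h2 := fun s y ↦ χ (s - y) • k2 s y + (-deriv χ (s - y)) • k s y)
    (by fun_prop) (by fun_prop) (hasDerivAt_cutoff_smul hχ hd)
  have h2 := h1.comp (by fun_prop : ContDiff ℝ 2 fun p : ℝ × ℝ ↦ (p.2, p.2))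
  simp only [volterra_eq hχ.continuous ck.continuous]
  exact h1.sub h2

/-- The cutoff makes the integral one over a distance at most `ℓ`. -/
theorem norm_volterra_le {ℓ : ℝ} (hℓ : 0 ≤ ℓ) (hχ : Continuous χ)
    (hχ1 : ∀ s, |χ s| ≤ 1) (hχ0 : ∀ s, ℓ ≤ |s| → χ s = 0)
    {k : ℝ → ℝ → E} (ck : Continuous (fun p : ℝ × ℝ ↦ k p.1 p.2)) {C : ℝ} (x y : ℝ)
    (hC : ∀ s, ‖k s y‖ ≤ C) : ‖volterra χ k x y‖ ≤ ℓ * C := by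
  have hC0 : 0 ≤ C := (norm_nonneg _).trans (hC 0)
  have hcont : Continuous (fun s ↦ χ (s - y) • k s y) :=
    (hχ.comp (by fun_prop)).smul (ck.comp (by fun_prop : Continuous fun s : ℝ ↦ (s, y)))
  have hle : ∀ s, ‖χ (s - y) • k s y‖ ≤ C := fun s ↦ by
    rw [norm_smul]
    calc _ ≤ 1 * C := mul_le_mul (hχ1 _) (hC s) (norm_nonneg _) zero_le_one
      _ = C := one_mul C
  have hshort : ∀ z, |z - y| ≤ ℓ → ‖∫ s in y..z, χ (s - y) • k s y‖ ≤ ℓ * C := by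
    intro z hz
    refine (intervalIntegral.norm_integral_le_of_norm_le_const fun s _ ↦ hle s).trans ?_
    rw [mul_comm]; gcongr
  have hlong : ∀ z, |z - y| = ℓ → (∀ s ∈ Set.uIcc z x, ℓ ≤ |s - y|) →
      ‖volterra χ k x y‖ ≤ ℓ * C := by
    intro z hz h
    rw [volterra, ← intervalIntegral.integral_add_adjacent_intervals
      (hcont.intervalIntegrable y z) (hcont.intervalIntegrable z x),
      intervalIntegral.integral_congr (g := fun _ ↦ (0 : E)) (a := z)
        (fun s hs ↦ by simp [hχ0 _ (h s hs)])]
    simpa using hshort z hz.le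
  rcases le_total |x - y| ℓ with h | h
  · exact hshort x h
  · rcases le_total y x with hxy | hxy
    · rw [abs_of_nonneg (by linarith)] at h
      refine hlong (y + ℓ) (by simp [abs_of_nonneg hℓ]) fun s hs ↦ ?_
      rw [Set.uIcc_of_le (by linarith)] at hs
      exact le_trans (by linarith [hs.1]) (le_abs_self _)
    · rw [abs_of_nonpos (by linarith)] at h
      refine hlong (y - ℓ) (by simp [abs_of_nonneg hℓ]) fun s hs ↦ ?_
      rw [Set.uIcc_of_ge (by linarith)] at hs
      exact le_trans (by linarith [hs.2]) (neg_le_abs _)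

end Regularity

/-! ### The system in characteristic coordinates -/

open scoped BoundedContinuousFunction

section Operator

open BoundedContinuousFunction

theorem volterra_add {χ : ℝ → ℝ} (hχ : Continuous χ) {k l : ℝ → ℝ → ℂ}
    (ck : Continuous (fun p : ℝ × ℝ ↦ k p.1 p.2)) (cl : Continuous (fun p : ℝ × ℝ ↦ l p.1 p.2))
    (x y : ℝ) :
    volterra χ (fun s t ↦ k s t + l s t) x y = volterra χ k x y + volterra χ l x y := by
  have h : ∀ {k : ℝ → ℝ → ℂ}, Continuous (fun p : ℝ × ℝ ↦ k p.1 p.2) →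
      IntervalIntegrable (fun s ↦ χ (s - y) • k s y) volume y x := fun ck ↦
    Continuous.intervalIntegrable ((hχ.comp (by fun_prop)).smul
      (ck.comp (by fun_prop : Continuous fun s : ℝ ↦ (s, y)))) _ _
  unfold volterra
  rw [← intervalIntegral.integral_add (h ck) (h cl)]
  simp only [smul_add]

theorem volterra_smul (χ : ℝ → ℝ) (c : ℂ) (k : ℝ → ℝ → ℂ) (x y : ℝ) :
    volterra χ (fun s t ↦ c * k s t) x y = c * volterra χ k x y := by
  unfold volterra
  rw [← smul_eq_mul, ← intervalIntegral.integral_smul]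
  simp only [smul_eq_mul, Complex.real_smul]
  congr 1
  funext s
  ring

theorem star_volterra (χ : ℝ → ℝ) (k : ℝ → ℝ → ℂ) (x y : ℝ) :
    volterra χ (fun s t ↦ star (k s t)) x y = star (volterra χ k x y) := by
  unfold volterra
  change _ = (starRingEnd ℂ) _
  rw [← intervalIntegral.intervalIntegral_conj]
  simp

/-- Integration along the first coordinate as an operator on bounded continuous functions. -/
def volterraFst (χ : ℝ → ℝ) {ℓ : ℝ} (hℓ : 0 ≤ ℓ) (hχ : Continuous χ)
    (hχ1 : ∀ s, |χ s| ≤ 1) (hχ0 : ∀ s, ℓ ≤ |s| → χ s = 0) :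
    ((ℝ × ℝ) →ᵇ ℂ) →ₗ[ℂ] ((ℝ × ℝ) →ᵇ ℂ) where
  toFun k := BoundedContinuousFunction.ofNormedAddCommGroup
    (fun p ↦ volterra χ (fun s t ↦ k (s, t)) p.1 p.2) (continuous_volterra hχ k.continuous)
    (ℓ * ‖k‖) (fun p ↦ norm_volterra_le hℓ hχ hχ1 hχ0 k.continuous _ _ fun _ ↦ k.norm_coe_le_norm _)
  map_add' k l := by
    ext p
    exact volterra_add hχ (k := fun s t ↦ k (s, t)) (l := fun s t ↦ l (s, t)) k.continuous
      l.continuous _ _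
  map_smul' c k := by
    ext p
    exact volterra_smul χ c (fun s t ↦ k (s, t)) _ _

/-- Integration along the second coordinate as an operator on bounded continuous functions. -/
def volterraSnd (χ : ℝ → ℝ) {ℓ : ℝ} (hℓ : 0 ≤ ℓ) (hχ : Continuous χ)
    (hχ1 : ∀ s, |χ s| ≤ 1) (hχ0 : ∀ s, ℓ ≤ |s| → χ s = 0) :
    ((ℝ × ℝ) →ᵇ ℂ) →ₗ[ℂ] ((ℝ × ℝ) →ᵇ ℂ) where
  toFun k := (volterraFst χ hℓ hχ hχ1 hχ0
    (k.compContinuous ⟨Prod.swap, continuous_swap⟩)).compContinuous ⟨Prod.swap, continuous_swap⟩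
  map_add' k l := by
    rw [show (k + l).compContinuous ⟨Prod.swap, continuous_swap⟩
      = k.compContinuous ⟨Prod.swap, continuous_swap⟩
        + l.compContinuous ⟨Prod.swap, continuous_swap⟩ from rfl, map_add]
    rfl
  map_smul' c k := by
    rw [show (c • k).compContinuous ⟨Prod.swap, continuous_swap⟩
      = c • k.compContinuous ⟨Prod.swap, continuous_swap⟩ from rfl, map_smul]
    rfl

end Operator

/-- Classical solutions, in the strip `|x - y| < ρ`, of the system in the characteristic
coordinates `x` (which is `x + t`) and `y` (which is `x - t`), for the sum `u` and the difference
`v` of the two components of the Dirac field; `q` is the derivative of the Klein-Gordon field `φ` in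
the direction of `x`. -/
structure IsCharacteristicSolution (m M ρ : ℝ) (u v : ℝ → ℝ → ℂ) (q φ : ℝ → ℝ → ℝ) : Prop where
  contDiff_u : ContDiff ℝ 1 (fun p : ℝ × ℝ ↦ u p.1 p.2)
  contDiff_v : ContDiff ℝ 1 (fun p : ℝ × ℝ ↦ v p.1 p.2)
  contDiff_q : ContDiff ℝ 1 (fun p : ℝ × ℝ ↦ q p.1 p.2)
  contDiff_phi : ContDiff ℝ 2 (fun p : ℝ × ℝ ↦ φ p.1 p.2)
  deriv_u : ∀ x y, |x - y| < ρ →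
    HasDerivAt (fun y ↦ u x y) (Complex.I / 2 * ((φ x y - m) * v x y)) y
  deriv_v : ∀ x y, |x - y| < ρ →
    HasDerivAt (fun x ↦ v x y) (-(Complex.I / 2 * ((φ x y - m) * u x y))) x
  deriv_q : ∀ x y, |x - y| < ρ →
    HasDerivAt (fun y ↦ q x y) (M ^ 2 / 4 * φ x y - 1 / 4 * (u x y * star (v x y)).re) y
  deriv_phi : ∀ x y, |x - y| < ρ → HasDerivAt (fun x ↦ φ x y) (q x y) x

theorem exists_partials_of_contDiff {E : Type*} [NormedAddCommGroup E] [NormedSpace ℝ E]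
    {f : ℝ → ℝ → E} (hf : ContDiff ℝ 1 (fun p : ℝ × ℝ ↦ f p.1 p.2)) :
    ∃ fx fy : ℝ → ℝ → E, Continuous (fun p : ℝ × ℝ ↦ fx p.1 p.2) ∧
      Continuous (fun p : ℝ × ℝ ↦ fy p.1 p.2) ∧
      (∀ x y, HasDerivAt (fun x ↦ f x y) (fx x y) x) ∧
      (∀ x y, HasDerivAt (fun y ↦ f x y) (fy x y) y) := by
  have hc := hf.continuous_fderiv (by norm_num)
  refine ⟨fun x y ↦ fderiv ℝ (fun p : ℝ × ℝ ↦ f p.1 p.2) (x, y) (1, 0),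
    fun x y ↦ fderiv ℝ (fun p : ℝ × ℝ ↦ f p.1 p.2) (x, y) (0, 1),
    hc.clm_apply continuous_const, hc.clm_apply continuous_const, fun x y ↦ ?_, fun x y ↦ ?_⟩
  · exact (((hf.differentiable (by norm_num)) (x, y)).hasFDerivAt).comp_hasDerivAt
      (f := fun x : ℝ ↦ (x, y)) x ((hasDerivAt_id x).prodMk (hasDerivAt_const x y))
  · exact (((hf.differentiable (by norm_num)) (x, y)).hasFDerivAt).comp_hasDerivAt
      (f := fun y : ℝ ↦ (x, y)) y ((hasDerivAt_const y x).prodMk (hasDerivAt_id y))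

/-- Continuous solutions of the integrated system are classical ones: along each characteristic
the integrand has a continuous derivative in the transversal direction. -/
theorem regularity_integrated_system {χ : ℝ → ℝ} (hχ : ContDiff ℝ (⊤ : ℕ∞) χ)
    {m M : ℝ} {u v q φ : ℝ → ℝ → ℂ} {u₀ v₀ q₀ φ₀ : ℝ → ℂ}
    (cu₀ : ContDiff ℝ 1 u₀) (cv₀ : ContDiff ℝ 1 v₀) (cq₀ : ContDiff ℝ 1 q₀)
    (cφ₀ : ContDiff ℝ 2 φ₀)
    (cu : Continuous (fun p : ℝ × ℝ ↦ u p.1 p.2)) (cv : Continuous (fun p : ℝ × ℝ ↦ v p.1 p.2))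
    (cq : Continuous (fun p : ℝ × ℝ ↦ q p.1 p.2)) (cφ : Continuous (fun p : ℝ × ℝ ↦ φ p.1 p.2))
    (hu : ∀ x y, u x y = u₀ x +
      volterra χ (fun s t ↦ Complex.I / 2 * (φ t s * v t s - m * v t s)) y x)
    (hv : ∀ x y, v x y = v₀ y -
      volterra χ (fun s t ↦ Complex.I / 2 * (φ s t * u s t - m * u s t)) x y)
    (hq : ∀ x y, q x y = q₀ x +
      volterra χ (fun s t ↦ ((M ^ 2 / 4 : ℝ) : ℂ) * φ t s
        - ((1 / 8 : ℝ) : ℂ) * (u t s * star (v t s) + v t s * star (u t s))) y x)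
    (hφ : ∀ x y, φ x y = φ₀ y + volterra χ q x y) :
    ContDiff ℝ 1 (fun p : ℝ × ℝ ↦ u p.1 p.2) ∧ ContDiff ℝ 1 (fun p : ℝ × ℝ ↦ v p.1 p.2) ∧
    ContDiff ℝ 1 (fun p : ℝ × ℝ ↦ q p.1 p.2) ∧ ContDiff ℝ 2 (fun p : ℝ × ℝ ↦ φ p.1 p.2) ∧
    (∀ x y, HasDerivAt (fun y ↦ u x y)
      (χ (y - x) • (Complex.I / 2 * (φ x y * v x y - m * v x y))) y) ∧
    (∀ x y, HasDerivAt (fun x ↦ v x y)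
      (-(χ (x - y) • (Complex.I / 2 * (φ x y * u x y - m * u x y)))) x) ∧
    (∀ x y, HasDerivAt (fun y ↦ q x y) (χ (y - x) • (((M ^ 2 / 4 : ℝ) : ℂ) * φ x y
        - ((1 / 8 : ℝ) : ℂ) * (u x y * star (v x y) + v x y * star (u x y)))) y) ∧
    (∀ x y, HasDerivAt (fun x ↦ φ x y) (χ (x - y) • q x y) x) := by
  have hχc := hχ.continuous
  have hχ1 : ContDiff ℝ 1 χ := hχ.of_le (by simp)
  have hswap : ∀ {k : ℝ → ℝ → ℂ}, Continuous (fun p : ℝ × ℝ ↦ k p.1 p.2) →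
      Continuous (fun p : ℝ × ℝ ↦ k p.2 p.1) := fun ck ↦ ck.comp continuous_swap
  have hswap1 : ∀ {k : ℝ → ℝ → ℂ}, ContDiff ℝ 1 (fun p : ℝ × ℝ ↦ k p.1 p.2) →
      ContDiff ℝ 1 (fun p : ℝ × ℝ ↦ k p.2 p.1) := fun ck ↦
    ck.comp (contDiff_snd.prodMk contDiff_fst)
  have cu' := hswap cu
  have cv' := hswap cv
  have cφ' := hswap cφ
  -- The derivatives along the characteristics.
  have du : ∀ x y, HasDerivAt (fun y ↦ u x y)
      (χ (y - x) • (Complex.I / 2 * (φ x y * v x y - m * v x y))) y := by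
    intro x y
    simp only [hu x]
    exact (hasDerivAt_volterra hχc (k := fun s t ↦ Complex.I / 2 * (φ t s * v t s - m * v t s))
      (by fun_prop) y x).const_add _
  have dv : ∀ x y, HasDerivAt (fun x ↦ v x y)
      (-(χ (x - y) • (Complex.I / 2 * (φ x y * u x y - m * u x y)))) x := by
    intro x y
    simp only [hv _ y]
    exact (hasDerivAt_volterra hχc (k := fun s t ↦ Complex.I / 2 * (φ s t * u s t - m * u s t))
      (by fun_prop) x y).const_sub _
  have dq : ∀ x y, HasDerivAt (fun y ↦ q x y) (χ (y - x) • (((M ^ 2 / 4 : ℝ) : ℂ) * φ x y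
        - ((1 / 8 : ℝ) : ℂ) * (u x y * star (v x y) + v x y * star (u x y)))) y := by
    intro x y
    simp only [hq x]
    exact (hasDerivAt_volterra hχc (k := fun s t ↦ ((M ^ 2 / 4 : ℝ) : ℂ) * φ t s
      - ((1 / 8 : ℝ) : ℂ) * (u t s * star (v t s) + v t s * star (u t s)))
      (by fun_prop) y x).const_add _
  have dφ : ∀ x y, HasDerivAt (fun x ↦ φ x y) (χ (x - y) • q x y) x := by
    intro x y
    simp only [hφ _ y]
    exact (hasDerivAt_volterra hχc cq x y).const_add _
  -- The transversal derivatives.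
  have Cu : ContDiff ℝ 1 (fun p : ℝ × ℝ ↦ u p.1 p.2) := by
    have := contDiff_one_volterra hχ (k := fun s t ↦ Complex.I / 2 * (φ t s * v t s - m * v t s))
      (k2 := fun s t ↦ Complex.I / 2 * ((χ (t - s) • q t s) * v t s
        + φ t s * (-(χ (t - s) • (Complex.I / 2 * (φ t s * u t s - m * u t s))))
        - m * (-(χ (t - s) • (Complex.I / 2 * (φ t s * u t s - m * u t s))))))
      (by fun_prop) (by have := hswap cq; fun_prop)
      (fun s t ↦ ((((dφ t s).mul (dv t s)).sub ((dv t s).const_mul _)).const_mul _))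
    simp only [hu]
    exact (cu₀.comp contDiff_fst).add (this.comp (contDiff_snd.prodMk contDiff_fst))
  have Cφ : ContDiff ℝ 1 (fun p : ℝ × ℝ ↦ φ p.1 p.2) := by
    have := contDiff_one_volterra hχ cq (by fun_prop) dq
    simp only [hφ]
    exact ((cφ₀.of_le (by norm_num)).comp contDiff_snd).add this
  obtain ⟨-, φy, -, cφy, -, dφy⟩ := exists_partials_of_contDiff Cφ
  have Cv : ContDiff ℝ 1 (fun p : ℝ × ℝ ↦ v p.1 p.2) := by
    have := contDiff_one_volterra hχ (k := fun s t ↦ Complex.I / 2 * (φ s t * u s t - m * u s t))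
      (by fun_prop) (by fun_prop)
      (fun s t ↦ ((((dφy s t).mul (du s t)).sub ((du s t).const_mul _)).const_mul _))
    simp only [hv]
    exact (cv₀.comp contDiff_snd).sub this
  have Csu : ContDiff ℝ 1 (fun p : ℝ × ℝ ↦ star (u p.1 p.2)) := Complex.conjCLE.contDiff.comp Cu
  have Csv : ContDiff ℝ 1 (fun p : ℝ × ℝ ↦ star (v p.1 p.2)) := Complex.conjCLE.contDiff.comp Cv
  have CH : ContDiff ℝ 1 (fun p : ℝ × ℝ ↦ ((M ^ 2 / 4 : ℝ) : ℂ) * φ p.1 p.2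
        - ((1 / 8 : ℝ) : ℂ) * (u p.1 p.2 * star (v p.1 p.2) + v p.1 p.2 * star (u p.1 p.2))) :=
    (contDiff_const.mul Cφ).sub (contDiff_const.mul ((Cu.mul Csv).add (Cv.mul Csu)))
  obtain ⟨Hx, -, cHx, -, dHx, -⟩ := exists_partials_of_contDiff
    (f := fun x y ↦ ((M ^ 2 / 4 : ℝ) : ℂ) * φ x y
        - ((1 / 8 : ℝ) : ℂ) * (u x y * star (v x y) + v x y * star (u x y))) CH
  have Cq : ContDiff ℝ 1 (fun p : ℝ × ℝ ↦ q p.1 p.2) := by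
    have := contDiff_one_volterra hχ (k := fun s t ↦ ((M ^ 2 / 4 : ℝ) : ℂ) * φ t s
      - ((1 / 8 : ℝ) : ℂ) * (u t s * star (v t s) + v t s * star (u t s)))
      (k2 := fun s t ↦ Hx t s) (by fun_prop) (hswap cHx) (fun s t ↦ dHx t s)
    simp only [hq]
    exact (cq₀.comp contDiff_fst).add (this.comp (contDiff_snd.prodMk contDiff_fst))
  refine ⟨Cu, Cv, Cq, ?_, du, dv, dq, dφ⟩
  have := contDiff_two_volterra hχ Cq
    ((hχ1.comp (by fun_prop : ContDiff ℝ 1 fun p : ℝ × ℝ ↦ p.2 - p.1)).smul CH) dq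
  simp only [hφ]
  exact (cφ₀.comp contDiff_snd).add this

/-- For data given on the diagonal, the characteristic system is solvable in a strip of a width
that is inversely proportional to the size of the data for the fields `u` and `v`. -/
theorem exists_characteristic_solution {m M ρ N Q₀ B₀ R : ℝ} (hm : 0 ≤ m) (hρ : 0 < ρ) (hN : 0 < N)
    {u₀ v₀ : ℝ → ℂ} {q₀ φ₀ : ℝ → ℝ}
    (cu₀ : ContDiff ℝ 1 u₀) (cv₀ : ContDiff ℝ 1 v₀) (cq₀ : ContDiff ℝ 1 q₀)
    (cφ₀ : ContDiff ℝ 2 φ₀)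
    (hsupp : ∀ x, R < |x| → u₀ x = 0 ∧ v₀ x = 0 ∧ q₀ x = 0 ∧ φ₀ x = 0)
    (hu₀ : ∀ x, ‖u₀ x‖ ≤ N / (2 * ρ)) (hv₀ : ∀ x, ‖v₀ x‖ ≤ N / (2 * ρ))
    (hq₀ : ∀ x, |q₀ x| ≤ Q₀) (hφ₀ : ∀ x, |φ₀ x| ≤ B₀)
    (h1 : 2 * ρ * ((B₀ + N ^ 2 + 1) + m + 16 * N ^ 2) ≤ 1)
    (h2 : 2 * (2 * ρ) * Q₀ + (2 * ρ) ^ 2 * M ^ 2 * (B₀ + N ^ 2 + 1) / 2 ≤ 2)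
    (h3 : (2 * ρ) ^ 2 * M ^ 2 ≤ 1 / 2) :
    ∃ (u v : ℝ → ℝ → ℂ) (q φ : ℝ → ℝ → ℝ), IsCharacteristicSolution m M ρ u v q φ ∧
      (∀ x, u x x = u₀ x ∧ v x x = v₀ x ∧ q x x = q₀ x ∧ φ x x = φ₀ x) ∧
      (∀ x y, (R < x ∧ R < y) ∨ (x < -R ∧ y < -R) →
        u x y = 0 ∧ v x y = 0 ∧ q x y = 0 ∧ φ x y = 0) ∧
      (∀ x y, ‖u x y‖ ≤ N / ρ ∧ ‖v x y‖ ≤ N / ρ ∧ |φ x y| ≤ B₀ + N ^ 2 + 1) ∧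
      (∀ x y, ‖u x y - u₀ x‖ ≤ (B₀ + N ^ 2 + 1 + m) * N ∧
        ‖v x y - v₀ y‖ ≤ (B₀ + N ^ 2 + 1 + m) * N) := by
  set ℓ : ℝ := 2 * ρ with hℓdef
  have hℓ : 0 < ℓ := by positivity
  obtain ⟨χ₁, hχ₁, hχ₁1, hχ₁0, hχ₁b, hχ₁n⟩ := exists_cutoff
  let χ : ℝ → ℝ := fun s ↦ χ₁ (s / ρ)
  have hχ : ContDiff ℝ (⊤ : ℕ∞) χ := hχ₁.comp (by fun_prop)
  have hχc := hχ.continuous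
  have hχone : ∀ s, |s| < ρ → χ s = 1 := fun s hs ↦ hχ₁1 _ (by
    rw [abs_div, abs_of_pos hρ, div_le_one hρ]; exact hs.le)
  have hχ1 : ∀ s, |χ s| ≤ 1 := fun s ↦ abs_le.2 ⟨by linarith [(hχ₁b (s / ρ)).1], (hχ₁b (s / ρ)).2⟩
  have hχ0 : ∀ s, ℓ ≤ |s| → χ s = 0 := fun s hs ↦ hχ₁0 _ (by
    rw [abs_div, abs_of_pos hρ, le_div_iff₀ hρ]; exact hs)
  let V := volterraFst χ hℓ.le hχc hχ1 hχ0
  let V' := volterraSnd χ hℓ.le hχc hχ1 hχ0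
  have hVe : ∀ k p, V k p = volterra χ (fun s t ↦ k (s, t)) p.1 p.2 := fun k p ↦ rfl
  have hVe' : ∀ k p, V' k p = volterra χ (fun s t ↦ k (t, s)) p.2 p.1 := fun k p ↦ rfl
  have hV : ∀ k, ‖V k‖ ≤ ℓ * ‖k‖ := fun k ↦
    (BoundedContinuousFunction.norm_le (by positivity)).2 fun p ↦
      norm_volterra_le hℓ.le hχc hχ1 hχ0 (k := fun s t ↦ k (s, t)) k.continuous _ _
        fun _ ↦ k.norm_coe_le_norm _
  have hV' : ∀ k, ‖V' k‖ ≤ ℓ * ‖k‖ := fun k ↦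
    (BoundedContinuousFunction.norm_le (by positivity)).2 fun p ↦
      norm_volterra_le hℓ.le hχc hχ1 hχ0 (k := fun s t ↦ k (t, s))
        (k.continuous.comp continuous_swap) _ _ fun _ ↦ k.norm_coe_le_norm _
  have hVs : ∀ k, V (star k) = star (V k) := fun k ↦ by
    ext p; exact star_volterra χ (fun s t ↦ k (s, t)) _ _
  have hVs' : ∀ k, V' (star k) = star (V' k) := fun k ↦ by
    ext p; exact star_volterra χ (fun s t ↦ k (t, s)) _ _
  -- The functions that vanish where both coordinates lie on the same side of the support of the
  -- data; the integrations preserve this, which is the finite speed of propagation.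
  let Z : Set (ℝ × ℝ) := {p | (R < p.1 ∧ R < p.2) ∨ (p.1 < -R ∧ p.2 < -R)}
  let S : Submodule ℂ ((ℝ × ℝ) →ᵇ ℂ) :=
    { carrier := {k | ∀ p ∈ Z, k p = 0}
      add_mem' := fun ha hb p hp ↦ by simp [ha p hp, hb p hp]
      zero_mem' := fun p hp ↦ rfl
      smul_mem' := fun c k hk p hp ↦ by simp [hk p hp] }
  have hS : IsClosed (S : Set ((ℝ × ℝ) →ᵇ ℂ)) := by
    have : (S : Set ((ℝ × ℝ) →ᵇ ℂ)) = ⋂ p ∈ Z, {k | k p = 0} := by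
      ext k
      simp only [Set.mem_iInter]
      rfl
    rw [this]
    exact isClosed_biInter fun p _ ↦
      isClosed_eq (BoundedContinuousFunction.lipschitz_eval_const p).continuous continuous_const
  have hSm : ∀ k ∈ S, ∀ l, k * l ∈ S := fun k hk l p hp ↦ by
    rw [BoundedContinuousFunction.mul_apply, hk p hp, zero_mul]
  have hZ : ∀ p ∈ Z, ∀ s ∈ Set.uIcc p.2 p.1, (s, p.2) ∈ Z ∧ (p.1, s) ∈ Z := by
    rintro ⟨x, y⟩ hp s hs
    simp only [Z, Set.mem_ofPred_eq] at hp ⊢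
    rcases hp with ⟨h1, h2⟩ | ⟨h1, h2⟩
    · have : R < s := lt_of_lt_of_le (lt_min h2 h1) hs.1
      exact ⟨Or.inl ⟨this, h2⟩, Or.inl ⟨h1, this⟩⟩
    · have : s < -R := lt_of_le_of_lt hs.2 (max_lt h2 h1)
      exact ⟨Or.inr ⟨this, h2⟩, Or.inr ⟨h1, this⟩⟩
  have hSV : ∀ k ∈ S, V k ∈ S := fun k hk p hp ↦ by
    rw [hVe, volterra, intervalIntegral.integral_congr (g := fun _ ↦ (0 : ℂ))
      (fun s hs ↦ by simp [hk _ (hZ p hp s hs).1])]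
    simp
  have hSV' : ∀ k ∈ S, V' k ∈ S := fun k hk p hp ↦ by
    rw [hVe', volterra, intervalIntegral.integral_congr (g := fun _ ↦ (0 : ℂ))
      (fun s hs ↦ by simp [hk _ (hZ p hp s (by rwa [Set.uIcc_comm])).2])]
    simp
  let u₁ : (ℝ × ℝ) →ᵇ ℂ := BoundedContinuousFunction.ofNormedAddCommGroup (fun p ↦ u₀ p.1)
    (cu₀.continuous.comp continuous_fst) _ (fun p ↦ hu₀ p.1)
  let v₁ : (ℝ × ℝ) →ᵇ ℂ := BoundedContinuousFunction.ofNormedAddCommGroup (fun p ↦ v₀ p.2)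
    (cv₀.continuous.comp continuous_snd) _ (fun p ↦ hv₀ p.2)
  let q₁ : (ℝ × ℝ) →ᵇ ℂ := BoundedContinuousFunction.ofNormedAddCommGroup (fun p ↦ (q₀ p.1 : ℂ))
    (Complex.continuous_ofReal.comp (cq₀.continuous.comp continuous_fst)) Q₀
    (fun p ↦ by rw [Complex.norm_real]; exact hq₀ p.1)
  let φ₁ : (ℝ × ℝ) →ᵇ ℂ := BoundedContinuousFunction.ofNormedAddCommGroup (fun p ↦ (φ₀ p.2 : ℂ))
    (Complex.continuous_ofReal.comp (cφ₀.continuous.comp continuous_snd)) B₀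
    (fun p ↦ by rw [Complex.norm_real]; exact hφ₀ p.2)
  have hNℓ : 0 ≤ N / ℓ := by positivity
  have hQ₀ : 0 ≤ Q₀ := (abs_nonneg _).trans (hq₀ 0)
  have hB₀ : 0 ≤ B₀ := (abs_nonneg _).trans (hφ₀ 0)
  have habs : ∀ x, (R < x ∨ x < -R) → R < |x| := by
    rintro x (h | h)
    · exact h.trans_le (le_abs_self _)
    · exact (by linarith : R < -x).trans_le (neg_le_abs _)
  have hZ1 : ∀ p ∈ Z, R < |p.1| := fun p hp ↦ habs _ (hp.imp (fun h ↦ h.1) (fun h ↦ h.1))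
  have hZ2 : ∀ p ∈ Z, R < |p.2| := fun p hp ↦ habs _ (hp.imp (fun h ↦ h.2) (fun h ↦ h.2))
  obtain ⟨u, huS, v, hvS, q, hqS, φ, hφS, hqs, hφs, hun, hvn, hφn, eu, ev, eq, eφ⟩ :=
    exists_solution_integrated_system V V' hℓ hV hV' hVs hVs' S hS hSm hSV hSV'
      (m := m) (M := M) (N := N) (B := B₀ + N ^ 2 + 1) (Q₀ := Q₀) (B₀ := B₀) hm hN
      (u₀ := u₁) (v₀ := v₁) (q₀ := q₁) (φ₀ := φ₁)
      (fun p hp ↦ (hsupp _ (hZ1 p hp)).1) (fun p hp ↦ (hsupp _ (hZ2 p hp)).2.1)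
      (fun p hp ↦ by change ((q₀ p.1 : ℝ) : ℂ) = 0; rw [(hsupp _ (hZ1 p hp)).2.2.1]; simp)
      (fun p hp ↦ by change ((φ₀ p.2 : ℝ) : ℂ) = 0; rw [(hsupp _ (hZ2 p hp)).2.2.2]; simp)
      (by ext p; exact Complex.conj_ofReal _) (by ext p; exact Complex.conj_ofReal _)
      (BoundedContinuousFunction.norm_ofNormedAddCommGroup_le _ hNℓ _)
      (BoundedContinuousFunction.norm_ofNormedAddCommGroup_le _ hNℓ _)
      (BoundedContinuousFunction.norm_ofNormedAddCommGroup_le _ hQ₀ _)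
      (BoundedContinuousFunction.norm_ofNormedAddCommGroup_le _ hB₀ _)
      rfl h1 h2 h3
  have hB : 0 ≤ B₀ + N ^ 2 + 1 := by positivity
  have eu' : ∀ x y, u (x, y) = u₀ x + volterra χ
      (fun s t ↦ Complex.I / 2 * (φ (t, s) * v (t, s) - m * v (t, s))) y x := fun x y ↦
    congrArg (fun k : (ℝ × ℝ) →ᵇ ℂ ↦ k (x, y)) eu
  have ev' : ∀ x y, v (x, y) = v₀ y - volterra χ
      (fun s t ↦ Complex.I / 2 * (φ (s, t) * u (s, t) - m * u (s, t))) x y := fun x y ↦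
    congrArg (fun k : (ℝ × ℝ) →ᵇ ℂ ↦ k (x, y)) ev
  have eq' : ∀ x y, q (x, y) = (q₀ x : ℂ) + volterra χ (fun s t ↦
      ((M ^ 2 / 4 : ℝ) : ℂ) * φ (t, s) - ((1 / 8 : ℝ) : ℂ) *
        (u (t, s) * star (v (t, s)) + v (t, s) * star (u (t, s)))) y x := fun x y ↦
    congrArg (fun k : (ℝ × ℝ) →ᵇ ℂ ↦ k (x, y)) eq
  have eφ' : ∀ x y, φ (x, y) = (φ₀ y : ℂ) + volterra χ (fun s t ↦ q (s, t)) x y := fun x y ↦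
    congrArg (fun k : (ℝ × ℝ) →ᵇ ℂ ↦ k (x, y)) eφ
  have hqr : ∀ p, ((q p).re : ℂ) = q p := fun p ↦ Complex.conj_eq_iff_re.1
    (congrArg (fun k : (ℝ × ℝ) →ᵇ ℂ ↦ k p) hqs)
  have hφr : ∀ p, ((φ p).re : ℂ) = φ p := fun p ↦ Complex.conj_eq_iff_re.1
    (congrArg (fun k : (ℝ × ℝ) →ᵇ ℂ ↦ k p) hφs)
  obtain ⟨Cu, Cv, Cq, Cφ, du, dv, dq, dφ⟩ := regularity_integrated_system hχ
    (u := fun x y ↦ u (x, y)) (v := fun x y ↦ v (x, y)) (q := fun x y ↦ q (x, y))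
    (φ := fun x y ↦ φ (x, y)) cu₀ cv₀ (Complex.ofRealCLM.contDiff.comp cq₀)
    (Complex.ofRealCLM.contDiff.comp cφ₀) u.continuous v.continuous q.continuous φ.continuous
    eu' ev' eq' eφ'
  have hdiag : ∀ (k : ℝ → ℝ → ℂ) x, volterra χ k x x = 0 := fun k x ↦ by simp [volterra]
  refine ⟨fun x y ↦ u (x, y), fun x y ↦ v (x, y), fun x y ↦ (q (x, y)).re,
    fun x y ↦ (φ (x, y)).re, ⟨Cu, Cv, Complex.reCLM.contDiff.comp Cq,
    Complex.reCLM.contDiff.comp Cφ, ?_, ?_, ?_, ?_⟩, ?_, ?_, ?_, ?_⟩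
  · intro x y hxy
    have := du x y
    rw [hχone _ (by rwa [abs_sub_comm]), one_smul] at this
    rw [hφr]
    convert this using 1
    ring
  · intro x y hxy
    have := dv x y
    rw [hχone _ hxy, one_smul] at this
    rw [hφr]
    convert this using 1
    ring
  · intro x y hxy
    have := dq x y
    rw [hχone _ (by rwa [abs_sub_comm]), one_smul] at this
    have h4 := Complex.reCLM.hasFDerivAt.comp_hasDerivAt y this
    refine HasDerivAt.congr_deriv h4 ?_
    simp only [Complex.reCLM_apply, Complex.sub_re, Complex.add_re,
      Complex.mul_re, Complex.ofReal_re, Complex.ofReal_im, Complex.star_def, Complex.conj_re,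
      Complex.conj_im]
    ring
  · intro x y hxy
    have := dφ x y
    rw [hχone _ hxy, one_smul] at this
    exact Complex.reCLM.hasFDerivAt.comp_hasDerivAt x this
  · intro x
    beta_reduce
    rw [eu', ev', eq', eφ', hdiag, hdiag, hdiag, hdiag]
    simp
  · intro x y hxy
    beta_reduce
    rw [huS (x, y) hxy, hvS (x, y) hxy, hqS (x, y) hxy, hφS (x, y) hxy]
    simp
  · intro x y
    have e : 2 * N / ℓ = N / ρ := by rw [hℓdef]; field_simp
    rw [e] at hun hvn
    exact ⟨(u.norm_coe_le_norm _).trans hun, (v.norm_coe_le_norm _).trans hvn,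
      (Complex.abs_re_le_norm _).trans ((φ.norm_coe_le_norm _).trans hφn)⟩
  · intro x y
    have hprod : ∀ c : (ℝ × ℝ) →ᵇ ℂ, ‖c‖ ≤ 2 * N / ℓ →
        ℓ * ‖(Complex.I / 2 : ℂ) • (φ * c - (m : ℂ) • c)‖ ≤ (B₀ + N ^ 2 + 1 + m) * N := by
      intro c hc
      rw [norm_smul]
      calc _ ≤ ℓ * (1 / 2 * ((B₀ + N ^ 2 + 1) * (2 * N / ℓ) + m * (2 * N / ℓ))) := by
            gcongr
            · simp
            · refine (norm_sub_le _ _).trans (add_le_add ((norm_mul_le _ _).trans (by gcongr)) ?_)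
              rw [norm_smul, Complex.norm_real, Real.norm_of_nonneg hm]
              gcongr
        _ = _ := by field_simp
    constructor
    · have e : u (x, y) - u₀ x = V' ((Complex.I / 2 : ℂ) • (φ * v - (m : ℂ) • v)) (x, y) := by
        rw [sub_eq_iff_eq_add']
        exact congrArg (fun k : (ℝ × ℝ) →ᵇ ℂ ↦ k (x, y)) eu
      rw [e]
      exact (BoundedContinuousFunction.norm_coe_le_norm _ _).trans ((hV' _).trans (hprod v hvn))
    · have e : v (x, y) - v₀ y = -V ((Complex.I / 2 : ℂ) • (φ * u - (m : ℂ) • u)) (x, y) := by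
        have : v (x, y) = v₀ y - V ((Complex.I / 2 : ℂ) • (φ * u - (m : ℂ) • u)) (x, y) :=
          congrArg (fun k : (ℝ × ℝ) →ᵇ ℂ ↦ k (x, y)) ev
        rw [this]; ring
      rw [e, norm_neg]
      exact (BoundedContinuousFunction.norm_coe_le_norm _ _).trans ((hV _).trans (hprod u hun))

/-! ### From characteristic coordinates to space and time -/

theorem memLp_of_finite_speed {F : Type*} [NormedAddCommGroup F] {u : ℝ → ℝ → F} {R : ℝ}
    (hu : Continuous (fun p : ℝ × ℝ ↦ u p.1 p.2))
    (hR : ∀ t x, R + |t| < |x| → u t x = 0) (t : ℝ) : MemLp (u t) 2 (volume : Measure ℝ) := by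
  have h1 : HasCompactSupport (u t) := HasCompactSupport.of_support_subset_isCompact
    (isCompact_Icc (a := -(R + |t|)) (b := R + |t|)) (fun x hx ↦ by
      by_contra h
      exact hx (hR t x (by rw [lt_abs]; simp only [Set.mem_Icc, not_and_or, not_le] at h; grind)))
  exact (hu.comp (by fun_prop : Continuous fun x : ℝ ↦ (t, x))).memLp_of_hasCompactSupport h1

theorem tendsto_eLpNorm_sub_of_finite_speed {F : Type*} [NormedAddCommGroup F]
    {u : ℝ → ℝ → F} {R : ℝ}
    (hu : Continuous (fun p : ℝ × ℝ ↦ u p.1 p.2))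
    (hR : ∀ t x, R + |t| < |x| → u t x = 0) (t : ℝ) :
    Filter.Tendsto (fun t' ↦ eLpNorm (u t' - u t) 2 (volume : Measure ℝ)) (𝓝 t) (𝓝 0) := by
  rw [ENNReal.tendsto_nhds_zero]
  intro ε hε
  set K : Set ℝ := Set.Icc (-(R + |t| + 1)) (R + |t| + 1) with hK
  have hKc : IsCompact K := isCompact_Icc
  obtain ⟨c, hc0, hc⟩ : ∃ c : ℝ, 0 < c ∧
      volume K ^ (1 / (2 : ℝ≥0∞).toReal) * ENNReal.ofReal c ≤ ε := by
    have h0 : volume K ^ (1 / (2 : ℝ≥0∞).toReal) ≠ ∞ :=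
      ENNReal.rpow_ne_top_of_nonneg (by positivity) hKc.measure_lt_top.ne
    have h1 : Filter.Tendsto (fun c : ℝ ↦ volume K ^ (1 / (2 : ℝ≥0∞).toReal) * ENNReal.ofReal c)
        (𝓝[>] 0) (𝓝 0) := by
      have := ENNReal.Tendsto.const_mul (a := volume K ^ (1 / (2 : ℝ≥0∞).toReal))
        ((ENNReal.continuous_ofReal.tendsto 0).mono_left (nhdsWithin_le_nhds (s := Set.Ioi 0)))
        (Or.inr h0)
      simpa using this
    have h2 := (ENNReal.tendsto_nhds_zero.1 h1 ε hε).and self_mem_nhdsWithin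
    obtain ⟨c, hc1, hc2⟩ := h2.exists
    exact ⟨c, hc2, hc1⟩
  obtain ⟨v, hv, hv2⟩ := hKc.mem_uniformity_of_prod (f := u) (s := Set.univ) (q := t)
    (by exact hu.continuousOn) (Set.mem_univ _) (Metric.dist_mem_uniformity hc0)
  rw [nhdsWithin_univ] at hv
  filter_upwards [hv, Metric.ball_mem_nhds t one_pos] with t' ht' ht1
  have hzero : ∀ x ∉ K, (u t' - u t) x = 0 := by
    intro x hx
    have h3 : R + |t| + 1 < |x| := by
      rw [lt_abs]; simp only [hK, Set.mem_Icc, not_and_or, not_le] at hx; grind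
    have h4 : |t'| ≤ |t| + 1 := by
      rw [Metric.mem_ball, Real.dist_eq] at ht1
      linarith [abs_sub_abs_le_abs_sub t' t]
    rw [Pi.sub_apply, hR t' x (by linarith), hR t x (by linarith), sub_zero]
  calc eLpNorm (u t' - u t) 2 volume
      = eLpNorm (u t' - u t) 2 (volume.restrict K) :=
        (eLpNorm_restrict_eq_of_support_subset fun x hx ↦ by
          by_contra h; exact hx (hzero x h)).symm
    _ ≤ volume K ^ (1 / (2 : ℝ≥0∞).toReal) * ENNReal.ofReal c := by
        have := eLpNorm_le_of_ae_bound (p := 2) (μ := volume.restrict K) (f := u t' - u t) (C := c)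
          (ae_restrict_of_forall_mem hKc.measurableSet fun x hx ↦ by
            have := hv2 t' ht' x hx
            rw [Set.mem_ofPred_eq, dist_eq_norm] at this
            exact this.le)
        simpa using this
    _ ≤ ε := hc

section Curve

variable {F : Type*} [NormedAddCommGroup F] [InnerProductSpace ℂ F] [CompleteSpace F]

/-- A curve with finite speed of propagation is continuous in `H^s`, `s ≤ 0`, as soon as it is
jointly continuous. -/
theorem isSobolevCurve_of_nonpos {s : ℝ} (hs : s ≤ 0) {u : ℝ → ℝ → F} {R : ℝ}
    (hu : Continuous (fun p : ℝ × ℝ ↦ u p.1 p.2))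
    (hR : ∀ t x, R + |t| < |x| → u t x = 0) (T : ℝ) : IsSobolevCurve T s u := by
  have hm := memLp_of_finite_speed hu hR
  refine ⟨fun t _ ↦ hm t, fun t _ ↦ ?_, fun t _ ↦ ?_⟩
  · obtain ⟨g, hg, -⟩ := exists_isWeightedFourier_of_nonpos hs ((hm t).toLp _)
    rw [← toDistribution_eq] at hg
    exact memSobolev_iff_exists_isWeightedFourier.2 ⟨g, hg⟩
  · have h1 := ENNReal.Tendsto.const_mul (a := ENNReal.ofReal (Real.sqrt (2 * Real.pi)))
      (tendsto_eLpNorm_sub_of_finite_speed hu hR t) (Or.inr ENNReal.ofReal_ne_top)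
    rw [mul_zero] at h1
    refine tendsto_of_tendsto_of_tendsto_of_le_of_le tendsto_const_nhds h1
      (fun _ ↦ zero_le) (fun t' ↦ ?_)
    rw [← toDistribution_sub (hm t') (hm t)]
    exact sobolevENorm_le_of_nonpos hs ((hm t').sub (hm t))

/-- A curve with finite speed of propagation is continuous in `H^s`, `s ≤ 1 / 2`, as soon as it and
its space derivative are jointly continuous. -/
theorem isSobolevCurve_of_le_half {s : ℝ} (hs : s ≤ 1 / 2) {u u' : ℝ → ℝ → F} {R : ℝ}
    (hu : Continuous (fun p : ℝ × ℝ ↦ u p.1 p.2)) (hu' : Continuous (fun p : ℝ × ℝ ↦ u' p.1 p.2))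
    (hd : ∀ t x, HasDerivAt (u t) (u' t x) x)
    (hR : ∀ t x, R + |t| < |x| → u t x = 0) (T : ℝ) : IsSobolevCurve T s u := by
  have hR' : ∀ t x, R + |t| < |x| → u' t x = 0 := by
    intro t x hx
    have h1 : u t =ᶠ[𝓝 x] fun _ ↦ 0 := by
      filter_upwards [(isOpen_lt continuous_const continuous_abs).mem_nhds hx] with y hy
      exact hR t y hy
    exact (hd t x).unique ((hasDerivAt_const x (0 : F)).congr_of_eventuallyEq h1)
  have hm := memLp_of_finite_speed hu hR
  have hm' := memLp_of_finite_speed hu' hR'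
  refine ⟨fun t _ ↦ hm t, fun t _ ↦ ?_, fun t _ ↦ ?_⟩
  · obtain ⟨g, hg, -⟩ := exists_isWeightedFourier_of_le_half hs (hm t) (hm' t) (hd t)
    exact memSobolev_iff_exists_isWeightedFourier.2 ⟨g, hg⟩
  · have h1 := ENNReal.Tendsto.const_mul (a := ENNReal.ofReal (Real.sqrt (2 * Real.pi)))
      ((tendsto_eLpNorm_sub_of_finite_speed hu hR t).add
        (tendsto_eLpNorm_sub_of_finite_speed hu' hR' t))
      (Or.inr ENNReal.ofReal_ne_top)
    rw [add_zero, mul_zero] at h1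
    refine tendsto_of_tendsto_of_tendsto_of_le_of_le tendsto_const_nhds h1
      (fun _ ↦ zero_le) (fun t' ↦ ?_)
    rw [← toDistribution_sub (hm t') (hm t)]
    exact sobolevENorm_le_of_hasDerivAt hs ((hm t').sub (hm t)) ((hm' t').sub (hm' t))
      (fun x ↦ (hd t' x).sub (hd t x))

end Curve

theorem hasDerivAt_time {E : Type*} [NormedAddCommGroup E] [NormedSpace ℝ E] {f : ℝ → ℝ → E}
    (hf : ContDiff ℝ 1 (fun p : ℝ × ℝ ↦ f p.1 p.2)) {t x : ℝ} {a b : E}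
    (ha : HasDerivAt (fun z ↦ f z (x - t)) a (x + t))
    (hb : HasDerivAt (fun z ↦ f (x + t) z) b (x - t)) :
    HasDerivAt (fun t ↦ f (x + t) (x - t)) (a - b) t := by
  have h1 := ((hf.differentiable (by norm_num)) (x + t, x - t)).hasFDerivAt
  have ha' := ha.unique (h1.comp_hasDerivAt (f := fun z : ℝ ↦ (z, x - t)) (x + t)
    ((hasDerivAt_id _).prodMk (hasDerivAt_const _ _)))
  have hb' := hb.unique (h1.comp_hasDerivAt (f := fun z : ℝ ↦ (x + t, z)) (x - t)
    ((hasDerivAt_const _ _).prodMk (hasDerivAt_id _)))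
  have h2 := h1.comp_hasDerivAt (f := fun t : ℝ ↦ (x + t, x - t)) t
    (((hasDerivAt_id t).const_add x).prodMk ((hasDerivAt_id t).const_sub x))
  rw [ha', hb', ← map_sub, show ((1 : ℝ), (0 : ℝ)) - (0, 1) = (1, -1) by simp]
  exact h2

theorem hasDerivAt_space {E : Type*} [NormedAddCommGroup E] [NormedSpace ℝ E] {f : ℝ → ℝ → E}
    (hf : ContDiff ℝ 1 (fun p : ℝ × ℝ ↦ f p.1 p.2)) {t x : ℝ} {a b : E}
    (ha : HasDerivAt (fun z ↦ f z (x - t)) a (x + t))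
    (hb : HasDerivAt (fun z ↦ f (x + t) z) b (x - t)) :
    HasDerivAt (fun x ↦ f (x + t) (x - t)) (a + b) x := by
  have h1 := ((hf.differentiable (by norm_num)) (x + t, x - t)).hasFDerivAt
  have ha' := ha.unique (h1.comp_hasDerivAt (f := fun z : ℝ ↦ (z, x - t)) (x + t)
    ((hasDerivAt_id _).prodMk (hasDerivAt_const _ _)))
  have hb' := hb.unique (h1.comp_hasDerivAt (f := fun z : ℝ ↦ (x + t, z)) (x - t)
    ((hasDerivAt_const _ _).prodMk (hasDerivAt_id _)))
  have h2 := h1.comp_hasDerivAt (f := fun x : ℝ ↦ (x + t, x - t)) x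
    (((hasDerivAt_id x).add_const t).prodMk ((hasDerivAt_id x).sub_const t))
  rw [ha', hb', ← map_add, show ((1 : ℝ), (0 : ℝ)) + (0, 1) = (1, 1) by simp]
  exact h2

theorem exists_second_partials_of_contDiff {E : Type*} [NormedAddCommGroup E] [NormedSpace ℝ E]
    {f : ℝ → ℝ → E} (hf : ContDiff ℝ 2 (fun p : ℝ × ℝ ↦ f p.1 p.2)) :
    ∃ fx fy fxy : ℝ → ℝ → E, ContDiff ℝ 1 (fun p : ℝ × ℝ ↦ fx p.1 p.2) ∧
      ContDiff ℝ 1 (fun p : ℝ × ℝ ↦ fy p.1 p.2) ∧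
      (∀ x y, HasDerivAt (fun x ↦ f x y) (fx x y) x) ∧
      (∀ x y, HasDerivAt (fun y ↦ f x y) (fy x y) y) ∧
      (∀ x y, HasDerivAt (fun y ↦ fx x y) (fxy x y) y) ∧
      (∀ x y, HasDerivAt (fun x ↦ fy x y) (fxy x y) x) := by
  have hc : ContDiff ℝ 1 (fderiv ℝ (fun p : ℝ × ℝ ↦ f p.1 p.2)) :=
    hf.fderiv_right (by norm_num)
  have hx : ∀ x y : ℝ, HasDerivAt (fun x : ℝ ↦ (x, y)) ((1 : ℝ), (0 : ℝ)) x := fun x y ↦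
    (hasDerivAt_id x).prodMk (hasDerivAt_const x y)
  have hy : ∀ x y : ℝ, HasDerivAt (fun y : ℝ ↦ (x, y)) ((0 : ℝ), (1 : ℝ)) y := fun x y ↦
    (hasDerivAt_const y x).prodMk (hasDerivAt_id y)
  have haux : ∀ (G : ℝ × ℝ → ℝ × ℝ →L[ℝ] E) (G' : ℝ × ℝ →L[ℝ] ℝ × ℝ →L[ℝ] E) (γ : ℝ → ℝ × ℝ)
      (γ' v : ℝ × ℝ) (z : ℝ), HasFDerivAt G G' (γ z) → HasDerivAt γ γ' z →
      HasDerivAt (fun z ↦ G (γ z) v) (G' γ' v) z := fun G G' γ γ' v z hG hγ ↦ by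
    simpa using (hG.comp_hasDerivAt z hγ).clm_apply (hasDerivAt_const z v)
  have h1 : ∀ p, HasFDerivAt (fun p : ℝ × ℝ ↦ f p.1 p.2) _ p :=
    fun p ↦ ((hf.differentiable (by norm_num)) p).hasFDerivAt
  have h2 := fun p ↦ ((hc.differentiable (by norm_num)) p).hasFDerivAt
  refine ⟨fun x y ↦ fderiv ℝ (fun p : ℝ × ℝ ↦ f p.1 p.2) (x, y) (1, 0),
    fun x y ↦ fderiv ℝ (fun p : ℝ × ℝ ↦ f p.1 p.2) (x, y) (0, 1),
    fun x y ↦ fderiv ℝ (fderiv ℝ (fun p : ℝ × ℝ ↦ f p.1 p.2)) (x, y) (0, 1) (1, 0),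
    hc.clm_apply contDiff_const, hc.clm_apply contDiff_const,
    fun x y ↦ (h1 (x, y)).comp_hasDerivAt (f := fun x ↦ (x, y)) x (hx x y),
    fun x y ↦ (h1 (x, y)).comp_hasDerivAt (f := fun y ↦ (x, y)) y (hy x y),
    fun x y ↦ ?_, fun x y ↦ ?_⟩
  · exact haux _ _ (fun y ↦ (x, y)) _ _ y (h2 (x, y)) (hy x y)
  · have h3 : IsSymmSndFDerivAt ℝ (fun p : ℝ × ℝ ↦ f p.1 p.2) (x, y) :=
      hf.contDiffAt.isSymmSndFDerivAt (by simp)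
    beta_reduce
    rw [h3.eq (0, 1) (1, 0)]
    exact haux _ _ (fun x ↦ (x, y)) _ _ x (h2 (x, y)) (hx x y)

/-- The spinor with sum `1` and difference `0` of its components. -/
def spinorFst : Spinor := !₂[1 / 2, 1 / 2]

/-- The spinor with sum `0` and difference `1` of its components. -/
def spinorSnd : Spinor := !₂[1 / 2, -(1 / 2)]

/-- The Dirac field for which the sum and the difference of the components, in characteristic
coordinates, are `u` and `v`. -/
def diracField (u v : ℝ → ℝ → ℂ) (t x : ℝ) : Spinor :=
  u (x + t) (x - t) • spinorFst + v (x + t) (x - t) • spinorSnd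

theorem contDiff_space_time {E : Type*} [NormedAddCommGroup E] [NormedSpace ℝ E] {n : WithTop ℕ∞}
    {f : ℝ → ℝ → E} (hf : ContDiff ℝ n (fun p : ℝ × ℝ ↦ f p.1 p.2)) :
    ContDiff ℝ n (fun p : ℝ × ℝ ↦ f (p.2 + p.1) (p.2 - p.1)) :=
  hf.comp (g := fun p : ℝ × ℝ ↦ f p.1 p.2) (f := fun p : ℝ × ℝ ↦ (p.2 + p.1, p.2 - p.1))
    (by fun_prop)

theorem contDiff_diracField {u v : ℝ → ℝ → ℂ}
    (hu : ContDiff ℝ 1 (fun p : ℝ × ℝ ↦ u p.1 p.2))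
    (hv : ContDiff ℝ 1 (fun p : ℝ × ℝ ↦ v p.1 p.2)) :
    ContDiff ℝ 1 (fun p : ℝ × ℝ ↦ diracField u v p.1 p.2) :=
  ((contDiff_space_time hu).smul contDiff_const).add
    ((contDiff_space_time hv).smul contDiff_const)

/-- A solution in characteristic coordinates with finite speed of propagation is a solution of the
Dirac-Klein-Gordon system. -/
theorem IsCharacteristicSolution.isSolution {m M ρ R : ℝ} {u v : ℝ → ℝ → ℂ} {q φ : ℝ → ℝ → ℝ}
    (h : IsCharacteristicSolution m M ρ u v q φ)
    (hsupp : ∀ x y, (R < x ∧ R < y) ∨ (x < -R ∧ y < -R) → u x y = 0 ∧ v x y = 0 ∧ φ x y = 0) :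
    IsSolution m M (-(1 / 2)) (1 / 2) (ρ / 2) (diracField u v)
      (fun t x ↦ φ (x + t) (x - t)) := by
  obtain ⟨p, r, s, hp, hr, dp, dr, dpy, drx⟩ := exists_second_partials_of_contDiff h.contDiff_phi
  obtain ⟨px, -, -, -, dpx, -⟩ := exists_partials_of_contDiff hp
  obtain ⟨-, ry, -, -, -, dry⟩ := exists_partials_of_contDiff hr
  obtain ⟨ux, uy, cux, cuy, dux, duy⟩ := exists_partials_of_contDiff h.contDiff_u
  obtain ⟨vx, vy, cvx, cvy, dvx, dvy⟩ := exists_partials_of_contDiff h.contDiff_v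
  have hφ1 : ContDiff ℝ 1 (fun p : ℝ × ℝ ↦ φ p.1 p.2) := h.contDiff_phi.of_le (by norm_num)
  have hstrip : ∀ t ∈ Set.Ioo (-(ρ / 2)) (ρ / 2), ∀ x : ℝ, |(x + t) - (x - t)| < ρ := by
    intro t ht x
    rw [abs_lt]; constructor <;> linarith [ht.1, ht.2]
  have hzero : ∀ t x : ℝ, R + |t| < |x| → u (x + t) (x - t) = 0 ∧ v (x + t) (x - t) = 0 ∧
      φ (x + t) (x - t) = 0 := by
    intro t x hx
    refine hsupp _ _ ?_
    have h1 := neg_abs_le t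
    have h2 := le_abs_self t
    rcases lt_abs.1 hx with h3 | h3
    · left; constructor <;> linarith
    · right; constructor <;> linarith
  have htime : ∀ t x : ℝ, HasDerivAt (fun t ↦ φ (x + t) (x - t))
      (p (x + t) (x - t) - r (x + t) (x - t)) t := fun t x ↦
    hasDerivAt_time hφ1 (dp _ _) (dr _ _)
  have hspace : ∀ t x : ℝ, HasDerivAt (fun x ↦ φ (x + t) (x - t))
      (p (x + t) (x - t) + r (x + t) (x - t)) x := fun t x ↦
    hasDerivAt_space hφ1 (dp _ _) (dr _ _)
  have hdt : dt (fun t x ↦ φ (x + t) (x - t)) =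
      fun t x ↦ p (x + t) (x - t) - r (x + t) (x - t) := by
    funext t x; exact (htime t x).deriv
  have hdx : dx (fun t x ↦ φ (x + t) (x - t)) =
      fun t x ↦ p (x + t) (x - t) + r (x + t) (x - t) := by
    funext t x; exact (hspace t x).deriv
  have hpc := (contDiff_space_time hp).continuous
  have hrc := (contDiff_space_time hr).continuous
  have hφc := (contDiff_space_time hφ1).continuous
  refine ⟨(contDiff_diracField h.contDiff_u h.contDiff_v).contDiffOn,
    (contDiff_space_time h.contDiff_phi).contDiffOn, ?_, ?_, ?_, ?_, ?_⟩
  · intro t ht x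
    have huy := (duy (x + t) (x - t)).unique (h.deriv_u _ _ (hstrip t ht x))
    have hvx := (dvx (x + t) (x - t)).unique (h.deriv_v _ _ (hstrip t ht x))
    have e1 : dt (diracField u v) t x = (ux (x + t) (x - t) - uy (x + t) (x - t)) • spinorFst
        + (vx (x + t) (x - t) - vy (x + t) (x - t)) • spinorSnd :=
      (((hasDerivAt_time h.contDiff_u (dux _ _) (duy _ _)).smul_const spinorFst).add
        ((hasDerivAt_time h.contDiff_v (dvx _ _) (dvy _ _)).smul_const spinorSnd)).deriv
    have e2 : dx (diracField u v) t x = (ux (x + t) (x - t) + uy (x + t) (x - t)) • spinorFst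
        + (vx (x + t) (x - t) + vy (x + t) (x - t)) • spinorSnd :=
      (((hasDerivAt_space h.contDiff_u (dux _ _) (duy _ _)).smul_const spinorFst).add
        ((hasDerivAt_space h.contDiff_v (dvx _ _) (dvy _ _)).smul_const spinorSnd)).deriv
    rw [e1, e2, huy, hvx]
    ext i
    have hI := Complex.I_mul_I
    fin_cases i <;>
      simp [gamma0, gamma1, diracField, spinorFst, spinorSnd]
    · linear_combination (-(1 / 2) * (φ (x + t) (x - t) - m)
        * (u (x + t) (x - t) + v (x + t) (x - t))) * hI
    · linear_combination (-(1 / 2) * (φ (x + t) (x - t) - m)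
        * (u (x + t) (x - t) - v (x + t) (x - t))) * hI
  · intro t ht x
    have e1 : dt (dt (fun t x ↦ φ (x + t) (x - t))) t x =
        (px (x + t) (x - t) - s (x + t) (x - t)) - (s (x + t) (x - t) - ry (x + t) (x - t)) := by
      rw [hdt]
      exact ((hasDerivAt_time hp (dpx _ _) (dpy _ _)).sub
        (hasDerivAt_time hr (drx _ _) (dry _ _))).deriv
    have e2 : dx (dx (fun t x ↦ φ (x + t) (x - t))) t x =
        (px (x + t) (x - t) + s (x + t) (x - t)) + (s (x + t) (x - t) + ry (x + t) (x - t)) := by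
      rw [hdx]
      exact ((hasDerivAt_space hp (dpx _ _) (dpy _ _)).add
        (hasDerivAt_space hr (drx _ _) (dry _ _))).deriv
    have e3 : s (x + t) (x - t) = M ^ 2 / 4 * φ (x + t) (x - t)
        - 1 / 4 * (u (x + t) (x - t) * star (v (x + t) (x - t))).re := by
      refine (dpy _ _).unique ((h.deriv_q _ _ (hstrip t ht x)).congr_of_eventuallyEq ?_)
      filter_upwards [(isOpen_lt (by fun_prop : Continuous fun y : ℝ ↦ |x + t - y|)
        continuous_const).mem_nhds (hstrip t ht x)] with y hy
      exact (dp _ _).unique (h.deriv_phi _ _ hy)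
    rw [e1, e2, show ∀ a b c d : ℝ, (a - b) - (b - c) - ((a + b) + (b + c)) + d = -4 * b + d
      from fun a b c d ↦ by ring, e3]
    have hconj : (starRingEnd ℂ) 2 = 2 := map_ofNat _ 2
    have hre : ((2 : ℂ)⁻¹).re = 2⁻¹ := by simp
    have him : ((2 : ℂ)⁻¹).im = 0 := by simp
    apply Complex.ext <;>
      simp [hconj, hre, him, gamma0, diracField, spinorFst, spinorSnd, Matrix.mulVec, dotProduct,
        Fin.sum_univ_two] <;> ring
  · refine isSobolevCurve_of_nonpos (by norm_num)
      (contDiff_diracField h.contDiff_u h.contDiff_v).continuous (R := R) (fun t x hx ↦ ?_) _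
    rw [diracField, (hzero t x hx).1, (hzero t x hx).2.1, zero_smul, zero_smul, add_zero]
  · refine isSobolevCurve_of_le_half le_rfl (R := R)
      (u' := fun t x ↦ ((p (x + t) (x - t) + r (x + t) (x - t) : ℝ) : ℂ))
      (Complex.continuous_ofReal.comp hφc) (Complex.continuous_ofReal.comp (hpc.add hrc))
      (fun t x ↦ (hspace t x).ofReal_comp) (fun t x hx ↦ ?_) _
    simp [(hzero t x hx).2.2]
  · rw [hdt]
    refine isSobolevCurve_of_nonpos (by norm_num) (R := R)
      (Complex.continuous_ofReal.comp (hpc.sub hrc)) (fun t x hx ↦ ?_) _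
    have h1 : (fun t ↦ φ (x + t) (x - t)) =ᶠ[𝓝 t] fun _ ↦ 0 := by
      filter_upwards [(isOpen_lt (by fun_prop : Continuous fun t : ℝ ↦ R + |t|)
        continuous_const).mem_nhds hx] with t' ht'
      exact (hzero t' x ht').2.2
    simp [cplx, (htime t x).unique ((hasDerivAt_const t (0 : ℝ)).congr_of_eventuallyEq h1)]

/-- The datum `(φ₀' + φ₁) / 2` for `q` makes `φ₁` the initial velocity of the Klein-Gordon field. -/
theorem IsCharacteristicSolution.dt_zero {m M ρ : ℝ} (hρ : 0 < ρ) {u v : ℝ → ℝ → ℂ}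
    {q φ : ℝ → ℝ → ℝ} (h : IsCharacteristicSolution m M ρ u v q φ) {φ₀ φ₀' φ₁ : ℝ → ℝ}
    (hφ : ∀ x, φ x x = φ₀ x) (hφ' : ∀ x, HasDerivAt φ₀ (φ₀' x) x)
    (hq : ∀ x, q x x = (φ₀' x + φ₁ x) / 2) (x : ℝ) :
    dt (fun t x ↦ φ (x + t) (x - t)) 0 x = φ₁ x := by
  have hφ1 : ContDiff ℝ 1 (fun p : ℝ × ℝ ↦ φ p.1 p.2) := h.contDiff_phi.of_le (by norm_num)
  obtain ⟨p, r, -, -, dp, dr⟩ := exists_partials_of_contDiff hφ1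
  have h1 := (hasDerivAt_time (t := 0) (x := x) hφ1 (dp _ _) (dr _ _)).deriv
  have h2 := hasDerivAt_space (t := 0) (x := x) hφ1 (dp _ _) (dr _ _)
  have h3 := (dp x x).unique (h.deriv_phi x x (by simpa using hρ))
  rw [hq] at h3
  simp only [add_zero, sub_zero, hφ] at h1 h2
  have h4 := (hφ' x).unique h2
  change deriv (fun t ↦ φ (x + t) (x - t)) 0 = _
  rw [h1]
  linarith

/-! ### Sums of rescaled derivatives in `H^{-1/2}`, and duality -/

theorem eLpNorm_comp_add_div {E : Type*} [NormedAddCommGroup E] {f : ℝ → E}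
    (hf : MemLp f 2 (volume : Measure ℝ)) {r : ℝ} (hr : 0 < r) (c : ℝ) :
    eLpNorm (fun x ↦ f ((x + c) / r)) 2 (volume : Measure ℝ)
      = ENNReal.ofReal (Real.sqrt r) * eLpNorm f 2 volume := by
  have h1 : Measure.map (fun x : ℝ ↦ (x + c) / r) volume = ENNReal.ofReal r • volume := by
    have e : (fun x : ℝ ↦ (x + c) / r) = (fun x ↦ r⁻¹ * x) ∘ fun x ↦ x + c := by
      funext x; simp [div_eq_inv_mul]
    rw [e, ← Measure.map_map (by fun_prop) (by fun_prop), (measurePreserving_add_right _ c).map_eq,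
      Real.map_volume_mul_left (inv_ne_zero hr.ne'), inv_inv, abs_of_pos hr]
  have h2 := eLpNorm_map_measure (μ := volume) (p := 2) (f := fun x : ℝ ↦ (x + c) / r) (g := f)
    (by rw [h1]; exact hf.1.smul_measure _) (by fun_prop)
  change eLpNorm (f ∘ fun x : ℝ ↦ (x + c) / r) 2 volume = _
  rw [← h2, h1, eLpNorm_smul_measure_of_ne_top (by simp), smul_eq_mul, Real.sqrt_eq_rpow,
    ← ENNReal.ofReal_rpow_of_pos hr]
  norm_num

theorem memLp_comp_add_div {E : Type*} [NormedAddCommGroup E] {f : ℝ → E}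
    (hf : MemLp f 2 (volume : Measure ℝ)) {r : ℝ} (hr : 0 < r) (c : ℝ) :
    MemLp (fun x ↦ f ((x + c) / r)) 2 (volume : Measure ℝ) := by
  refine ⟨hf.1.comp_quasiMeasurePreserving ⟨by fun_prop, ?_⟩, ?_⟩
  · have e : (fun x : ℝ ↦ (x + c) / r) = (fun x ↦ r⁻¹ * x) ∘ fun x ↦ x + c := by
      funext x; simp [div_eq_inv_mul]
    rw [e, ← Measure.map_map (by fun_prop) (by fun_prop), (measurePreserving_add_right _ c).map_eq,
      Real.map_volume_mul_left (inv_ne_zero hr.ne')]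
    exact Measure.smul_absolutelyContinuous
  · rw [eLpNorm_comp_add_div hf hr c]
    exact ENNReal.mul_lt_top ENNReal.ofReal_lt_top hf.2

theorem norm_toLp_comp_add_div {E : Type*} [NormedAddCommGroup E] {f : ℝ → E}
    (hf : MemLp f 2 (volume : Measure ℝ)) {r : ℝ} (hr : 0 < r) (c : ℝ) :
    ‖(memLp_comp_add_div hf hr c).toLp _‖ = Real.sqrt r * ‖hf.toLp f‖ := by
  rw [Lp.norm_toLp, Lp.norm_toLp, eLpNorm_comp_add_div hf hr c, ENNReal.toReal_mul,
    ENNReal.toReal_ofReal (Real.sqrt_nonneg r)]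

section Scales

variable {F : Type*} [NormedAddCommGroup F] [InnerProductSpace ℂ F] [CompleteSpace F]
  {Θ Θ' : ℝ → F}

theorem exists_isWeightedFourier_scale (hΘ' : MemLp Θ' 2 (volume : Measure ℝ))
    {r : ℝ} (hr : 0 < r) (c : ℝ) :
    ∃ g, IsWeightedFourier (-(1 / 2)) (toDistribution fun x ↦ r⁻¹ • Θ' ((x + c) / r)) g := by
  have h := (memLp_comp_add_div hΘ' hr c).const_smul r⁻¹
  obtain ⟨g, hg, -⟩ := exists_isWeightedFourier_of_nonpos (s := -(1 / 2)) (by norm_num) (h.toLp _)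
  rw [← toDistribution_eq] at hg
  exact ⟨g, hg⟩

/-- The derivatives of the rescalings of one function all have the same size in `H^{-1/2}`, up to a
constant, while two of them at scales far apart are almost orthogonal. -/
theorem norm_inner_scale_le (hΘ : MemLp Θ 2 (volume : Measure ℝ))
    (hΘ' : MemLp Θ' 2 (volume : Measure ℝ)) (hd : ∀ x, HasDerivAt Θ (Θ' x) x) {r r' c : ℝ}
    (hr : 0 < r) (hr' : 0 < r') {g g' : Lp F 2 (volume : Measure ℝ)}
    (hg : IsWeightedFourier (-(1 / 2)) (toDistribution fun x ↦ r⁻¹ • Θ' ((x + c) / r)) g)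
    (hg' : IsWeightedFourier (-(1 / 2)) (toDistribution fun x ↦ r'⁻¹ • Θ' ((x + c) / r')) g') :
    ‖inner ℂ g g'‖ ≤ Real.sqrt (r / r') * (‖hΘ.toLp Θ‖ * ‖hΘ'.toLp Θ'‖) := by
  have h1 := (memLp_comp_add_div hΘ' hr c).const_smul r⁻¹
  have h2 := (memLp_comp_add_div hΘ' hr' c).const_smul r'⁻¹
  have h0 := memLp_comp_add_div hΘ hr c
  have hw := isWeakDeriv_of_hasDerivAt h0 h1 (fun x ↦ by
    exact HasDerivAt.scomp x (hd _) (((hasDerivAt_id x).add_const c).div_const r |>.congr_deriv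
      (by simp)))
  have := hw.norm_inner_le (g := g) (g' := g') (k := h2.toLp _) (by
    rw [← toDistribution_eq]; exact hg) (by rw [← toDistribution_eq]; exact hg')
  refine this.trans_eq ?_
  rw [MemLp.toLp_const_smul r'⁻¹ (memLp_comp_add_div hΘ' hr' c), norm_smul,
    norm_toLp_comp_add_div hΘ hr c,
    norm_toLp_comp_add_div hΘ' hr' c, Real.sqrt_div hr.le,
    Real.norm_of_nonneg (by positivity)]
  have : 0 < Real.sqrt r' := Real.sqrt_pos.2 hr'
  field_simp
  rw [Real.sq_sqrt hr'.le]

/-- The sum of `J` almost orthogonal vectors has norm `O(√J)`. -/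
theorem norm_sq_sum_le {H : Type*} [NormedAddCommGroup H] [InnerProductSpace ℂ H] {g : ℕ → H}
    {C : ℝ} (hg : ∀ i k, ‖inner ℂ (g i) (g (i + k))‖ ≤ (1 / 2) ^ k * C) (J : ℕ) :
    ‖∑ j ∈ Finset.range J, g j‖ ^ 2 ≤ 3 * J * C := by
  have hC : 0 ≤ C := by have := (norm_nonneg _).trans (hg 0 0); simpa using this
  induction J with
  | zero => simp
  | succ J ih =>
    have h1 : ‖g J‖ ^ 2 ≤ C := by
      have := hg J 0
      rw [add_zero, inner_self_eq_norm_sq_to_K] at this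
      simpa using this
    have h2 : ∀ J' ≤ J, ‖inner ℂ (∑ j ∈ Finset.range J', g j) (g J)‖
        ≤ 2 * (1 / 2) ^ (J - J' + 1) * C := by
      intro J' hJ'
      induction J' with
      | zero => simp [hC]
      | succ n ihn =>
        rw [Finset.sum_range_succ, inner_add_left]
        obtain ⟨k, rfl⟩ := Nat.exists_eq_add_of_le hJ'
        have h5 := hg n (1 + k)
        rw [← add_assoc] at h5
        refine (norm_add_le _ _).trans ((add_le_add (ihn (by omega)) h5).trans_eq ?_)
        rw [show n + 1 + k - n + 1 = k + 2 by omega, show n + 1 + k - (n + 1) + 1 = k + 1 by omega]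
        ring
    have h3 := h2 J le_rfl
    have h4 := norm_add_sq (𝕜 := ℂ) (∑ j ∈ Finset.range J, g j) (g J)
    rw [Finset.sum_range_succ, h4]
    have h5 := RCLike.re_le_norm (inner ℂ (∑ j ∈ Finset.range J, g j) (g J))
    push_cast
    rw [Nat.sub_self, zero_add, pow_one] at h3
    nlinarith

/-- By almost orthogonality, the norm in `H^{-1/2}` of a sum over `J` scales grows only like
`√J`. -/
theorem exists_isWeightedFourier_sum_scales (hΘ : MemLp Θ 2 (volume : Measure ℝ))
    (hΘ' : MemLp Θ' 2 (volume : Measure ℝ)) (hd : ∀ x, HasDerivAt Θ (Θ' x) x) {l : ℝ}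
    (hl : 0 < l) (J : ℕ) :
    ∃ g, IsWeightedFourier (-(1 / 2)) (toDistribution fun x ↦
      ∑ j ∈ Finset.range J, (l / 4 ^ j)⁻¹ • Θ' (x / (l / 4 ^ j))) g ∧
      ‖g‖ ^ 2 ≤ 3 * J * (‖hΘ.toLp Θ‖ * ‖hΘ'.toLp Θ'‖) := by
  have hr : ∀ j : ℕ, 0 < l / 4 ^ j := fun j ↦ by positivity
  choose g hg using fun j : ℕ ↦ exists_isWeightedFourier_scale hΘ' (hr j) 0
  refine ⟨∑ j ∈ Finset.range J, g j, ?_, norm_sq_sum_le (fun i k ↦ ?_) J⟩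
  · have hm : ∀ j : ℕ, MemLp (fun x ↦ (l / 4 ^ j)⁻¹ • Θ' (x / (l / 4 ^ j))) 2 volume := fun j ↦ by
      have := (memLp_comp_add_div hΘ' (hr j) 0).const_smul (l / 4 ^ j)⁻¹
      simp only [add_zero] at this
      exact this
    induction J with
    | zero =>
      have e : toDistribution (fun _ : ℝ ↦ (0 : F)) = 0 := by
        have h0 : MemLp (0 : ℝ → F) 2 (volume : Measure ℝ) := MemLp.zero
        change toDistribution (0 : ℝ → F) = 0
        rw [toDistribution_eq h0, MemLp.toLp_zero]
        exact map_zero (Lp.toTemperedDistributionCLM F (volume : Measure ℝ) 2)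
      simp only [Finset.range_zero, Finset.sum_empty, e]
      exact IsWeightedFourier.zero _
    | succ J ih =>
      simp only [Finset.sum_range_succ]
      have h1 : MemLp (fun x ↦ ∑ j ∈ Finset.range J, (l / 4 ^ j)⁻¹ • Θ' (x / (l / 4 ^ j))) 2
          volume := memLp_finsetSum _ fun j _ ↦ hm j
      have := toDistribution_add h1 (hm J)
      change IsWeightedFourier _ (toDistribution ((fun x ↦ ∑ j ∈ Finset.range J,
        (l / 4 ^ j)⁻¹ • Θ' (x / (l / 4 ^ j))) + fun x ↦ (l / 4 ^ J)⁻¹ • Θ' (x / (l / 4 ^ J)))) _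
      rw [this]
      refine ih.add ?_
      have := hg J
      simpa only [add_zero] using this
  · rw [norm_inner_symm]
    refine (norm_inner_scale_le hΘ hΘ' hd (hr _) (hr _) (hg (i + k)) (hg i)).trans_eq ?_
    congr 1
    rw [show l / 4 ^ (i + k) / (l / 4 ^ i) = ((1 / 2 : ℝ) ^ k) ^ 2 by
      rw [← pow_mul, mul_comm k 2, pow_mul, pow_add]; field_simp; rw [← mul_pow]; norm_num,
      Real.sqrt_sq (by positivity)]

/-- The spaces `H^{1/2}` and `H^{-1/2}` are in duality. -/
theorem IsWeightedFourier.inner_eq {f k g g' : Lp F 2 (volume : Measure ℝ)}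
    (hg : IsWeightedFourier (1 / 2) (f : 𝓢'(ℝ, F)) g)
    (hg' : IsWeightedFourier (-(1 / 2)) (k : 𝓢'(ℝ, F)) g') :
    (inner ℂ g g' : ℂ) = inner ℂ f k := by
  obtain ⟨g1', hg1', -, hg2'⟩ := exists_isWeightedFourier_of_nonpos (s := -(1 / 2)) (by norm_num) k
  obtain rfl : g' = g1' := eq_of_toTemperedDistribution_eq (hg'.symm.trans hg1')
  obtain ⟨f', hf1, -, hf2⟩ := hg.symbol_mul (hasTemperateGrowth_japaneseBracket (-(1 / 2))) (C := 1)
    (fun η ↦ by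
      rw [Complex.norm_real, Real.norm_of_nonneg (japaneseBracket_pos _ _).le]
      exact japaneseBracket_le_one (by norm_num) η) (b := fun _ ↦ 1)
    (fun η ↦ by
      rw [← Complex.ofReal_mul, japaneseBracket_mul]
      norm_num [japaneseBracket_zero])
  have e : (𝓕 f : Lp F 2 (volume : Measure ℝ)) = f' := by
    apply eq_of_toTemperedDistribution_eq
    rw [← hf2, ← Lp.fourier_toTemperedDistribution_eq]
    simp
  rw [← Lp.inner_fourier_eq f k, e, L2.inner_def, L2.inner_def]
  apply integral_congr_ae
  filter_upwards [hf1, hg2'] with η h1 h2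
  rw [h1, h2, inner_smul_left, inner_smul_right, Complex.conj_ofReal]

end Scales

/-- A function close to a high bump is large in `H^{1/2}`, however narrow the bump. -/
theorem IsWeightedFourier.bump_le_norm {B B' B'' : ℝ → ℝ} (hB : ∀ x, HasDerivAt B (B' x) x)
    (hB' : ∀ x, HasDerivAt B' (B'' x) x) (cB'' : Continuous B'') (hc : HasCompactSupport B)
    (hsupp : ∀ x, 2 < |x| → B'' x = 0)
    (m' : MemLp (cplx B') 2 (volume : Measure ℝ)) (m'' : MemLp (cplx B'') 2 (volume : Measure ℝ))
    {f : ℝ → ℝ} (hf : Continuous f) (mf : MemLp (cplx f) 2 (volume : Measure ℝ))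
    {g : Lp ℂ 2 (volume : Measure ℝ)}
    (hg : IsWeightedFourier (1 / 2) (toDistribution (cplx f)) g) {R c A K : ℝ} (hR : 0 < R)
    (h : ∀ z, |z| ≤ 2 → |f (R * z - c) - A * B z| ≤ K) :
    A * (∫ x, B' x ^ 2) - K * ∫ x, |B'' x|
      ≤ ‖g‖ * Real.sqrt (‖m'.toLp _‖ * ‖m''.toLp _‖) := by
  -- The test function is `R⁻¹ B'' ((x + c) / R)`: its norm in `H^{-1/2}` has a bound that does not
  -- depend on `R`, while its pairing with the rescaled bump is `-∫ B' ^ 2`, after integration by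
  -- parts.
  obtain ⟨k, hk⟩ := exists_isWeightedFourier_scale m'' hR c
  have hd : ∀ x, HasDerivAt (cplx B') (cplx B'' x) x := fun x ↦ (hB' x).ofReal_comp
  have h1 := norm_inner_scale_le m' m'' hd hR hR hk hk
  rw [div_self hR.ne', Real.sqrt_one, one_mul, inner_self_eq_norm_sq_to_K] at h1
  have h2 : ‖k‖ ≤ Real.sqrt (‖m'.toLp _‖ * ‖m''.toLp _‖) := by
    apply Real.le_sqrt_of_sq_le
    simpa using h1
  have mk := (memLp_comp_add_div m'' hR c).const_smul R⁻¹
  have h3 : (inner ℂ g k : ℂ) = inner ℂ (mf.toLp _) (mk.toLp _) := by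
    refine IsWeightedFourier.inner_eq ?_ ?_
    · rw [← toDistribution_eq]; exact hg
    · rw [← toDistribution_eq]; exact hk
  have h4 : (inner ℂ (mf.toLp _) (mk.toLp _) : ℂ) =
      ((∫ x, R⁻¹ * (f x * B'' ((x + c) / R)) : ℝ) : ℂ) := by
    rw [L2.inner_def, ← integral_complex_ofReal]
    apply integral_congr_ae
    filter_upwards [mf.coeFn_toLp, mk.coeFn_toLp] with x e1 e2
    rw [e1, e2]
    simp [cplx]
    ring
  have h5 : (∫ x, R⁻¹ * (f x * B'' ((x + c) / R))) = ∫ z, f (R * z - c) * B'' z := by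
    have e1 := integral_add_right_eq_self (μ := volume)
      (fun x ↦ R⁻¹ * (f x * B'' ((x + c) / R))) (-c)
    rw [← e1]
    have e2 := Measure.integral_comp_mul_left (fun x ↦ R⁻¹ * (f (x - c) * B'' (x / R))) R
    simp only [smul_eq_mul, abs_inv, abs_of_pos hR] at e2
    have e3 : ∀ x : ℝ, R * x / R = x := fun x ↦ by field_simp
    simp only [e3, integral_const_mul] at e2
    have e4 := mul_left_cancel₀ (inv_ne_zero hR.ne') e2
    rw [e4, ← integral_const_mul]
    simp only [neg_add_cancel_right, sub_eq_add_neg]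
  have cB' : Continuous B' := continuous_iff_continuousAt.2 fun x ↦ (hB' x).continuousAt
  have hc' : HasCompactSupport B' := by
    have := hc.deriv; rwa [show deriv B = B' from funext fun x ↦ (hB x).deriv] at this
  have hc'' : HasCompactSupport B'' := by
    have := hc'.deriv; rwa [show deriv B' = B'' from funext fun x ↦ (hB' x).deriv] at this
  have cB : Continuous B := continuous_iff_continuousAt.2 fun x ↦ (hB x).continuousAt
  have i1 : Integrable (fun x ↦ B x * B'' x) (volume : Measure ℝ) :=
    (cB.mul cB'').integrable_of_hasCompactSupport hc''.mul_left
  have i2 : Integrable (fun x ↦ B' x * B' x) (volume : Measure ℝ) :=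
    (cB'.mul cB').integrable_of_hasCompactSupport hc'.mul_left
  have i3 : Integrable (fun x ↦ B x * B' x) (volume : Measure ℝ) :=
    (cB.mul cB').integrable_of_hasCompactSupport hc'.mul_left
  have h6 : ∫ x, B x * B'' x = -∫ x, B' x ^ 2 := by
    rw [integral_mul_deriv_eq_deriv_mul_of_integrable (v := B') (fun x _ ↦ hB x)
      (fun x _ ↦ hB' x) i1 i2 i3]
    simp only [sq]
  have i4 : Integrable (fun z ↦ f (R * z - c) * B'' z) (volume : Measure ℝ) :=
    ((hf.comp (by fun_prop)).mul cB'').integrable_of_hasCompactSupport hc''.mul_left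
  have i5 : Integrable (fun z ↦ |B'' z|) (volume : Measure ℝ) :=
    (cB''.integrable_of_hasCompactSupport hc'').abs
  have h7 : |(∫ z, f (R * z - c) * B'' z) - A * ∫ x, B x * B'' x| ≤ K * ∫ x, |B'' x| := by
    rw [← integral_const_mul, ← integral_const_mul, ← integral_sub i4 (i1.const_mul A),
      ← Real.norm_eq_abs]
    refine norm_integral_le_of_norm_le (i5.const_mul K) (Filter.Eventually.of_forall fun z ↦ ?_)
    rw [Real.norm_eq_abs, show f (R * z - c) * B'' z - A * (B z * B'' z)
      = (f (R * z - c) - A * B z) * B'' z by ring, abs_mul]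
    by_cases hz : |z| ≤ 2
    · exact mul_le_mul_of_nonneg_right (h z hz) (abs_nonneg _)
    · simp [hsupp z (not_le.1 hz)]
  have h8 : |∫ z, f (R * z - c) * B'' z| ≤ ‖g‖ * ‖k‖ := by
    have := norm_inner_le_norm (𝕜 := ℂ) g k
    rwa [h3, h4, h5, Complex.norm_real, Real.norm_eq_abs] at this
  calc A * (∫ x, B' x ^ 2) - K * ∫ x, |B'' x| ≤ |∫ z, f (R * z - c) * B'' z| := by
        rw [h6] at h7
        have := neg_abs_le (∫ z, f (R * z - c) * B'' z)
        have := (abs_le.1 h7).2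
        linarith
    _ ≤ ‖g‖ * ‖k‖ := h8
    _ ≤ _ := by gcongr

/-! ### Growth of the Klein-Gordon field -/

/-- If `u` and `v` are close to their initial values `f = F'` and `g = G'`, then the Klein-Gordon
field is close to `S F / 4`, provided that `G` equals the constant `S` on the support of `f`
and vanishes at the other end of the characteristic. -/
theorem IsCharacteristicSolution.abs_sub_le {m M ρ Q₀ B e L S : ℝ} {u v : ℝ → ℝ → ℂ}
    {q φ : ℝ → ℝ → ℝ} (h : IsCharacteristicSolution m M ρ u v q φ)
    {f g F G : ℝ → ℝ} (hF : ∀ x, HasDerivAt F (f x) x) (hG : ∀ x, HasDerivAt G (g x) x)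
    (hq : ∀ x, |q x x| ≤ Q₀) (hφ : ∀ x y, |φ x y| ≤ B)
    (hu : ∀ x y, ‖u x y - f x‖ ≤ e) (hv : ∀ x y, ‖v x y - g y‖ ≤ e)
    (hf : ∀ x, |f x| ≤ L) (hg : ∀ x, |g x| ≤ L) {a b : ℝ} (hab : |a - b| < ρ)
    (hFb : F b = 0) (hGb : G b = 0) (hS : ∀ x, f x * G x = S * f x) :
    |φ a b - φ b b - S / 4 * F a|
      ≤ (Q₀ + (M ^ 2 / 4 * B + (2 * L * e + e ^ 2) / 4) * |a - b|) * |a - b| := by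
  set E : ℝ := M ^ 2 / 4 * B + (2 * L * e + e ^ 2) / 4 with hE
  have he : 0 ≤ e := (norm_nonneg _).trans (hu 0 0)
  have hL : 0 ≤ L := (abs_nonneg _).trans (hf 0)
  have hB : 0 ≤ B := (abs_nonneg _).trans (hφ 0 0)
  have hE0 : 0 ≤ E := by positivity
  have hprod : ∀ x y, |(u x y * star (v x y)).re - f x * g y| ≤ 2 * L * e + e ^ 2 := by
    intro x y
    have e1 : (u x y * star (v x y)).re - f x * g y
        = (f x * star (v x y - g y) + (u x y - f x) * g y
          + (u x y - f x) * star (v x y - g y)).re := by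
      simp
      ring
    rw [e1]
    refine (Complex.abs_re_le_norm _).trans ((norm_add₃_le).trans ?_)
    rw [norm_mul, norm_mul, norm_mul, norm_star, Complex.norm_real, Complex.norm_real,
      Real.norm_eq_abs, Real.norm_eq_abs]
    calc _ ≤ L * e + e * L + e * e := by
          gcongr
          exacts [hf x, hv x y, hu x y, hg y, hu x y, hv x y]
      _ = _ := by ring
  have hmem : ∀ {z w x y : ℝ}, z ∈ Set.uIcc x y → w ∈ Set.uIcc x y → |z - w| ≤ |x - y| := by
    intro z w x y hz hw
    rw [abs_sub_comm x y]
    exact Set.abs_sub_le_of_uIcc_subset_uIcc (Set.uIcc_subset_uIcc hw hz)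
  -- Along the second characteristic the derivative of `q` is `- f g / 4`, up to a bounded error.
  have hqe : ∀ x ∈ Set.uIcc a b, |q x b - S / 4 * f x| ≤ Q₀ + E * |a - b| := by
    intro x hx
    have hseg : ∀ y ∈ Set.uIcc b x, |x - y| ≤ |a - b| := fun y hy ↦
      hmem hx (Set.uIcc_subset_uIcc Set.right_mem_uIcc hx hy)
    have h1 := (convex_uIcc b x).norm_image_sub_le_of_norm_hasDerivWithin_le
      (f := fun y ↦ q x y + 1 / 4 * (f x * G y)) (C := E) (x := x) (y := b)
      (fun y hy ↦ ((h.deriv_q x y ((hseg y hy).trans_lt hab)).add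
        (((hG y).const_mul (f x)).const_mul (1 / 4))).hasDerivWithinAt)
      (fun y hy ↦ by
        rw [show M ^ 2 / 4 * φ x y - 1 / 4 * (u x y * star (v x y)).re + 1 / 4 * (f x * g y)
          = M ^ 2 / 4 * φ x y - 1 / 4 * ((u x y * star (v x y)).re - f x * g y) by ring]
        refine (norm_sub_le _ _).trans ?_
        rw [norm_mul, norm_mul, Real.norm_of_nonneg (by positivity : 0 ≤ M ^ 2 / 4),
          Real.norm_of_nonneg (by norm_num : (0 : ℝ) ≤ 1 / 4), Real.norm_eq_abs, Real.norm_eq_abs,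
          hE, div_eq_inv_mul (2 * L * e + e ^ 2), ← one_div]
        gcongr
        exacts [hφ x y, hprod x y])
      Set.right_mem_uIcc Set.left_mem_uIcc
    rw [hGb, hS, Real.norm_eq_abs, Real.norm_eq_abs] at h1
    have h2 : E * |b - x| ≤ E * |a - b| :=
      mul_le_mul_of_nonneg_left (hmem Set.right_mem_uIcc hx) hE0
    have h3 := hq x
    rw [abs_le] at h1 h3 ⊢
    constructor <;> linarith [h1.1, h1.2, h3.1, h3.2]
  have hseg : ∀ x ∈ Set.uIcc a b, |x - b| < ρ := fun x hx ↦
    (hmem hx Set.right_mem_uIcc).trans_lt hab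
  have h1 := (convex_uIcc a b).norm_image_sub_le_of_norm_hasDerivWithin_le
    (f := fun x ↦ φ x b - S / 4 * F x) (C := Q₀ + E * |a - b|) (x := b) (y := a)
    (fun x hx ↦ ((h.deriv_phi x b (hseg x hx)).sub ((hF x).const_mul (S / 4))).hasDerivWithinAt)
    hqe Set.right_mem_uIcc Set.left_mem_uIcc
  rw [Real.norm_eq_abs, Real.norm_eq_abs, hFb] at h1
  convert h1 using 2
  ring

/-! ### Solutions with concentrating initial data -/

/-- `B` is a smooth bump with first and second derivatives `B'` and `B''`. -/
structure IsBump (B B' B'' : ℝ → ℝ) : Prop where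
  deriv : ∀ x, HasDerivAt B (B' x) x
  deriv' : ∀ x, HasDerivAt B' (B'' x) x
  continuous'' : Continuous B''
  one : ∀ x, |x| ≤ 1 → B x = 1
  zero : ∀ x, 2 ≤ |x| → B x = 0

namespace IsBump

variable {B B' B'' : ℝ → ℝ}

theorem zero' (h : IsBump B B' B'') (x : ℝ) (hx : 2 < |x|) : B' x = 0 := by
  have h1 : B =ᶠ[𝓝 x] fun _ ↦ 0 := by
    filter_upwards [(isOpen_lt continuous_const continuous_abs).mem_nhds hx] with y hy
    exact h.zero y (le_of_lt hy)
  exact (h.deriv x).unique ((hasDerivAt_const x (0 : ℝ)).congr_of_eventuallyEq h1)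

theorem zero'' (h : IsBump B B' B'') (x : ℝ) (hx : 2 < |x|) : B'' x = 0 := by
  have h1 : B' =ᶠ[𝓝 x] fun _ ↦ 0 := by
    filter_upwards [(isOpen_lt continuous_const continuous_abs).mem_nhds hx] with y hy
    exact h.zero' y hy
  exact (h.deriv' x).unique ((hasDerivAt_const x (0 : ℝ)).congr_of_eventuallyEq h1)

theorem continuous (h : IsBump B B' B'') : Continuous B :=
  continuous_iff_continuousAt.2 fun x ↦ (h.deriv x).continuousAt

theorem continuous' (h : IsBump B B' B'') : Continuous B' :=
  continuous_iff_continuousAt.2 fun x ↦ (h.deriv' x).continuousAt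

theorem contDiff' (h : IsBump B B' B'') : ContDiff ℝ 1 B' := by
  rw [contDiff_one_iff_deriv]
  exact ⟨fun x ↦ (h.deriv' x).differentiableAt,
    (funext fun x ↦ (h.deriv' x).deriv : _root_.deriv B' = B'') ▸ h.continuous''⟩

theorem hasCompactSupport_of {E : Type*} [Zero E] {f : ℝ → E} (hf : ∀ x, 2 < |x| → f x = 0) :
    HasCompactSupport f :=
  HasCompactSupport.of_support_subset_isCompact (isCompact_Icc (a := -2) (b := 2))
    (fun x hx ↦ by
      rw [Set.mem_Icc, ← abs_le]
      by_contra h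
      exact hx (hf x (not_le.1 h)))

theorem integral_sq_pos (h : IsBump B B' B'') : 0 < ∫ x, B' x ^ 2 := by
  obtain ⟨x, hx⟩ : ∃ x, B' x ≠ 0 := by
    by_contra! hc
    have := is_const_of_deriv_eq_zero (fun x ↦ (h.deriv x).differentiableAt)
      (fun x ↦ by rw [(h.deriv x).deriv, hc]) 0 2
    rw [h.one 0 (by simp), h.zero 2 (by norm_num)] at this
    exact one_ne_zero this
  exact (h.continuous'.pow 2).integral_pos_of_hasCompactSupport_nonneg_nonzero
    (hasCompactSupport_of fun x hx ↦ by simp [h.zero' x hx]) (fun x ↦ sq_nonneg _)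
    (pow_ne_zero 2 hx)

end IsBump

theorem exists_isBump : ∃ B B' B'' : ℝ → ℝ, IsBump B B' B'' := by
  obtain ⟨B, hB, h1, h0, -, -⟩ := exists_cutoff
  have hB' : ContDiff ℝ (⊤ : ℕ∞) (deriv B) :=
    (contDiff_infty_iff_deriv.1 hB).2
  have hB'' : ContDiff ℝ (⊤ : ℕ∞) (deriv (deriv B)) :=
    (contDiff_infty_iff_deriv.1 hB').2
  exact ⟨B, deriv B, deriv (deriv B), fun x ↦ (hB.differentiable (by simp) x).hasDerivAt,
    fun x ↦ (hB'.differentiable (by simp) x).hasDerivAt, hB''.continuous, h1, h0⟩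

/-- The derivative of the rescaled bump `B (x / R)`, in terms of the derivative `B'` of `B`. -/
def profile (B' : ℝ → ℝ) (R x : ℝ) : ℝ := R⁻¹ * B' (x / R)

/-- The sum of the profiles at the `J` scales `l`, `l / 4`, `l / 4 ^ 2`, .... -/
def profileSum (B' : ℝ → ℝ) (l : ℝ) (J : ℕ) (x : ℝ) : ℝ :=
  ∑ j ∈ Finset.range J, profile B' (l / 4 ^ j) x

theorem hasDerivAt_rescale {B B' B'' : ℝ → ℝ} (hB : IsBump B B' B'') {R : ℝ} (x : ℝ) :
    HasDerivAt (fun x ↦ B (x / R)) (profile B' R x) x :=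
  ((hB.deriv (x / R)).scomp x ((hasDerivAt_id x).div_const R)).congr_deriv
    (by simp [profile])

theorem exists_bound_of_hasCompactSupport {E : Type*} [NormedAddCommGroup E] {f : ℝ → E}
    (hf : Continuous f) (hc : HasCompactSupport f) : ∃ C, 0 ≤ C ∧ ∀ x, ‖f x‖ ≤ C := by
  obtain ⟨C, hC⟩ := hf.bounded_above_of_compact_support hc
  exact ⟨C, (norm_nonneg _).trans (hC 0), hC⟩

theorem exists_radius {E : Type*} [Zero E] {f : ℝ → E} (hc : HasCompactSupport f) :
    ∃ R, ∀ x, R < |x| → f x = 0 := by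
  obtain ⟨R, hR⟩ := (Metric.isBounded_iff_subset_closedBall 0).1 hc.isCompact.isBounded
  refine ⟨R, fun x hx ↦ by_contra fun h ↦ ?_⟩
  have := hR (subset_tsupport f h)
  rw [Metric.mem_closedBall, dist_zero_right, Real.norm_eq_abs] at this
  linarith

set_option maxHeartbeats 1000000 in
/-- Added to given smooth data, a concentrated profile in `u` and a sum of profiles over many scales
in `v` produce, in arbitrarily short time, a narrow bump of the height `η J δ / 4` in the
Klein-Gordon field, up to an error independent of these numbers. -/
theorem exists_solution_with_bump {m M : ℝ} (hm : 0 ≤ m) {B B' B'' : ℝ → ℝ}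
    (hB : IsBump B B' B'') {U V : ℝ → ℂ} {φ₀ φ₁ : ℝ → ℝ} (hU : ContDiff ℝ 1 U) (hV : ContDiff ℝ 1 V)
    (hφ₀ : ContDiff ℝ 2 φ₀) (hφ₁ : ContDiff ℝ 1 φ₁) (cU : HasCompactSupport U)
    (cV : HasCompactSupport V) (cφ₀ : HasCompactSupport φ₀) (cφ₁ : HasCompactSupport φ₁)
    {B₀ : ℝ} (hB₀ : ∀ x, |φ₀ x| ≤ B₀) {δ η ε : ℝ} (hδ : 0 ≤ δ) (hη : 0 ≤ η) (hε : 0 < ε) (J : ℕ) :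
    ∃ (R l T τ : ℝ) (ψ : ℝ → ℝ → Spinor) (φ : ℝ → ℝ → ℝ), 0 < R ∧ 0 < l ∧
      IsSolution m M (-(1 / 2)) (1 / 2) T ψ φ ∧ 0 < τ ∧ τ < ε ∧ τ < T ∧
      (ψ 0 = fun x ↦ (((δ * profile B' R x : ℝ) : ℂ) + U x) • spinorFst
        + (((η * profileSum B' l J x : ℝ) : ℂ) + V x) • spinorSnd) ∧
      φ 0 = φ₀ ∧ dt φ 0 = φ₁ ∧ Continuous (φ τ) ∧
      ∀ z, |z| ≤ 2 → |φ τ (R * z - τ) - η * J / 4 * δ * B z| ≤ B₀ + 1 := by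
  have hφ₀' : ContDiff ℝ 1 (deriv φ₀) := by
    have : ContDiff ℝ (1 + 1) φ₀ := by rw [one_add_one_eq_two]; exact hφ₀
    exact (contDiff_succ_iff_deriv.1 this).2.2
  have cq : HasCompactSupport (fun x ↦ (deriv φ₀ x + φ₁ x) / 2) := by
    have := (cφ₀.deriv.add cφ₁).smul_left (f := fun _ ↦ (1 / 2 : ℝ))
    refine this.mono fun x hx ↦ ?_
    simp only [Function.mem_support] at hx ⊢
    contrapose! hx
    simp only [Pi.smul_apply', Pi.add_apply, smul_eq_mul] at hx
    linarith
  have hq₀ : ContDiff ℝ 1 (fun x ↦ (deriv φ₀ x + φ₁ x) / 2) := (hφ₀'.add hφ₁).div_const 2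
  obtain ⟨b₁, hb₁, hb₁'⟩ := exists_bound_of_hasCompactSupport hB.continuous'
    (IsBump.hasCompactSupport_of hB.zero')
  obtain ⟨K₁, hK₁, hK₁'⟩ := exists_bound_of_hasCompactSupport hU.continuous cU
  obtain ⟨K₂, hK₂, hK₂'⟩ := exists_bound_of_hasCompactSupport hV.continuous cV
  obtain ⟨Q₀, hQ₀, hQ₀'⟩ := exists_bound_of_hasCompactSupport hq₀.continuous cq
  obtain ⟨R₁, hR₁⟩ := exists_radius cU
  obtain ⟨R₂, hR₂⟩ := exists_radius cV
  obtain ⟨R₃, hR₃⟩ := exists_radius cφ₀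
  obtain ⟨R₄, hR₄⟩ := exists_radius cq
  have hB₀0 : 0 ≤ B₀ := (abs_nonneg _).trans (hB₀ 0)
  -- The size of the data, relative to the length of the time interval; it stays fixed as the
  -- largest scale `l` tends to zero.
  set N : ℝ := 12 * 4 ^ J * b₁ * (2 * δ + η * J) + 1 with hN
  have hNpos : 0 < N := by positivity
  set Bφ : ℝ := B₀ + N ^ 2 + 1 with hBφ
  set e : ℝ := K₁ + K₂ + (Bφ + m) * N with he
  have small : ∀ (p : ℝ → ℝ) (c : ℝ), Continuous p → p 0 = 0 → 0 < c →
      ∀ᶠ l in 𝓝[>] (0 : ℝ), p l < c := fun p c hp h0 hc ↦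
    ((hp.tendsto' 0 0 h0).mono_left nhdsWithin_le_nhds).eventually_lt_const hc
  obtain ⟨l, hl, c1, c2, c3, c4, c5, c6, c7⟩ : ∃ l : ℝ, 0 < l ∧
      2 * (6 * l) * (Bφ + m + 16 * N ^ 2) < 1 ∧
      2 * (2 * (6 * l)) * Q₀ + (2 * (6 * l)) ^ 2 * M ^ 2 * Bφ / 2 < 2 ∧
      (2 * (6 * l)) ^ 2 * M ^ 2 < 1 / 2 ∧ 12 * l * (K₁ + K₂) < 1 ∧
      4 * l * Q₀ + 4 * l ^ 2 * M ^ 2 * Bφ + 2 / 3 * N * e * l + 4 * l ^ 2 * e ^ 2 < 1 ∧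
      2 * l < ε ∧ l < 1 := by
    have := ((small (fun l ↦ 2 * (6 * l) * (Bφ + m + 16 * N ^ 2)) 1 (by fun_prop) (by simp)
      one_pos).and ((small (fun l ↦ 2 * (2 * (6 * l)) * Q₀ + (2 * (6 * l)) ^ 2 * M ^ 2 * Bφ / 2) 2
      (by fun_prop) (by simp) two_pos).and ((small (fun l ↦ (2 * (6 * l)) ^ 2 * M ^ 2) (1 / 2)
      (by fun_prop) (by simp) one_half_pos).and ((small (fun l ↦ 12 * l * (K₁ + K₂)) 1
      (by fun_prop) (by simp) one_pos).and ((small (fun l ↦ 4 * l * Q₀ + 4 * l ^ 2 * M ^ 2 * Bφ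
      + 2 / 3 * N * e * l + 4 * l ^ 2 * e ^ 2) 1 (by fun_prop) (by simp) one_pos).and
      ((small (fun l ↦ 2 * l) ε (by fun_prop) (by simp) hε).and
      (small (fun l ↦ l) 1 (by fun_prop) (by simp) one_pos)))))))
    obtain ⟨l, hl, hl'⟩ := (this.and self_mem_nhdsWithin).exists
    exact ⟨l, hl', hl⟩
  have h4 : ∀ j : ℕ, (1 : ℝ) ≤ 4 ^ j := fun j ↦ one_le_pow₀ (by norm_num)
  have hscale : ∀ j : ℕ, 0 < l / 4 ^ j := fun j ↦ by positivity
  have hscale_le : ∀ j : ℕ, l / 4 ^ j ≤ l := fun j ↦ div_le_self hl.le (h4 j)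
  -- So small that `|x| ≤ 2 R`, the support of the concentrated profile, lies where all the bumps
  -- `B (4 ^ j x / l)` are equal to `1`.
  set R : ℝ := l / 4 ^ J / 2 with hR
  have hRpos : 0 < R := half_pos (hscale J)
  have hRl : 2 * R ≤ l := by rw [hR]; linarith [hscale_le J]
  set f : ℝ → ℝ := fun x ↦ δ * profile B' R x with hf
  set g : ℝ → ℝ := fun x ↦ η * profileSum B' l J x with hg
  have dF : ∀ x, HasDerivAt (fun x ↦ δ * B (x / R)) (f x) x := fun x ↦
    (hasDerivAt_rescale hB x).const_mul δ
  have dG : ∀ x, HasDerivAt (fun x ↦ η * ∑ j ∈ Finset.range J, B (x / (l / 4 ^ j))) (g x) x :=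
    fun x ↦ (HasDerivAt.fun_sum fun j _ ↦ hasDerivAt_rescale hB x).const_mul η
  have cprof : ∀ r, ContDiff ℝ 1 (profile B' r) := fun r ↦
    contDiff_const.mul (hB.contDiff'.comp (contDiff_id.div_const r))
  have cf : ContDiff ℝ 1 f := contDiff_const.mul (cprof R)
  have cg : ContDiff ℝ 1 g := contDiff_const.mul (ContDiff.sum fun j _ ↦ cprof _)
  have hprof0 : ∀ r x : ℝ, 0 < r → 2 * r < |x| → profile B' r x = 0 := fun r x hr hx ↦ by
    rw [profile, hB.zero', mul_zero]
    rwa [abs_div, abs_of_pos hr, lt_div_iff₀ hr]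
  have hprof : ∀ r x : ℝ, 0 < r → |profile B' r x| ≤ r⁻¹ * b₁ := fun r x hr ↦ by
    rw [profile, abs_mul, abs_of_pos (inv_pos.2 hr)]
    exact mul_le_mul_of_nonneg_left (hb₁' _) (inv_pos.2 hr).le
  have hfL : ∀ x, |f x| ≤ 2 * 4 ^ J * b₁ * δ / l := fun x ↦ by
    rw [hf]
    simp only
    rw [abs_mul, abs_of_nonneg hδ]
    calc _ ≤ δ * (R⁻¹ * b₁) := by gcongr; exact hprof R x hRpos
      _ = _ := by rw [hR]; field_simp
  have hgL : ∀ x, |g x| ≤ 4 ^ J * b₁ * (η * J) / l := fun x ↦ by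
    rw [hg]
    simp only
    rw [abs_mul, abs_of_nonneg hη]
    calc _ ≤ η * ∑ j ∈ Finset.range J, (4 ^ J / l) * b₁ := by
          gcongr
          refine (Finset.abs_sum_le_sum_abs _ _).trans (Finset.sum_le_sum fun j hj ↦ ?_)
          refine (hprof _ x (hscale j)).trans ?_
          rw [inv_div]
          gcongr
          · norm_num
          · exact (Finset.mem_range.1 hj).le
      _ = _ := by rw [Finset.sum_const, Finset.card_range, nsmul_eq_mul]; field_simp
  have hNl : 2 * 4 ^ J * b₁ * δ / l + 4 ^ J * b₁ * (η * J) / l + (K₁ + K₂) ≤ N / (2 * (6 * l)) := by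
    rw [le_div_iff₀ (by positivity), hN]
    have e1 : (2 * 4 ^ J * b₁ * δ / l + 4 ^ J * b₁ * (η * J) / l + (K₁ + K₂)) * (2 * (6 * l))
        = 12 * 4 ^ J * b₁ * (2 * δ + η * J) + 12 * l * (K₁ + K₂) := by field_simp; ring
    linarith
  have hp1 : 0 ≤ 2 * 4 ^ J * b₁ * δ / l := by positivity
  have hp2 : 0 ≤ 4 ^ J * b₁ * (η * J) / l := by positivity
  -- The strip `|x - y| < 6 l` contains the points with `x - y = 4 l`, which belong to the time
  -- `2 l`.
  obtain ⟨u, v, q, φ, hsol, hdiag, hzero, hbound, hclose⟩ :=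
    exists_characteristic_solution (m := m) (M := M) (ρ := 6 * l) (N := N) (Q₀ := Q₀) (B₀ := B₀)
      (R := max (max 2 R₁) (max R₂ (max R₃ R₄))) hm (by positivity) hNpos
      (u₀ := fun x ↦ (f x : ℂ) + U x) (v₀ := fun x ↦ (g x : ℂ) + V x)
      (q₀ := fun x ↦ (deriv φ₀ x + φ₁ x) / 2) (φ₀ := φ₀)
      ((Complex.ofRealCLM.contDiff.comp cf).add hU) ((Complex.ofRealCLM.contDiff.comp cg).add hV)
      hq₀ hφ₀
      (fun x hx ↦ by
        simp only [max_lt_iff] at hx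
        have hfx : f x = 0 := by
          simp only [hf, hprof0 R x hRpos (by linarith [hx.1.1]), mul_zero]
        have hgx : g x = 0 := by
          simp only [hg, profileSum]
          rw [Finset.sum_eq_zero fun j _ ↦ hprof0 _ x (hscale j)
            (by linarith [hx.1.1, hscale_le j]), mul_zero]
        simp only [hfx, hgx, hR₁ x hx.1.2, hR₂ x hx.2.1, hR₃ x hx.2.2.1, hR₄ x hx.2.2.2]
        simp)
      (fun x ↦ (norm_add_le _ _).trans (by
        rw [Complex.norm_real, Real.norm_eq_abs]
        linarith [hfL x, hK₁' x]))
      (fun x ↦ (norm_add_le _ _).trans (by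
        rw [Complex.norm_real, Real.norm_eq_abs]
        linarith [hgL x, hK₂' x]))
      hQ₀' hB₀ c1.le c2.le c3.le
  have hT : 6 * l / 2 = 3 * l := by ring
  refine ⟨R, l, 3 * l, 2 * l, diracField u v, fun t x ↦ φ (x + t) (x - t), hRpos, hl, ?_,
    by positivity, c6, by linarith, ?_, ?_, ?_, ?_, ?_⟩
  · rw [← hT]
    exact hsol.isSolution fun x y hxy ↦
      ⟨(hzero x y hxy).1, (hzero x y hxy).2.1, (hzero x y hxy).2.2.2⟩
  · funext x
    simp only [diracField, add_zero, sub_zero, (hdiag x).1, (hdiag x).2.1]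
    rfl
  · funext x
    simp only [add_zero, sub_zero, (hdiag x).2.2.2]
  · funext x
    exact hsol.dt_zero (by positivity) (φ₀ := φ₀) (fun x ↦ (hdiag x).2.2.2)
      (fun x ↦ (hφ₀.differentiable (by norm_num) x).hasDerivAt) (fun x ↦ (hdiag x).2.2.1) x
  · exact hsol.contDiff_phi.continuous.comp
      (by fun_prop : Continuous fun x : ℝ ↦ (x + 2 * l, x - 2 * l))
  · intro z hz
    have hx : |R * z| ≤ 2 * R := by
      rw [abs_mul, abs_of_pos hRpos]
      linarith [mul_le_mul_of_nonneg_left hz hRpos.le]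
    -- At the time `2 l`, the far end of the characteristic is outside the supports of all profiles.
    have hb : 3 * l ≤ |R * z - 4 * l| := by
      rw [abs_sub_comm]
      have := abs_sub_abs_le_abs_sub (4 * l) (R * z)
      rw [abs_of_pos (by positivity : 0 < 4 * l)] at this
      linarith
    have hfar : ∀ r, 0 < r → r ≤ l → B ((R * z - 4 * l) / r) = 0 := fun r hr hrl ↦ by
      refine hB.zero _ ?_
      rw [abs_div, abs_of_pos hr, le_div_iff₀ hr]
      linarith
    have key := hsol.abs_sub_le (Q₀ := Q₀) (B := Bφ) (e := e) (L := N / (2 * (6 * l)))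
      (S := η * J) (a := R * z) (b := R * z - 4 * l) dF dG
      (fun x ↦ by rw [(hdiag x).2.2.1]; exact hQ₀' x) (fun x y ↦ (hbound x y).2.2)
      (fun x y ↦ by
        have := (norm_add_le _ _).trans (add_le_add (hclose x y).1 (hK₁' x))
        rw [show u x y - (f x + U x) + U x = u x y - f x by ring] at this
        linarith)
      (fun x y ↦ by
        have := (norm_add_le _ _).trans (add_le_add (hclose x y).2 (hK₂' y))
        rw [show v x y - (g y + V y) + V y = v x y - g y by ring] at this
        linarith)
      (fun x ↦ by linarith [hfL x]) (fun x ↦ by linarith [hgL x])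
      (by rw [sub_sub_cancel, abs_of_pos (by positivity)]; linarith)
      (by rw [hfar R hRpos (by linarith), mul_zero])
      (by rw [Finset.sum_eq_zero fun j _ ↦ hfar _ (hscale j) (hscale_le j), mul_zero])
      (fun x ↦ by
        by_cases hxR : 2 * R < |x|
        · simp only [hf, hprof0 R x hRpos hxR, mul_zero, zero_mul]
        · rw [Finset.sum_congr rfl (g := fun _ ↦ (1 : ℝ)) fun j hj ↦ hB.one _ (by
            rw [abs_div, abs_of_pos (hscale j), div_le_one (hscale j)]
            refine (not_lt.1 hxR).trans ?_
            rw [hR, mul_div_cancel₀ _ two_ne_zero]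
            gcongr
            · norm_num
            · exact (Finset.mem_range.1 hj).le)]
          simp
          ring)
    rw [sub_sub_cancel, abs_of_pos (by positivity : 0 < 4 * l), (hdiag _).2.2.2,
      mul_div_cancel_left₀ _ hRpos.ne'] at key
    have e1 : (Q₀ + (M ^ 2 / 4 * Bφ + (2 * (N / (2 * (6 * l))) * e + e ^ 2) / 4) * (4 * l))
        * (4 * l) = 4 * l * Q₀ + 4 * l ^ 2 * M ^ 2 * Bφ + 2 / 3 * N * e * l
          + 4 * l ^ 2 * e ^ 2 := by
      field_simp
      ring
    rw [e1] at key
    have h5 := hB₀ (R * z - 4 * l)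
    beta_reduce
    rw [show R * z - 2 * l + 2 * l = R * z by ring, show R * z - 2 * l - 2 * l = R * z - 4 * l by
      ring]
    rw [abs_le] at key h5 ⊢
    constructor <;> linarith [key.1, key.2, h5.1, h5.2]

/-! ### Smallness of the data and largeness of the solution -/

section Smul

variable {F : Type*} [NormedAddCommGroup F] [InnerProductSpace ℂ F] [CompleteSpace F]

theorem toDistribution_smul {f : ℝ → F} (hf : MemLp f 2 (volume : Measure ℝ)) (c : ℂ) :
    toDistribution (c • f) = c • toDistribution f := by
  rw [toDistribution_eq hf, toDistribution_eq (hf.const_smul c), MemLp.toLp_const_smul]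
  exact map_smul (Lp.toTemperedDistributionCLM F (volume : Measure ℝ) 2) _ _

theorem IsWeightedFourier.sobolevENorm_smul_lt {s : ℝ} {f : ℝ → F}
    (hf : MemLp f 2 (volume : Measure ℝ)) {g : Lp F 2 (volume : Measure ℝ)}
    (hg : IsWeightedFourier s (toDistribution f) g) {c C δ : ℝ} (hc : 0 ≤ c) (hC : ‖g‖ ≤ C)
    (h : Real.sqrt (2 * Real.pi) * (c * C) < δ) :
    sobolevENorm s (toDistribution fun x ↦ (c : ℂ) • f x) < ENNReal.ofReal δ := by
  change sobolevENorm s (toDistribution ((c : ℂ) • f)) < _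
  have hC0 : 0 ≤ C := (norm_nonneg _).trans hC
  rw [toDistribution_smul hf, (hg.smul (c : ℂ)).sobolevENorm_eq, norm_smul, Complex.norm_real,
    Real.norm_of_nonneg hc]
  refine (ENNReal.ofReal_lt_ofReal_iff (lt_of_le_of_lt (by positivity) h)).2
    (lt_of_le_of_lt ?_ h)
  gcongr

end Smul

theorem memLp_ofReal_smul {E : Type*} [NormedAddCommGroup E] [NormedSpace ℂ E] {f : ℝ → ℝ}
    (hf : Continuous f) (hc : HasCompactSupport f) (e : E) :
    MemLp (fun x ↦ (f x : ℂ) • e) 2 (volume : Measure ℝ) := by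
  refine Continuous.memLp_of_hasCompactSupport (by fun_prop) ?_
  refine hc.mono fun x hx ↦ ?_
  simp only [Function.mem_support] at hx ⊢
  contrapose! hx
  simp [hx]

theorem ofReal_profile_smul {E : Type*} [NormedAddCommGroup E] [NormedSpace ℂ E] (B' : ℝ → ℝ)
    (r x : ℝ) (e : E) : ((profile B' r x : ℝ) : ℂ) • e = r⁻¹ • ((B' (x / r) : ℂ) • e) := by
  rw [profile, Complex.ofReal_mul, mul_smul]
  exact Complex.coe_smul _ _

theorem memLp_profile {E : Type*} [NormedAddCommGroup E] [NormedSpace ℂ E] {B B' B'' : ℝ → ℝ}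
    (hB : IsBump B B' B'') {r : ℝ} (hr : 0 < r) (e : E) :
    MemLp (fun x ↦ ((profile B' r x : ℝ) : ℂ) • e) 2 (volume : Measure ℝ) := by
  have := (memLp_comp_add_div (memLp_ofReal_smul hB.continuous'
    (IsBump.hasCompactSupport_of hB.zero') e) hr 0).const_smul r⁻¹
  simp only [add_zero] at this
  refine (memLp_congr_ae (Filter.Eventually.of_forall fun x ↦ ?_)).1 this
  exact (ofReal_profile_smul B' r x e).symm

theorem memLp_profileSum {E : Type*} [NormedAddCommGroup E] [NormedSpace ℂ E] {B B' B'' : ℝ → ℝ}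
    (hB : IsBump B B' B'') {l : ℝ} (hl : 0 < l) (J : ℕ) (e : E) :
    MemLp (fun x ↦ ((profileSum B' l J x : ℝ) : ℂ) • e) 2 (volume : Measure ℝ) := by
  simp only [profileSum, Complex.ofReal_sum, Finset.sum_smul]
  exact memLp_finsetSum _ fun j _ ↦ memLp_profile hB (by positivity) e

/-- The size of a profile in `H^{-1/2}` has a bound that does not depend on its scale, and a sum
over `n ^ 4` scales has a size of the order of at most `n ^ 2`. -/
theorem exists_sobolevENorm_profile_lt {B B' B'' : ℝ → ℝ} (hB : IsBump B B' B'') (e : Spinor) :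
    ∃ C, 0 ≤ C ∧ (∀ R δ μ : ℝ, 0 < R → 0 ≤ δ → δ * C < μ →
      sobolevENorm (-(1 / 2)) (toDistribution fun x ↦ ((δ * profile B' R x : ℝ) : ℂ) • e)
        < ENNReal.ofReal μ) ∧
      ∀ (l η μ : ℝ) (n : ℕ), 0 < l → 0 ≤ η → η * n ^ 2 * C < μ →
        sobolevENorm (-(1 / 2)) (toDistribution fun x ↦
          ((η * profileSum B' l (n ^ 4) x : ℝ) : ℂ) • e) < ENNReal.ofReal μ := by
  have hΘ := memLp_ofReal_smul hB.continuous
    (IsBump.hasCompactSupport_of fun x hx ↦ hB.zero x (le_of_lt hx)) e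
  have hΘ' := memLp_ofReal_smul hB.continuous' (IsBump.hasCompactSupport_of hB.zero') e
  have hd : ∀ x, HasDerivAt (fun x ↦ (B x : ℂ) • e) ((B' x : ℂ) • e) x := fun x ↦
    (hB.deriv x).ofReal_comp.smul_const e
  set C₀ : ℝ := ‖hΘ.toLp _‖ * ‖hΘ'.toLp _‖ with hC₀
  refine ⟨Real.sqrt (2 * Real.pi) * Real.sqrt (3 * C₀), by positivity,
    fun R δ μ hR hδ h ↦ ?_, fun l η μ n hl hη h ↦ ?_⟩
  · obtain ⟨g, hg⟩ := exists_isWeightedFourier_scale hΘ' hR 0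
    have h1 := norm_inner_scale_le hΘ hΘ' hd hR hR hg hg
    rw [div_self hR.ne', Real.sqrt_one, one_mul, inner_self_eq_norm_sq_to_K] at h1
    have h2 : ‖g‖ ^ 2 ≤ 3 * C₀ := by
      have h3 : ‖g‖ ^ 2 ≤ C₀ := by
        rwa [norm_pow, RCLike.norm_ofReal, abs_norm] at h1
      have : 0 ≤ C₀ := by positivity
      linarith
    simp only [add_zero, ← ofReal_profile_smul] at hg
    have := hg.sobolevENorm_smul_lt (memLp_profile hB hR e) hδ (Real.le_sqrt_of_sq_le h2) (δ := μ)
      (by linarith)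
    simpa only [Complex.ofReal_mul, mul_smul] using this
  · obtain ⟨g, hg, hg2⟩ := exists_isWeightedFourier_sum_scales hΘ hΘ' hd hl (n ^ 4)
    simp only [← ofReal_profile_smul, ← Finset.sum_smul, ← Complex.ofReal_sum] at hg
    change IsWeightedFourier _
      (toDistribution fun x ↦ ((profileSum B' l (n ^ 4) x : ℝ) : ℂ) • e) g at hg
    have h2 : ‖g‖ ≤ n ^ 2 * Real.sqrt (3 * C₀) := by
      rw [← Real.sqrt_sq (by positivity : (0 : ℝ) ≤ n ^ 2), ← Real.sqrt_mul (by positivity)]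
      apply Real.le_sqrt_of_sq_le
      refine hg2.trans_eq ?_
      push_cast
      ring
    have := hg.sobolevENorm_smul_lt (memLp_profileSum hB hl (n ^ 4) e) hη h2 (δ := μ) (by linarith)
    simpa only [Complex.ofReal_mul, mul_smul] using this

end DKG
end

theorem theorem1 (m M : ℝ) (hm : 0 ≤ m) (hM : 0 ≤ M)
    (ψ₀ : 𝓢'(ℝ, DKG.Spinor)) (φ₀ φ₁ : 𝓢'(ℝ, ℂ))
    (hψ₀ : MemSobolev (-(1 / 2)) 2 ψ₀)
    (hφ₀ : MemSobolev (1 / 2) 2 φ₀) (hφ₁ : MemSobolev (-(1 / 2)) 2 φ₁)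
    (hφ₀_real : DKG.IsRealDistribution φ₀) (hφ₁_real : DKG.IsRealDistribution φ₁)
    (ε : ℝ) (hε : 0 < ε) :
    ∃ (T tε : ℝ) (ψ : ℝ → ℝ → DKG.Spinor) (φ : ℝ → ℝ → ℝ),
      DKG.IsSolution m M (-(1 / 2)) (1 / 2) T ψ φ ∧
      0 < tε ∧ tε < ε ∧ tε < T ∧
      DKG.sobolevENorm (-(1 / 2)) (DKG.toDistribution (ψ 0) - ψ₀)
        + DKG.sobolevENorm (1 / 2) (DKG.toDistribution (DKG.cplx (φ 0)) - φ₀)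
        + DKG.sobolevENorm (-(1 / 2)) (DKG.toDistribution (DKG.cplx (DKG.dt φ 0)) - φ₁)
        < ENNReal.ofReal ε ∧
      ENNReal.ofReal ε⁻¹ < DKG.sobolevENorm (1 / 2) (DKG.toDistribution (DKG.cplx (φ tε))) := by
  obtain ⟨B, B', B'', hB⟩ := DKG.exists_isBump
  have hε8 : 0 < ε / 8 := by positivity
  obtain ⟨ψb, hψb, cψb, nψb⟩ := DKG.exists_smooth_sobolevENorm_sub_lt (by norm_num) hψ₀ hε8
  obtain ⟨φb, hφb, cφb, nφb⟩ :=
    DKG.exists_real_smooth_sobolevENorm_sub_lt le_rfl hφ₀ hφ₀_real hε8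
  obtain ⟨χb, hχb, cχb, nχb⟩ :=
    DKG.exists_real_smooth_sobolevENorm_sub_lt (by norm_num) hφ₁ hφ₁_real hε8
  obtain ⟨B₀, hB₀, hB₀'⟩ := DKG.exists_bound_of_hasCompactSupport hφb.continuous cφb
  obtain ⟨C₁, hC₁, hsmall₁, -⟩ := DKG.exists_sobolevENorm_profile_lt hB DKG.spinorFst
  obtain ⟨C₂, hC₂, -, hsmall₂⟩ := DKG.exists_sobolevENorm_profile_lt hB DKG.spinorSnd
  have hψb0 : ∀ i, ContDiff ℝ 1 (fun x ↦ ψb x i) := fun i ↦ by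
    have : ContDiff ℝ 1 ψb := hψb.of_le (by exact_mod_cast le_top)
    exact ((EuclideanSpace.proj i : DKG.Spinor →L[ℂ] ℂ).restrictScalars ℝ).contDiff.comp this
  have cψb0 : ∀ i, HasCompactSupport (fun x ↦ ψb x i) := fun i ↦
    cψb.comp_left (g := fun w : DKG.Spinor ↦ w i) rfl
  have m' := DKG.memLp_ofReal_smul hB.continuous' (DKG.IsBump.hasCompactSupport_of hB.zero') (1 : ℂ)
  have m'' := DKG.memLp_ofReal_smul hB.continuous''
    (DKG.IsBump.hasCompactSupport_of hB.zero'') (1 : ℂ)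
  simp only [smul_eq_mul, mul_one] at m' m''
  set D : ℝ := Real.sqrt (‖MemLp.toLp _ m'‖ * ‖MemLp.toLp _ m''‖) with hD
  have ha := hB.integral_sq_pos
  -- The size of the concentrated part of the first component.
  obtain ⟨δ, hδ, hδC⟩ : ∃ δ : ℝ, 0 < δ ∧ δ * C₁ < ε / 8 := by
    refine ⟨ε / 8 / (C₁ + 1), by positivity, ?_⟩
    rw [div_mul_eq_mul_div, div_lt_iff₀ (by positivity)]
    nlinarith
  -- The number `n ^ 4` of scales in the second component: its size is of the order `1 / n`, that of
  -- the solution is of the order `n`.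
  obtain ⟨n, hn, hnC, hnD⟩ : ∃ n : ℕ, 0 < n ∧ 1 / (n : ℝ) * C₂ < ε / 8 ∧
      ε⁻¹ * D < n / 4 * δ * (∫ x, B' x ^ 2) - (B₀ + 1) * ∫ x, |B'' x| := by
    have t1 : Filter.Tendsto (fun n : ℕ ↦ 1 / (n : ℝ) * C₂) Filter.atTop (𝓝 0) := by
      simpa using tendsto_one_div_atTop_nhds_zero_nat.mul_const C₂
    have t2 : Filter.Tendsto (fun n : ℕ ↦ n / 4 * δ * (∫ x, B' x ^ 2) - (B₀ + 1) * ∫ x, |B'' x|)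
        Filter.atTop Filter.atTop := by
      refine Filter.tendsto_atTop_add_const_right _ _ ?_
      exact ((tendsto_natCast_atTop_atTop.atTop_div_const (by norm_num)).atTop_mul_const
        hδ).atTop_mul_const ha
    obtain ⟨n, h1, h2, h3⟩ := ((Filter.eventually_gt_atTop 0).and
      ((t1.eventually_lt_const hε8).and (t2.eventually_gt_atTop (ε⁻¹ * D)))).exists
    exact ⟨n, h1, h2, h3⟩
  have hn' : (0 : ℝ) < n := by exact_mod_cast hn
  obtain ⟨R, l, T, τ, ψ, φ, hR, hl, hsol, hτ, hτε, hτT, hψ, hφ, hdφ, hφc, hbump⟩ :=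
    DKG.exists_solution_with_bump (M := M) hm hB ((hψb0 0).add (hψb0 1)) ((hψb0 0).sub (hψb0 1))
      (by exact_mod_cast contDiff_infty.1 hφb 2) (by exact_mod_cast contDiff_infty.1 hχb 1)
      ((cψb0 0).add (cψb0 1)) ((cψb0 0).sub (cψb0 1)) cφb cχb hB₀' hδ.le
      (η := 1 / n ^ 3) (by positivity) hε (n ^ 4)
  have hT : 0 < T := hτ.trans hτT
  refine ⟨T, τ, ψ, φ, hsol, hτ, hτε, hτT, ?_, ?_⟩
  · rw [hφ, hdφ]
    have n₁ := hsmall₁ R δ (ε / 8) hR hδ.le hδC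
    have n₂ := hsmall₂ l (1 / n ^ 3) (ε / 8) n hl (by positivity)
      (by rw [show (1 : ℝ) / n ^ 3 * n ^ 2 = 1 / n by field_simp]; exact hnC)
    set X : ℝ → DKG.Spinor := fun x ↦ ((δ * DKG.profile B' R x : ℝ) : ℂ) • DKG.spinorFst with hX
    set Y : ℝ → DKG.Spinor := fun x ↦
      ((1 / n ^ 3 * DKG.profileSum B' l (n ^ 4) x : ℝ) : ℂ) • DKG.spinorSnd with hY
    have mX : MemLp X 2 (volume : Measure ℝ) := by
      simp only [hX, Complex.ofReal_mul, mul_smul]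
      exact (DKG.memLp_profile hB hR DKG.spinorFst).const_smul (δ : ℂ)
    have mY : MemLp Y 2 (volume : Measure ℝ) := by
      simp only [hY, Complex.ofReal_mul, mul_smul]
      exact (DKG.memLp_profileSum hB hl (n ^ 4) DKG.spinorSnd).const_smul ((1 / n ^ 3 : ℝ) : ℂ)
    have mψb : MemLp ψb 2 (volume : Measure ℝ) := hψb.continuous.memLp_of_hasCompactSupport cψb
    have hsum : ψ 0 = ψb + (X + Y) := by
      rw [hψ]
      funext x
      ext i
      fin_cases i <;> simp [hX, hY, DKG.spinorFst, DKG.spinorSnd] <;> ring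
    rw [hsum, DKG.toDistribution_add mψb (mX.add mY), DKG.toDistribution_add mX mY,
      add_sub_right_comm]
    calc _ ≤ ENNReal.ofReal (ε / 8) + (ENNReal.ofReal (ε / 8) + ENNReal.ofReal (ε / 8))
          + ENNReal.ofReal (ε / 8) + ENNReal.ofReal (ε / 8) := by
          gcongr
          exact (DKG.sobolevENorm_add_le _ _ _).trans (add_le_add nψb.le
            ((DKG.sobolevENorm_add_le _ _ _).trans (add_le_add n₁.le n₂.le)))
      _ = ENNReal.ofReal (ε / 8 + (ε / 8 + ε / 8) + ε / 8 + ε / 8) := by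
          rw [ENNReal.ofReal_add, ENNReal.ofReal_add, ENNReal.ofReal_add, ENNReal.ofReal_add] <;>
            positivity
      _ < ENNReal.ofReal ε := by
          rw [ENNReal.ofReal_lt_ofReal_iff hε]
          linarith
  · have hmem : τ ∈ Set.Ioo (-T) T := ⟨by linarith, hτT⟩
    obtain ⟨g, hg⟩ :=
      DKG.memSobolev_iff_exists_isWeightedFourier.1 (hsol.curve_phi.memSobolev τ hmem)
    have key := hg.bump_le_norm hB.deriv hB.deriv' hB.continuous''
      (DKG.IsBump.hasCompactSupport_of fun x hx ↦ hB.zero x (le_of_lt hx)) hB.zero'' m' m'' hφc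
      (hsol.curve_phi.memLp τ hmem) hR (c := τ) (A := n / 4 * δ) (K := B₀ + 1) (fun z hz ↦ by
        have := hbump z hz
        rwa [show (1 : ℝ) / n ^ 3 * ((n ^ 4 : ℕ) : ℝ) / 4 * δ = n / 4 * δ by
          push_cast; field_simp] at this)
    have h1 : ε⁻¹ < ‖g‖ := lt_of_mul_lt_mul_right (hnD.trans_le key) (Real.sqrt_nonneg _)
    rw [hg.sobolevENorm_eq, ENNReal.ofReal_lt_ofReal_iff (by
      have := (inv_pos.2 hε).trans h1; positivity)]
    have h2 : 1 ≤ Real.sqrt (2 * Real.pi) := by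
      rw [Real.one_le_sqrt]
      linarith [Real.pi_gt_three]
    nlinarith [norm_nonneg g]
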